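/- **Theorem 1.3.** Let $\mathfrak L_{\rm ring}=\{+,-,\cdot,0,1\}$ be the language of rings and $\mathfrak L_{\rm ring}(t)$ its expansion by one constant symbol. A *fragment* is a set of formulas that contains $\top,\bot$ and is closed under conjunction, disjunction and substitution of variables for free variables. For $Q\in\{\forall,\exists\}$ and a set of formulas $F$ put $Q_1[F]=\{Qx\,\psi:\psi\in F\}\cup F$ and $Q_{n+1}[F]=Q_1[Q_n[F]]$; let $Q_nF$ be the smallest fragment containing $Q_n[F]$; put $Q^1F=Q_1F$, $Q^{n+1}F=Q_1Q^nF$ and $QF=\bigcup_{n\ge1}Q^nF$. Let $\exists=\exists F_0$, where $F_0$ is the set of quantifier-free formulas; this gives the fragments $\exists$, $\forall_n\exists=\forall_n(\exists F_0)$ and $\forall\exists=\forall(\exists F_0)$. For a field $K$ let ${\rm Th}_F(K)$ be the set of $\mathfrak L_{\rm ring}$-sentences in $F$ that hold in $K$, and for $a\in K$ let ${\rm Th}_F(K,a)$ be the set of $\mathfrak L_{\rm ring}(t)$-sentences in $F$ that hold in $K$ when the constant symbol is interpreted as $a$. Such a theory is *decidable* if the set of Gödel numbers of its elements is computable. A subset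 of $K$ is *existentially $\emptyset$-definable* if it is defined in $K$ by an $\mathfrak L_{\rm ring}$-formula $\gamma(x)$ in $\exists$ without parameters. Let $k,l$ be fields, and let $k(t),l(t)$ be the rational function fields in one variable $t$. (a) If ${\rm Th}_\exists(k)\subseteq{\rm Th}_\exists(l)$, then ${\rm Th}_\exists(k(t),t)\subseteq{\rm Th}_\exists(l(t),t)$. (b) If ${\rm Th}_{\forall_1\exists}(k)\subseteq{\rm Th}_{\forall_1\exists}(l)$, then ${\rm Th}_{\forall_1\exists}(k(t))\subseteq{\rm Th}_{\forall_1\exists}(l(t))$. (c) If ${\rm Th}_\exists(k(t),t)$ is decidable and ${\rm Th}_{\forall_1\exists}(k)$ is decidable, then ${\rm Th}_{\forall_1\exists}(k(t))$ is decidable. (d) If ${\rm Th}_{\forall_1\exists}(k(t))$ is decidable and $k$ is existentially $\emptyset$-definable in $k(t)$, then ${\rm Th}_\exists(k(t),t)$ is decidable. (e) Suppose that $k,l$ are perfect of positive characteristic. If ${\rm Th}_{\forall_1\exists}(k(t),t)\subseteq{\rm Th}_{\forall_1\exists}(l(t),t)$, then ${\rm Th}_{\forall\exists}(k(t),t)\subseteq{\rm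 Th}_{\forall\exists}(l(t),t)$; and if ${\rm Th}_{\forall_1\exists}(k(t),t)$ is decidable, then so is ${\rm Th}_{\forall\exists}(k(t),t)$. If ${\rm Th}_{\forall_2\exists}(k(t))\subseteq{\rm Th}_{\forall_2\exists}(l(t))$, then ${\rm Th}_{\forall\exists}(k(t))\subseteq{\rm Th}_{\forall\exists}(l(t))$; and if ${\rm Th}_{\forall_2\exists}(k(t))$ is decidable, then so is ${\rm Th}_{\forall\exists}(k(t))$. -/

import Mathlib

namespace FieldFragments

open FirstOrder FirstOrder.Language

universe u v w

/-! ### Fragments of first-order formulas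

Formulas are Mathlib's `L.BoundedFormula α n`, whose free variables are those in `α` together with
`n` variables `x_0, …, x_{n-1}`; a quantifier binds the last of these.  The connectives `⊓`, `⊔`
and the quantifier `∃` are Mathlib's abbreviations. -/

/-- A set of formulas with free variables in `α` and in `x_0, …, x_{n-1}`, for every `n`. -/
abbrev FormulaSet (L : FirstOrder.Language.{u, v}) (α : Type w) : Type _ :=
  ∀ n : ℕ, Set (L.BoundedFormula α n)

inductive Quantifier
  | all
  | ex

/-- `Qx ψ`. -/
def Quantifier.bind {L : FirstOrder.Language.{u, v}} {α : Type w} {n : ℕ} :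
    Quantifier → L.BoundedFormula α (n + 1) → L.BoundedFormula α n
  | .all, ψ => ψ.all
  | .ex, ψ => ψ.ex

/-- `F₀`: the quantifier-free formulas. -/
def qfFormulas (L : FirstOrder.Language.{u, v}) (α : Type w) : FormulaSet L α :=
  fun _ => {φ | φ.IsQF}

/-- `Q₁[F] = {Qx ψ : ψ ∈ F} ∪ F`. -/
def bracketOne {L : FirstOrder.Language.{u, v}} {α : Type w} (Q : Quantifier) (F : FormulaSet L α) :
    FormulaSet L α :=
  fun n => {φ | ∃ ψ ∈ F (n + 1), φ = Q.bind ψ} ∪ F n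

/-- `Qₙ[F]`, where `Qₙ₊₁[F] = Q₁[Qₙ[F]]`. -/
def bracket {L : FirstOrder.Language.{u, v}} {α : Type w} (Q : Quantifier) (n : ℕ) (F : FormulaSet L α) :
    FormulaSet L α :=
  (bracketOne Q)^[n] F

/-- The smallest set of formulas that contains `F`, `⊤`, `⊥` and is closed under conjunction and
disjunction.  All the sets `F` to which this is applied below are closed under substitution of
variables for free variables (the quantifier-free formulas are, and bound variables carry no
names here, so that `Q₁[·]` and the closure itself preserve this property).  So this is
the smallest fragment containing `F`: the smallest set containing `F`, `⊤`, `⊥` and closed under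
conjunction, disjunction and substitution of variables. -/
inductive FragmentClosure {L : FirstOrder.Language.{u, v}} {α : Type w} (F : FormulaSet L α) :
    ∀ n : ℕ, L.BoundedFormula α n → Prop
  | base {n : ℕ} {φ : L.BoundedFormula α n} : φ ∈ F n → FragmentClosure F n φ
  | top {n : ℕ} : FragmentClosure F n ⊤
  | bot {n : ℕ} : FragmentClosure F n ⊥
  | inf {n : ℕ} {φ ψ : L.BoundedFormula α n} :
      FragmentClosure F n φ → FragmentClosure F n ψ → FragmentClosure F n (φ ⊓ ψ)
  | sup {n : ℕ} {φ ψ : L.BoundedFormula α n} :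
      FragmentClosure F n φ → FragmentClosure F n ψ → FragmentClosure F n (φ ⊔ ψ)

/-- `Qₙ F`: the smallest fragment containing `Qₙ[F]`. -/
def lowerFragment {L : FirstOrder.Language.{u, v}} {α : Type w} (Q : Quantifier) (n : ℕ)
    (F : FormulaSet L α) : FormulaSet L α :=
  fun m => {φ | FragmentClosure (bracket Q n F) m φ}

/-- `Qⁿ F`, where `Q¹ F = Q₁ F` and `Qⁿ⁺¹ F = Q₁ (Qⁿ F)`. -/
def upperFragment {L : FirstOrder.Language.{u, v}} {α : Type w} (Q : Quantifier) (n : ℕ)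
    (F : FormulaSet L α) : FormulaSet L α :=
  (lowerFragment Q 1)^[n] F

/-- `Q F`: the union of the `Qⁿ F`, `n ≥ 1`. -/
def quantFragment {L : FirstOrder.Language.{u, v}} {α : Type w} (Q : Quantifier) (F : FormulaSet L α) :
    FormulaSet L α :=
  fun m => {φ | ∃ n : ℕ, 1 ≤ n ∧ φ ∈ upperFragment Q n F m}

/-- The fragment `∃` of existential formulas. -/
def exFragment (L : FirstOrder.Language.{u, v}) (α : Type w) : FormulaSet L α :=
  quantFragment .ex (qfFormulas L α)

/-- The fragment `∀ₙ∃`. -/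
def allNExFragment (n : ℕ) (L : FirstOrder.Language.{u, v}) (α : Type w) : FormulaSet L α :=
  lowerFragment .all n (exFragment L α)

/-- The fragment `∀∃`. -/
def allExFragment (L : FirstOrder.Language.{u, v}) (α : Type w) : FormulaSet L α :=
  quantFragment .all (exFragment L α)

/-! ### Theories of fields and of rational function fields -/

/-- `Th_F(M)`: the sentences of `F` that hold in `M`. -/
def fragmentTheory {L : FirstOrder.Language.{u, v}} (F : FormulaSet L Empty) (M : Type w) [L.Structure M] :
    Set L.Sentence :=
  {φ | φ ∈ F 0 ∧ M ⊨ φ}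

/-- `Th_F(K)` for a field `K`, in the language of rings. -/
def fieldTheory (F : FormulaSet FirstOrder.Language.ring Empty) (K : Type w) [Field K] :
    Set FirstOrder.Language.ring.Sentence :=
  letI := Ring.compatibleRingOfRing K
  fragmentTheory F K

/-- The language of rings with one additional constant symbol. -/
abbrev ringWithConst : FirstOrder.Language.{0, 0} := FirstOrder.Language.ring[[Unit]]

/-- `Th_F(K, a)` for an element `a` of a field `K`: the language is that of rings with an
additional constant symbol, which is interpreted as `a`. -/
def pointedFieldTheory (F : FormulaSet ringWithConst Empty) (K : Type w) [Field K] (a : K) :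
    Set ringWithConst.Sentence :=
  letI := Ring.compatibleRingOfRing K
  letI : (constantsOn Unit).Structure K := constantsOn.structure fun _ => a
  fragmentTheory F K

/-- `S` is existentially `∅`-definable in the field `K`: it is defined by an existential formula
in one free variable in the language of rings. -/
def ExistentiallyDefinable (K : Type w) [Field K] (S : Set K) : Prop :=
  letI := Ring.compatibleRingOfRing K
  ∃ γ : FirstOrder.Language.ring.Formula (Fin 1), γ ∈ exFragment FirstOrder.Language.ring (Fin 1) 0 ∧
    S = {x : K | γ.Realize fun _ => x}

/-! ### Gödel numbering and decidability -/

/-- A presentation of a language: an injective numbering of its function symbols (constants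
included) and one of its relation symbols. -/
structure Presentation (L : FirstOrder.Language.{u, v}) where
  funcNum : (Σ n, L.Functions n) → ℕ
  funcNum_injective : Function.Injective funcNum
  relNum : (Σ n, L.Relations n) → ℕ
  relNum_injective : Function.Injective relNum

/-- Gödel number of a term in the variables `x_0, …, x_{n-1}`. -/
def Presentation.termCode {L : FirstOrder.Language.{u, v}} (P : Presentation L) {n : ℕ} :
    L.Term (Empty ⊕ Fin n) → ℕ
  | .var x => 2 * Sum.elim Empty.elim (fun i : Fin n => (i : ℕ)) x
  | .func f ts =>
      2 * Nat.pair (P.funcNum ⟨_, f⟩)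
        (Encodable.encode (List.ofFn fun i => P.termCode (ts i))) + 1

/-- Gödel number of a formula in the variables `x_0, …, x_{n-1}`. -/
def Presentation.code {L : FirstOrder.Language.{u, v}} (P : Presentation L) :
    ∀ {n : ℕ}, L.BoundedFormula Empty n → ℕ
  | _, .falsum => 0
  | _, .equal s t => 4 * Nat.pair (P.termCode s) (P.termCode t) + 1
  | _, .rel R ts =>
      4 * Nat.pair (P.relNum ⟨_, R⟩)
        (Encodable.encode (List.ofFn fun i => P.termCode (ts i))) + 2
  | _, .imp φ ψ => 4 * Nat.pair (P.code φ) (P.code ψ) + 3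
  | _, .all φ => 4 * P.code φ + 4

/-- A set of sentences is decidable if the set of its Gödel numbers is. -/
def DecidableTheory {L : FirstOrder.Language.{u, v}} (P : Presentation L) (T : Set L.Sentence) : Prop :=
  ComputablePred fun m : ℕ => ∃ φ ∈ T, P.code φ = m

def ringFuncNum : ∀ {n : ℕ}, ringFunc n → ℕ
  | _, .add => 0
  | _, .mul => 1
  | _, .neg => 2
  | _, .zero => 3
  | _, .one => 4

theorem ringFuncNum_lt {n : ℕ} (f : ringFunc n) : ringFuncNum f < 5 := by
  cases f <;> simp [ringFuncNum]

theorem ringFuncNum_injective {m n : ℕ} (f : ringFunc m) (g : ringFunc n)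
    (h : ringFuncNum f = ringFuncNum g) : (⟨m, f⟩ : Σ n, ringFunc n) = ⟨n, g⟩ := by
  cases f <;> cases g <;> first | rfl | simp [ringFuncNum] at h

/-- The presentation of the language of rings; as the language is finite, its choice does not
affect which sets of sentences are decidable. -/
def ringPresentation : Presentation FirstOrder.Language.ring where
  funcNum f := ringFuncNum (n := f.1) f.2
  funcNum_injective := fun ⟨_, f⟩ ⟨_, g⟩ h => ringFuncNum_injective f g h
  relNum R := Empty.elim R.2
  relNum_injective := fun R => Empty.elim R.2

/-- The presentation of the language of rings with one additional constant symbol. -/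
def ringWithConstPresentation : Presentation ringWithConst where
  funcNum f := Sum.elim (fun g : ringFunc f.1 => ringFuncNum g) (fun _ => 5) f.2
  funcNum_injective := by
    rintro ⟨m, f | f⟩ ⟨n, g | g⟩ h
    · have := ringFuncNum_injective f g h
      obtain ⟨rfl, h2⟩ := Sigma.mk.inj this
      rw [eq_of_heq h2]
    · exact absurd h (ringFuncNum_lt f).ne
    · exact absurd h.symm (ringFuncNum_lt g).ne
    · match m, n, f, g with
      | 0, 0, (), () => rfl
  relNum R := Sum.elim Empty.elim Empty.elim R.2
  relNum_injective := fun R => Sum.elim Empty.elim Empty.elim R.2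

end FieldFragments

namespace FieldFragments

open FirstOrder FirstOrder.Language

universe u v w

/-! The proof rests on three algebraic facts, combined with computations on Gödel numbers.

Transfer of existential truth. Existential formulas are preserved by field homomorphisms
(`pointedHolds_map`). If every existential sentence true in `k` holds in `l`, then each finite part
of the addition and multiplication tables of `k` is realized in `l`, so `k` embeds in an ultrapower
of `l` (`exists_ringHom_germ_of_exTheory_subset`). This embedding extends to one of `k(t)` into the
ultrapower of `l(t)` that sends `t` to the diagonal `t` (`exists_ratFunc_hom_germ`), and Łoś's
theorem (`pointedHolds_germ`) brings truth down to `l(t)`.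

One universal quantifier. Every nonconstant `u` in `k(t)` is transcendental over `k`, so `t ↦ u`
defines an endomorphism over `k`. For existential `φ`, the sentence `∀ x φ(x)` therefore holds in
`k(t)` iff `φ(t)` holds and `φ(c)` holds for all constants `c` (`ringHolds_all_ratFunc`). The first
condition belongs to the existential theory of `(k(t), t)`. The second is `k ⊨ ∀ x φ(x)` if `k` is
infinite, as `k` is then existentially closed in `k(t)` (`ringHolds_of_ratFunc`). If `k` is finite,
the inclusion of theories forces `k ≅ l`, and for decidability each constant is described up to
automorphism by its finite diagram (`ringHolds_const_iff_diagram`). Conversely, if `k` is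
existentially definable, an existential `φ(t)` is equivalent to `∀ x (x ∈ k ∨ φ(x))`
(`pointedHolds_ratFunc_iff_all`).

Several universal quantifiers. If `k` is perfect of characteristic `p`, then `K = k(t)` has degree
`p` over `K ^ p`, and the powers `1, s, …, s ^ (p - 1)` form a basis for every `s` outside `K ^ p`.
Taking the first two coordinates `w_0, w_1` of `z = ∑ s ^ i * w_i ^ p` gives an existentially
definable surjection from `K` to `K × K` (`isPairing_ratFunc`), which merges all universal
quantifiers into one (`MergeRel.pointedHolds_iff`). In `(K, t)` one takes `s = t`; without the
constant, a second universal quantifier ranges over all `s` outside `K ^ p`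
(`ringHolds_ratFunc_iff_forallBase`).

For decidability, the fragments are recognized by a primitive recursive test (`formValid_iff`), and
the translations of sentences are primitive recursive on Gödel numbers (`code_substFormula`,
`exists_mergeRel`). -/

/-! ### The fragments as inductive predicates -/

/-- The fragments that occur, on one scale: `0` quantifier-free, `1` existential, `2` the
fragment `∀∃`, `3` the fragment `∀₁∃`. -/
inductive Level {L : FirstOrder.Language.{u, v}} {α : Type w} :
    ℕ → ∀ {n : ℕ}, L.BoundedFormula α n → Prop
  | qf {l n : ℕ} {φ : L.BoundedFormula α n} : φ.IsQF → Level l φ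
  | ex {l n : ℕ} {φ : L.BoundedFormula α (n + 1)} : 1 ≤ l → Level 1 φ → Level l φ.ex
  | allMany {n : ℕ} {φ : L.BoundedFormula α (n + 1)} : Level 2 φ → Level 2 φ.all
  | allOnce {n : ℕ} {φ : L.BoundedFormula α (n + 1)} : Level 1 φ → Level 3 φ.all
  | inf {l n : ℕ} {φ ψ : L.BoundedFormula α n} : Level l φ → Level l ψ → Level l (φ ⊓ ψ)
  | sup {l n : ℕ} {φ ψ : L.BoundedFormula α n} : Level l φ → Level l ψ → Level l (φ ⊔ ψ)

section

variable {L : FirstOrder.Language.{u, v}} {α : Type w} {n : ℕ}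

/-- Restricted to `l ≤ 1` because the numbering is not an inclusion order beyond that: level `2`
admits iterated `∀`, level `3` does not. -/
theorem Level.mono {l l' : ℕ} {φ : L.BoundedFormula α n} (h : Level l φ) (hl : l ≤ 1)
    (hll : l ≤ l') : Level l' φ := by
  induction h with
  | qf h => exact .qf h
  | ex h1 h _ => exact .ex (h1.trans hll) h
  | allMany => omega
  | allOnce => omega
  | inf _ _ h1 h2 => exact .inf (h1 hl hll) (h2 hl hll)
  | sup _ _ h1 h2 => exact .sup (h1 hl hll) (h2 hl hll)

theorem isQF_of_level_zero {l : ℕ} {φ : L.BoundedFormula α n} (h : Level l φ) (hl : l = 0) :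
    φ.IsQF := by
  induction h with
  | qf h => exact h
  | ex h1 => omega
  | allMany => omega
  | allOnce => omega
  | inf _ _ h1 h2 => exact (h1 hl).inf (h2 hl)
  | sup _ _ h1 h2 => exact (h1 hl).sup (h2 hl)

theorem FragmentClosure.level {F : FormulaSet L α} {l : ℕ}
    (h : ∀ n, ∀ φ ∈ F n, Level l φ)
    {φ : L.BoundedFormula α n} (hφ : FragmentClosure F n φ) : Level l φ := by
  induction hφ with
  | base hb => exact h _ _ hb
  | top => exact .qf BoundedFormula.IsQF.top
  | bot => exact .qf BoundedFormula.isQF_bot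
  | inf _ _ h1 h2 => exact .inf h1 h2
  | sup _ _ h1 h2 => exact .sup h1 h2

theorem upperFragment_succ (Q : Quantifier) (m : ℕ) (F : FormulaSet L α) :
    upperFragment Q (m + 1) F = lowerFragment Q 1 (upperFragment Q m F) :=
  Function.iterate_succ_apply' ..

theorem upperFragment_mono {Q : Quantifier} {m m' : ℕ} (h : m ≤ m') (F : FormulaSet L α) (n : ℕ) :
    upperFragment Q m F n ⊆ upperFragment Q m' F n := by
  induction h with
  | refl => rfl
  | step _ ih =>
    rw [upperFragment_succ]
    exact ih.trans fun φ hφ => .base (.inr hφ)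

theorem mem_quantFragment_of_mem {Q : Quantifier} {F : FormulaSet L α}
    {φ : L.BoundedFormula α n} (h : φ ∈ F n) : φ ∈ quantFragment Q F n :=
  ⟨1, le_rfl, upperFragment_mono (Nat.zero_le 1) F n h⟩

theorem bind_mem_quantFragment {Q : Quantifier} {F : FormulaSet L α}
    {φ : L.BoundedFormula α (n + 1)} (h : φ ∈ quantFragment Q F (n + 1)) :
    Q.bind φ ∈ quantFragment Q F n := by
  obtain ⟨m, _, h⟩ := h
  refine ⟨m + 1, by omega, ?_⟩
  rw [upperFragment_succ]
  exact .base (.inl ⟨φ, h, rfl⟩)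

/-- The fragments `Qᵐ F` increase with `m`, so two members lie in a common one; the connectives then
become available one step later. -/
theorem mem_quantFragment_pair {Q : Quantifier} {F : FormulaSet L α} {φ ψ : L.BoundedFormula α n}
    (h1 : φ ∈ quantFragment Q F n) (h2 : ψ ∈ quantFragment Q F n) :
    ∃ m, FragmentClosure (bracket Q 1 (upperFragment Q m F)) n φ ∧
      FragmentClosure (bracket Q 1 (upperFragment Q m F)) n ψ := by
  obtain ⟨m, _, h1⟩ := h1
  obtain ⟨m', _, h2⟩ := h2
  exact ⟨max m m', .base (.inr (upperFragment_mono (le_max_left _ _) _ _ h1)),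
    .base (.inr (upperFragment_mono (le_max_right _ _) _ _ h2))⟩

theorem inf_mem_quantFragment {Q : Quantifier} {F : FormulaSet L α} {φ ψ : L.BoundedFormula α n}
    (h1 : φ ∈ quantFragment Q F n) (h2 : ψ ∈ quantFragment Q F n) :
    φ ⊓ ψ ∈ quantFragment Q F n := by
  obtain ⟨m, h1, h2⟩ := mem_quantFragment_pair h1 h2
  refine ⟨m + 1, by omega, ?_⟩
  rw [upperFragment_succ]
  exact .inf h1 h2

theorem sup_mem_quantFragment {Q : Quantifier} {F : FormulaSet L α} {φ ψ : L.BoundedFormula α n}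
    (h1 : φ ∈ quantFragment Q F n) (h2 : ψ ∈ quantFragment Q F n) :
    φ ⊔ ψ ∈ quantFragment Q F n := by
  obtain ⟨m, h1, h2⟩ := mem_quantFragment_pair h1 h2
  refine ⟨m + 1, by omega, ?_⟩
  rw [upperFragment_succ]
  exact .sup h1 h2

theorem level_of_mem_quantFragment {Q : Quantifier} {F : FormulaSet L α} {l : ℕ}
    (hF : ∀ n, ∀ φ ∈ F n, Level l φ)
    (hQ : ∀ n (φ : L.BoundedFormula α (n + 1)), Level l φ → Level l (Q.bind φ))
    {φ : L.BoundedFormula α n} (h : φ ∈ quantFragment Q F n) : Level l φ := by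
  obtain ⟨m, -, h⟩ := h
  suffices ∀ m n, ∀ φ ∈ upperFragment Q m F n, Level l φ from this _ _ _ h
  intro m
  induction m with
  | zero => exact hF
  | succ m ih =>
    intro n φ hφ
    rw [upperFragment_succ] at hφ
    refine FragmentClosure.level ?_ hφ
    rintro n φ (⟨ψ, hψ, rfl⟩ | hφ)
    · exact hQ _ _ (ih _ _ hψ)
    · exact ih _ _ hφ

/-- Replaces the union of iterated closures by a predicate on which one can do induction: level `1`
is closed under `∃`, and conversely each use of `∃` or of a connective costs one more iteration. -/
theorem mem_exFragment {φ : L.BoundedFormula α n} : φ ∈ exFragment L α n ↔ Level 1 φ := by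
  constructor
  · exact level_of_mem_quantFragment (Q := .ex) (fun _ _ h => .qf h) fun _ _ h => .ex le_rfl h
  · intro h
    generalize hl : 1 = l at h
    induction h with
    | qf h => exact mem_quantFragment_of_mem h
    | ex h1 h ih => exact bind_mem_quantFragment (ih rfl)
    | allMany => omega
    | allOnce => omega
    | inf _ _ h1 h2 => exact inf_mem_quantFragment (h1 hl) (h2 hl)
    | sup _ _ h1 h2 => exact sup_mem_quantFragment (h1 hl) (h2 hl)

theorem mem_allExFragment {φ : L.BoundedFormula α n} : φ ∈ allExFragment L α n ↔ Level 2 φ := by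
  constructor
  · exact level_of_mem_quantFragment (Q := .all)
      (fun _ _ h => (mem_exFragment.1 h).mono le_rfl one_le_two) fun _ _ h => .allMany h
  · intro h
    generalize hl : 2 = l at h
    induction h with
    | qf h => exact mem_quantFragment_of_mem (mem_exFragment.2 (.qf h))
    | ex h1 h ih => exact mem_quantFragment_of_mem (mem_exFragment.2 (.ex le_rfl h))
    | allMany h ih => exact bind_mem_quantFragment (ih rfl)
    | allOnce => omega
    | inf _ _ h1 h2 => exact inf_mem_quantFragment (h1 hl) (h2 hl)
    | sup _ _ h1 h2 => exact sup_mem_quantFragment (h1 hl) (h2 hl)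

/-- A single bracket step precedes the closure, so the body of each `∀` is existential. -/
theorem mem_allNExFragment_one {φ : L.BoundedFormula α n} :
    φ ∈ allNExFragment 1 L α n ↔ Level 3 φ := by
  constructor
  · refine FragmentClosure.level ?_
    rintro n φ (⟨ψ, hψ, rfl⟩ | hφ)
    · exact .allOnce (mem_exFragment.1 hψ)
    · exact (mem_exFragment.1 hφ).mono le_rfl (by omega)
  · intro h
    generalize hl : 3 = l at h
    induction h with
    | qf h => exact .base (.inr (mem_exFragment.2 (.qf h)))
    | ex h1 h ih => exact .base (.inr (mem_exFragment.2 (.ex le_rfl h)))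
    | allMany => omega
    | allOnce h _ => exact .base (.inl ⟨_, mem_exFragment.2 h, rfl⟩)
    | inf _ _ h1 h2 => exact .inf (h1 hl) (h2 hl)
    | sup _ _ h1 h2 => exact .sup (h1 hl) (h2 hl)

theorem all_all_mem_allNExFragment_two {φ : L.BoundedFormula α (n + 1 + 1)} (h : Level 1 φ) :
    φ.all.all ∈ allNExFragment 2 L α n :=
  .base (.inl ⟨φ.all, .inl ⟨φ, mem_exFragment.2 h, rfl⟩, rfl⟩)

theorem mem_allNExFragment_two_of_level_one {φ : L.BoundedFormula α n} (h : Level 1 φ) :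
    φ ∈ allNExFragment 2 L α n :=
  .base (.inr (.inr (mem_exFragment.2 h)))

/-- Existential closure of the last `j` variables. -/
def exMany : ∀ (j : ℕ) {n : ℕ}, L.BoundedFormula α (n + j) → L.BoundedFormula α n
  | 0, _, φ => φ
  | j + 1, _, φ => exMany j φ.ex

theorem Level.exMany : ∀ {j n : ℕ} {φ : L.BoundedFormula α (n + j)}, Level 1 φ →
    Level 1 (exMany j φ)
  | 0, _, _, h => h
  | j + 1, _, _, h => Level.exMany (j := j) (.ex le_rfl h)

theorem realize_exMany {M : Type*} [L.Structure M] : ∀ {j n : ℕ} {φ : L.BoundedFormula α (n + j)}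
    {e : α → M} {v : Fin n → M},
    (FieldFragments.exMany j φ).Realize e v ↔ ∃ w : Fin j → M, φ.Realize e (Fin.append v w)
  | 0, n, φ, e, v => by
    have : ∀ w : Fin 0 → M, Fin.append v w = v := fun w => by
      rw [Subsingleton.elim w Fin.elim0, Fin.append_elim0]; rfl
    simp [FieldFragments.exMany, this]
  | j + 1, n, φ, e, v => by
    rw [FieldFragments.exMany, realize_exMany (j := j)]
    simp only [BoundedFormula.realize_ex]
    constructor
    · rintro ⟨w, a, h⟩
      exact ⟨Fin.snoc w a, by rwa [Fin.append_snoc]⟩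
    · rintro ⟨w, h⟩
      refine ⟨Fin.init w, w (Fin.last j), ?_⟩
      rwa [← Fin.append_snoc, Fin.snoc_init_self]

end

/-! ### Truth in fields and in fields with a distinguished element -/

/-- The structure of a field with a distinguished element. -/
@[reducible] def pointedStructure (K : Type*) [Field K] (a : K) : ringWithConst.Structure K :=
  letI := Ring.compatibleRingOfRing K
  letI : (constantsOn Unit).Structure K := constantsOn.structure fun _ => a
  inferInstance

/-- Truth of a formula of the language of rings in a field. -/
def RingHolds (K : Type*) [Field K] {n : ℕ} (φ : FirstOrder.Language.ring.BoundedFormula Empty n)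
    (v : Fin n → K) : Prop :=
  letI := Ring.compatibleRingOfRing K
  φ.Realize default v

/-- Truth of a formula in a field with a distinguished element. -/
def PointedHolds (K : Type*) [Field K] (a : K) {n : ℕ} (φ : ringWithConst.BoundedFormula Empty n)
    (v : Fin n → K) : Prop :=
  letI := pointedStructure K a
  φ.Realize default v

/-- Value of a term in a field with a distinguished element. -/
def pointedValue (K : Type*) [Field K] (a : K) {n : ℕ} (t : ringWithConst.Term (Empty ⊕ Fin n))
    (v : Fin n → K) : K :=
  letI := pointedStructure K a
  t.realize (Sum.elim default v)

/-- The image of a formula of the language of rings in the language with a constant. -/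
def liftFormula {n : ℕ} (φ : FirstOrder.Language.ring.BoundedFormula Empty n) :
    ringWithConst.BoundedFormula Empty n :=
  (FirstOrder.Language.ring.lhomWithConstants Unit).onBoundedFormula φ

section

variable {K : Type*} [Field K] {a : K} {n : ℕ}

theorem ringHolds_all {φ : FirstOrder.Language.ring.BoundedFormula Empty (n + 1)} {v : Fin n → K} :
    RingHolds K φ.all v ↔ ∀ x, RingHolds K φ (Fin.snoc v x) := Iff.rfl

theorem ringHolds_ex {φ : FirstOrder.Language.ring.BoundedFormula Empty (n + 1)} {v : Fin n → K} :
    RingHolds K φ.ex v ↔ ∃ x, RingHolds K φ (Fin.snoc v x) := by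
  let _ := Ring.compatibleRingOfRing K
  exact BoundedFormula.realize_ex

theorem ringHolds_inf {φ ψ : FirstOrder.Language.ring.BoundedFormula Empty n} {v : Fin n → K} :
    RingHolds K (φ ⊓ ψ) v ↔ RingHolds K φ v ∧ RingHolds K ψ v := by
  let _ := Ring.compatibleRingOfRing K
  exact BoundedFormula.realize_inf

theorem ringHolds_sup {φ ψ : FirstOrder.Language.ring.BoundedFormula Empty n} {v : Fin n → K} :
    RingHolds K (φ ⊔ ψ) v ↔ RingHolds K φ v ∨ RingHolds K ψ v := by
  let _ := Ring.compatibleRingOfRing K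
  exact BoundedFormula.realize_sup

theorem ringHolds_exMany {j : ℕ} {φ : FirstOrder.Language.ring.BoundedFormula Empty (n + j)}
    {v : Fin n → K} :
    RingHolds K (exMany j φ) v ↔ ∃ w : Fin j → K, RingHolds K φ (Fin.append v w) := by
  let _ := Ring.compatibleRingOfRing K
  exact realize_exMany

/-- The equation expressed by two polynomials. -/
noncomputable def polyEq {n : ℕ} (p q : FreeCommRing (Fin n)) :
    FirstOrder.Language.ring.BoundedFormula Empty n :=
  .equal ((FirstOrder.Ring.termOfFreeCommRing p).relabel Sum.inr)
    ((FirstOrder.Ring.termOfFreeCommRing q).relabel Sum.inr)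

theorem level_polyEq {p q : FreeCommRing (Fin n)} {l : ℕ} : Level l (polyEq p q) :=
  .qf (.of_isAtomic (.equal _ _))

theorem ringHolds_polyEq {p q : FreeCommRing (Fin n)} {v : Fin n → K} :
    RingHolds K (polyEq p q) v ↔ FreeCommRing.lift v p = FreeCommRing.lift v q := by
  let _ := Ring.compatibleRingOfRing K
  rw [RingHolds, polyEq, ← Term.bdEqual, BoundedFormula.realize_bdEqual]
  simp [Term.realize_relabel]

theorem pointedHolds_imp {φ ψ : ringWithConst.BoundedFormula Empty n} {v : Fin n → K} :
    PointedHolds K a (φ.imp ψ) v ↔ (PointedHolds K a φ v → PointedHolds K a ψ v) := Iff.rfl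

theorem pointedHolds_all {φ : ringWithConst.BoundedFormula Empty (n + 1)} {v : Fin n → K} :
    PointedHolds K a φ.all v ↔ ∀ x, PointedHolds K a φ (Fin.snoc v x) := Iff.rfl

theorem pointedHolds_falsum {v : Fin n → K} :
    ¬ PointedHolds K a (.falsum : ringWithConst.BoundedFormula Empty n) v := id

theorem pointedHolds_equal {s t : ringWithConst.Term (Empty ⊕ Fin n)} {v : Fin n → K} :
    PointedHolds K a (.equal s t) v ↔ pointedValue K a s v = pointedValue K a t v := Iff.rfl

theorem pointedHolds_ex {φ : ringWithConst.BoundedFormula Empty (n + 1)} {v : Fin n → K} :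
    PointedHolds K a φ.ex v ↔ ∃ x, PointedHolds K a φ (Fin.snoc v x) := by
  let _ := pointedStructure K a
  exact BoundedFormula.realize_ex

theorem pointedHolds_inf {φ ψ : ringWithConst.BoundedFormula Empty n} {v : Fin n → K} :
    PointedHolds K a (φ ⊓ ψ) v ↔ PointedHolds K a φ v ∧ PointedHolds K a ψ v := by
  let _ := pointedStructure K a
  exact BoundedFormula.realize_inf

theorem pointedHolds_sup {φ ψ : ringWithConst.BoundedFormula Empty n} {v : Fin n → K} :
    PointedHolds K a (φ ⊔ ψ) v ↔ PointedHolds K a φ v ∨ PointedHolds K a ψ v := by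
  let _ := pointedStructure K a
  exact BoundedFormula.realize_sup

theorem pointedHolds_liftFormula {φ : FirstOrder.Language.ring.BoundedFormula Empty n}
    {v : Fin n → K} : PointedHolds K a (liftFormula φ) v ↔ RingHolds K φ v := by
  let _ := Ring.compatibleRingOfRing K
  let _ : (constantsOn Unit).Structure K := constantsOn.structure fun _ => a
  exact LHom.realize_onBoundedFormula _ _

theorem level_liftFormula {l : ℕ} {φ : FirstOrder.Language.ring.BoundedFormula Empty n}
    (h : Level l φ) : Level l (liftFormula φ) := by
  induction h with
  | qf h =>
    refine .qf ?_
    induction h with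
    | falsum => exact .falsum
    | of_isAtomic h =>
      cases h with
      | equal => exact .of_isAtomic (.equal _ _)
      | rel R => exact R.elim
    | imp _ _ h1 h2 => exact h1.imp h2
  | ex h1 _ ih => exact .ex h1 ih
  | allMany _ ih => exact .allMany ih
  | allOnce _ ih => exact .allOnce ih
  | inf _ _ h1 h2 => exact .inf h1 h2
  | sup _ _ h1 h2 => exact .sup h1 h2

theorem mem_fieldTheory {F : FormulaSet FirstOrder.Language.ring Empty}
    {φ : FirstOrder.Language.ring.Sentence} :
    φ ∈ fieldTheory F K ↔ φ ∈ F 0 ∧ RingHolds K φ Fin.elim0 := by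
  rw [Subsingleton.elim Fin.elim0 (default : Fin 0 → K)]
  rfl

theorem mem_pointedFieldTheory {F : FormulaSet ringWithConst Empty} {φ : ringWithConst.Sentence} :
    φ ∈ pointedFieldTheory F K a ↔ φ ∈ F 0 ∧ PointedHolds K a φ Fin.elim0 := by
  rw [Subsingleton.elim Fin.elim0 (default : Fin 0 → K)]
  rfl

/-! ### Preservation of existential formulas -/

theorem pointedValue_map {M : Type*} [Field M] (f : K →+* M)
    (t : ringWithConst.Term (Empty ⊕ Fin n)) (v : Fin n → K) :
    pointedValue M (f a) t (f ∘ v) = f (pointedValue K a t v) := by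
  induction t with
  | var x => rcases x with x | x
             · exact x.elim
             · rfl
  | func g ts ih =>
    rcases g with g | g
    · cases g
      · exact (congrArg₂ (· + ·) (ih 0) (ih 1)).trans (map_add f _ _).symm
      · exact (congrArg₂ (· * ·) (ih 0) (ih 1)).trans (map_mul f _ _).symm
      · exact (congrArg (- ·) (ih 0)).trans (map_neg f _).symm
      · exact (map_zero f).symm
      · exact (map_one f).symm
    · rename_i m
      match m, g with
      | 0, g => rfl

/-- For quantifier-free formulas the proof needs an equivalence, because of implication; it holds
since homomorphisms of fields are injective. -/
theorem pointedHolds_map {M : Type*} [Field M] (f : K →+* M)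
    {φ : ringWithConst.BoundedFormula Empty n} (h : Level 1 φ) {v : Fin n → K}
    (hφ : PointedHolds K a φ v) : PointedHolds M (f a) φ (f ∘ v) := by
  generalize hl : 1 = l at h
  induction h with
  | qf h =>
    suffices PointedHolds M (f a) _ (f ∘ v) ↔ PointedHolds K a _ v from this.2 hφ
    clear hφ
    induction h with
    | falsum => rfl
    | of_isAtomic h =>
      cases h with
      | equal t₁ t₂ =>
        rw [Term.bdEqual, pointedHolds_equal, pointedHolds_equal, pointedValue_map,
          pointedValue_map]
        exact f.injective.eq_iff
      | rel R => rcases R with R | R <;> exact R.elim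
    | imp _ _ h1 h2 => rw [pointedHolds_imp, pointedHolds_imp, h1, h2]
  | ex h1 _ ih =>
    rw [pointedHolds_ex] at hφ ⊢
    obtain ⟨x, hx⟩ := hφ
    refine ⟨f x, ?_⟩
    rw [← Fin.comp_snoc]
    exact ih hx rfl
  | allMany => omega
  | allOnce => omega
  | inf _ _ h1 h2 =>
    rw [pointedHolds_inf] at hφ ⊢
    exact ⟨h1 hφ.1 hl, h2 hφ.2 hl⟩
  | sup _ _ h1 h2 =>
    rw [pointedHolds_sup] at hφ ⊢
    exact hφ.imp (h1 · hl) (h2 · hl)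

theorem ringHolds_map {M : Type*} [Field M] (f : K →+* M)
    {φ : FirstOrder.Language.ring.BoundedFormula Empty n} (h : Level 1 φ) {v : Fin n → K}
    (hφ : RingHolds K φ v) : RingHolds M φ (f ∘ v) := by
  rw [← pointedHolds_liftFormula (a := (0 : K))] at hφ
  exact pointedHolds_liftFormula.1 (pointedHolds_map f (level_liftFormula h) hφ)

/-! ### Ultrapowers -/

theorem pointedValue_germ {ι : Type*} {U : Ultrafilter ι} (b : ι → K)
    (t : ringWithConst.Term (Empty ⊕ Fin n)) (v : Fin n → ι → K) :
    pointedValue (Filter.Germ (U : Filter ι) K) (b : Filter.Germ (U : Filter ι) K) t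
      (fun i => (v i : Filter.Germ (U : Filter ι) K)) =
      ((fun j => pointedValue K (b j) t (fun i => v i j) : ι → K) :
        Filter.Germ (U : Filter ι) K) := by
  induction t with
  | var x => rcases x with x | x
             · exact x.elim
             · rfl
  | func g ts ih =>
    rcases g with g | g
    · cases g
      · exact congrArg₂ (· + ·) (ih 0) (ih 1)
      · exact congrArg₂ (· * ·) (ih 0) (ih 1)
      · exact congrArg (- ·) (ih 0)
      · rfl
      · rfl
    · rename_i m
      match m, g with
      | 0, g => rfl

/-- Łoś's theorem for germs along an ultrafilter, whose field structure is the one that the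
homomorphisms below map into. -/
theorem pointedHolds_germ {ι : Type*} {U : Ultrafilter ι} (b : ι → K)
    (φ : ringWithConst.BoundedFormula Empty n) (v : Fin n → ι → K) :
    PointedHolds (Filter.Germ (U : Filter ι) K) (b : Filter.Germ (U : Filter ι) K) φ
      (fun i => (v i : Filter.Germ (U : Filter ι) K)) ↔
      ∀ᶠ j in (U : Filter ι), PointedHolds K (b j) φ (fun i => v i j) := by
  induction φ with
  | falsum =>
    simp only [pointedHolds_falsum, false_iff]
    exact fun h => (h.exists).elim fun _ h => h
  | equal t₁ t₂ =>
    simp only [pointedHolds_equal, pointedValue_germ]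
    exact Filter.Germ.coe_eq
  | rel R => rcases R with R | R <;> exact R.elim
  | imp φ ψ h1 h2 =>
    simp only [pointedHolds_imp, h1, h2]
    exact Ultrafilter.eventually_imp.symm
  | all φ ih =>
    have key : ∀ x : ι → K, PointedHolds (Filter.Germ (U : Filter ι) K) (b : Filter.Germ _ K) φ
        (Fin.snoc (fun i => (v i : Filter.Germ (U : Filter ι) K)) (x : Filter.Germ _ K)) ↔
        ∀ᶠ j in (U : Filter ι), PointedHolds K (b j) φ (Fin.snoc (fun i => v i j) (x j)) := by
      intro x
      have := ih (Fin.snoc v x)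
      have e : ∀ j, (fun i => (Fin.snoc v x : Fin _ → ι → K) i j) =
          Fin.snoc (fun i => v i j) (x j) := fun j => by
        ext i; refine Fin.lastCases ?_ (fun i => ?_) i <;> simp
      simp only [e] at this
      convert this using 2
      ext i; refine Fin.lastCases ?_ (fun i => ?_) i <;> simp
    simp only [pointedHolds_all]
    constructor
    · intro h
      by_contra hc
      rw [← Ultrafilter.eventually_not] at hc
      simp only [not_forall] at hc
      -- Counterexamples chosen at the individual indices form a single germ, which refutes the
      -- universal statement.
      have : ∀ j, ∃ x, (∃ x, ¬ PointedHolds K (b j) φ (Fin.snoc (fun i => v i j) x)) →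
          ¬ PointedHolds K (b j) φ (Fin.snoc (fun i => v i j) x) := fun j => by
        by_cases hj : ∃ x, ¬ PointedHolds K (b j) φ (Fin.snoc (fun i => v i j) x)
        · exact hj.imp fun x hx _ => hx
        · exact ⟨0, fun h => absurd h hj⟩
      choose x hx using this
      have := (key x).1 (h x)
      obtain ⟨j, h1, h2⟩ := (this.and hc).exists
      exact hx j h2 h1
    · intro h x
      induction x using Filter.Germ.inductionOn with
      | _ x => exact (key x).2 (h.mono fun j hj => hj _)

end

/-! ### Finite parts of the diagram of a field -/

section

/-- Conjunction of a list of formulas. -/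
def conjList {L : FirstOrder.Language.{u, v}} {α : Type w} {n : ℕ} :
    List (L.BoundedFormula α n) → L.BoundedFormula α n
  | [] => ⊤
  | φ :: l => φ ⊓ conjList l

theorem level_conjList {L : FirstOrder.Language.{u, v}} {α : Type w} {n m : ℕ} :
    ∀ {l : List (L.BoundedFormula α n)}, (∀ φ ∈ l, Level m φ) → Level m (conjList l)
  | [], _ => .qf BoundedFormula.IsQF.top
  | _ :: _, h => .inf (h _ (by simp)) (level_conjList fun φ hφ => h φ (by simp [hφ]))

theorem ringHolds_conjList {K : Type*} [Field K] {n : ℕ} {v : Fin n → K} :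
    ∀ {l : List (FirstOrder.Language.ring.BoundedFormula Empty n)},
      RingHolds K (conjList l) v ↔ ∀ φ ∈ l, RingHolds K φ v
  | [] => ⟨fun _ => by simp, fun _ h => h⟩
  | φ :: l => by rw [conjList, ringHolds_inf, ringHolds_conjList]; simp

variable {k : Type*} [Field k]

open Classical in
/-- The elements occurring in a finite part of the diagram. -/
noncomputable def diagramSupport (S : Finset (k × k)) (c : k) : List k :=
  (({1, c} : Finset k) ∪ S.image (·.1) ∪ S.image (·.2) ∪ S.image (fun p => p.1 + p.2) ∪
    S.image (fun p => p.1 * p.2)).toList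

open Classical in
/-- The variable attached to an element; the variable `x_0` is kept free. -/
noncomputable def diagramVar (S : Finset (k × k)) (c a : k) :
    FreeCommRing (Fin (1 + ((diagramSupport S c).length + 1))) :=
  -- `idxOf` returns the length of the list for an absent element, hence one variable more than the
  -- list has entries.
  .of (Fin.natAdd 1 ⟨(diagramSupport S c).idxOf a, Nat.lt_succ_iff.2 List.idxOf_le_length⟩)

/-- The formula saying that `x_0` is the value at `c` of a map from `k` that preserves `1` and
the sums and products of the pairs in `S`. -/
noncomputable def diagramFormula (S : Finset (k × k)) (c : k) :
    FirstOrder.Language.ring.BoundedFormula Empty 1 :=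
  exMany ((diagramSupport S c).length + 1) <|
    polyEq (diagramVar S c c) (.of (Fin.castAdd _ 0)) ⊓
    (polyEq (diagramVar S c 1) 1 ⊓
    conjList (S.toList.map fun p =>
      polyEq (diagramVar S c (p.1 + p.2)) (diagramVar S c p.1 + diagramVar S c p.2) ⊓
      polyEq (diagramVar S c (p.1 * p.2)) (diagramVar S c p.1 * diagramVar S c p.2)))

theorem level_diagramFormula (S : Finset (k × k)) (c : k) : Level 1 (diagramFormula S c) := by
  refine Level.exMany (.inf level_polyEq (.inf level_polyEq (level_conjList ?_)))
  intro φ hφ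
  obtain ⟨p, -, rfl⟩ := List.mem_map.1 hφ
  exact .inf level_polyEq level_polyEq

/-- Only finitely many values of `f` matter, and they are named by the bound variables. No
inequations are needed: a map that preserves `1`, sums and products of fields is automatically
injective. -/
theorem ringHolds_diagramFormula {M : Type*} [Field M] {S : Finset (k × k)} {c : k}
    {v : Fin 1 → M} :
    RingHolds M (diagramFormula S c) v ↔ ∃ f : k → M, f c = v 0 ∧ f 1 = 1 ∧
      ∀ p ∈ S, f (p.1 + p.2) = f p.1 + f p.2 ∧ f (p.1 * p.2) = f p.1 * f p.2 := by
  classical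
  rw [diagramFormula, ringHolds_exMany]
  simp only [ringHolds_inf, ringHolds_conjList, ringHolds_polyEq, List.forall_mem_map,
    Finset.mem_toList, diagramVar, map_add, map_mul, FreeCommRing.lift_of, Fin.append_right,
    Fin.append_left, map_one]
  constructor
  · rintro ⟨w, h⟩
    exact ⟨fun a => w ⟨(diagramSupport S c).idxOf a, Nat.lt_succ_iff.2 List.idxOf_le_length⟩, h⟩
  · rintro ⟨f, h0, h1, h⟩
    -- The default `0` serves the surplus last variable, which no equation mentions.
    refine ⟨fun i => f ((diagramSupport S c).getD i 0), ?_⟩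
    have key : ∀ a ∈ diagramSupport S c,
        (diagramSupport S c).getD ((diagramSupport S c).idxOf a) 0 = a := by
      intro a ha
      rw [List.getD_eq_getElem _ _ (List.idxOf_lt_length_iff.2 ha), List.getElem_idxOf]
    have mem : ∀ p ∈ S, p.1 ∈ diagramSupport S c ∧ p.2 ∈ diagramSupport S c ∧
        p.1 + p.2 ∈ diagramSupport S c ∧ p.1 * p.2 ∈ diagramSupport S c := by
      intro p hp
      simp only [diagramSupport, Finset.mem_toList, Finset.mem_union, Finset.mem_image]
      exact ⟨.inl (.inl (.inl (.inr ⟨p, hp, rfl⟩))), .inl (.inl (.inr ⟨p, hp, rfl⟩)),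
        .inl (.inr ⟨p, hp, rfl⟩),
        .inr ⟨p, hp, rfl⟩⟩
    have hc : c ∈ diagramSupport S c := by simp [diagramSupport]
    have h1' : 1 ∈ diagramSupport S c := by simp [diagramSupport]
    beta_reduce
    refine ⟨by rw [key _ hc, h0], by rw [key _ h1', h1], fun p hp => ?_⟩
    obtain ⟨m1, m2, m3, m4⟩ := mem p hp
    rw [key _ m1, key _ m2, key _ m3, key _ m4]
    exact h p hp

/-- A map that preserves `1`, sums and products is a ring homomorphism. -/
def ringHomOfMap {M : Type*} [Field M] (f : k → M) (h1 : f 1 = 1)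
    (h : ∀ x y, f (x + y) = f x + f y ∧ f (x * y) = f x * f y) : k →+* M where
  toFun := f
  map_one' := h1
  map_zero' := by simpa using (h 0 0).1
  map_add' x y := (h x y).1
  map_mul' x y := (h x y).2

theorem exists_map_of_exTheory_subset {l : Type*} [Field l]
    (h : fieldTheory (exFragment _ _) k ⊆ fieldTheory (exFragment _ _) l) (S : Finset (k × k)) :
    ∃ f : k → l, f 1 = 1 ∧
      ∀ p ∈ S, f (p.1 + p.2) = f p.1 + f p.2 ∧ f (p.1 * p.2) = f p.1 * f p.2 := by
  have h1 : (diagramFormula S 1).ex ∈ fieldTheory (exFragment _ _) k :=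
    mem_fieldTheory.2 ⟨mem_exFragment.2 (.ex le_rfl (level_diagramFormula _ _)),
      ringHolds_ex.2 ⟨1, ringHolds_diagramFormula.2 ⟨id, rfl, rfl, fun _ _ => ⟨rfl, rfl⟩⟩⟩⟩
  obtain ⟨x, hx⟩ := ringHolds_ex.1 (mem_fieldTheory.1 (h h1)).2
  obtain ⟨f, -, hf⟩ := ringHolds_diagramFormula.1 hx
  exact ⟨f, hf⟩

/-- Compactness: the partial homomorphisms for the finite sets `S` are glued along an ultrafilter on
these sets. -/
theorem exists_ringHom_germ_of_exTheory_subset {l : Type*} [Field l]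
    (h : fieldTheory (exFragment _ _) k ⊆ fieldTheory (exFragment _ _) l) :
    ∃ U : Ultrafilter (Finset (k × k)),
      Nonempty (k →+* Filter.Germ (U : Filter (Finset (k × k))) l) := by
  classical
  choose f h1 hf using exists_map_of_exTheory_subset h
  -- Being finer than `atTop`, it contains, for each pair, the family of all `S` that include this
  -- pair.
  let U : Ultrafilter (Finset (k × k)) := Ultrafilter.of Filter.atTop
  refine ⟨U, ⟨ringHomOfMap (fun x => ((fun S => f S x : Finset (k × k) → l) : Filter.Germ _ l))
    ?_ ?_⟩⟩
  · exact congrArg _ (funext h1)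
  · intro x y
    have : ∀ᶠ S in (U : Filter (Finset (k × k))), (x, y) ∈ S := by
      refine Ultrafilter.of_le _ ?_
      filter_upwards [Filter.eventually_ge_atTop {(x, y)}] with S hS
      exact hS (by simp)
    exact ⟨Filter.Germ.coe_eq.2 (this.mono fun S hS => (hf S _ hS).1),
      Filter.Germ.coe_eq.2 (this.mono fun S hS => (hf S _ hS).2)⟩

/-! ### Homomorphisms from rational function fields -/

theorem exists_ratFunc_hom {M : Type*} [Field M] (f : k →+* M) (u : M)
    (hu : Function.Injective (Polynomial.eval₂RingHom f u)) :
    ∃ g : RatFunc k →+* M, g RatFunc.X = u ∧ ∀ c, g (algebraMap k _ c) = f c := by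
  refine ⟨IsFractionRing.lift (A := Polynomial k) hu, ?_, fun c => ?_⟩
  · rw [← RatFunc.algebraMap_X, IsFractionRing.lift_algebraMap]
    simp
  · rw [IsScalarTower.algebraMap_apply k (Polynomial k) (RatFunc k), IsFractionRing.lift_algebraMap]
    simp [Polynomial.algebraMap_eq]

theorem exists_ratFunc_map {l : Type*} [Field l] (f : k →+* l) :
    ∃ g : RatFunc k →+* RatFunc l, g RatFunc.X = RatFunc.X ∧
      ∀ c, g (algebraMap k _ c) = algebraMap l _ (f c) := by
  refine exists_ratFunc_hom ((algebraMap l (RatFunc l)).comp f) _ ?_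
  rw [injective_iff_map_eq_zero]
  intro p hp
  have : algebraMap (Polynomial l) (RatFunc l) (p.map f) = 0 := by
    rw [← hp, Polynomial.coe_eval₂RingHom, ← Polynomial.eval₂_map, ← Polynomial.aeval_def,
      ← RatFunc.algebraMap_X, Polynomial.aeval_algebraMap_apply, Polynomial.aeval_X_left_apply]
  rw [map_eq_zero_iff _ (IsFractionRing.injective _ _)] at this
  exact (Polynomial.map_eq_zero f).1 this

/-- A nonconstant rational function is transcendental over the constants. -/
theorem exists_ratFunc_endomorphism {u : RatFunc k}
    (hu : u ∉ Set.range (algebraMap k (RatFunc k))) :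
    ∃ g : RatFunc k →+* RatFunc k, g RatFunc.X = u ∧
      ∀ c, g (algebraMap k _ c) = algebraMap k _ c := by
  refine exists_ratFunc_hom (algebraMap k (RatFunc k)) u ?_
  have : Transcendental k u := u.transcendental_of_ne_C fun ⟨c, hc⟩ => hu ⟨c, hc.symm⟩
  exact transcendental_iff_injective.1 this

theorem ratFunc_X_notMem_range : (RatFunc.X : RatFunc k) ∉ Set.range (algebraMap k (RatFunc k)) := by
  rintro ⟨c, hc⟩
  rw [IsScalarTower.algebraMap_apply k (Polynomial k) (RatFunc k), ← RatFunc.algebraMap_X] at hc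
  exact Polynomial.X_ne_C c (IsFractionRing.injective (Polynomial k) (RatFunc k) hc).symm

/-- A homomorphism from `k` to an ultrapower of `l` extends to the rational function fields. -/
theorem exists_ratFunc_hom_germ {l ι : Type*} [Field l] {U : Ultrafilter ι}
    (f : k →+* Filter.Germ (U : Filter ι) l) :
    ∃ g : RatFunc k →+* Filter.Germ (U : Filter ι) (RatFunc l),
      g RatFunc.X = ((fun _ => RatFunc.X : ι → RatFunc l) : Filter.Germ _ _) := by
  let F : Filter.Germ (U : Filter ι) l →+* Filter.Germ (U : Filter ι) (RatFunc l) :=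
    { toFun := Filter.Germ.map (algebraMap l (RatFunc l))
      map_one' := by
        exact congrArg _ (funext fun _ => map_one (algebraMap l (RatFunc l)))
      map_zero' := by
        exact congrArg _ (funext fun _ => map_zero (algebraMap l (RatFunc l)))
      map_add' := fun x y => Filter.Germ.inductionOn₂ x y fun x y =>
        congrArg _ (funext fun _ => map_add (algebraMap l (RatFunc l)) _ _)
      map_mul' := fun x y => Filter.Germ.inductionOn₂ x y fun x y =>
        congrArg _ (funext fun _ => map_mul (algebraMap l (RatFunc l)) _ _) }
  suffices hu : Function.Injective (Polynomial.eval₂RingHom (F.comp f)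
      ((fun _ => RatFunc.X : ι → RatFunc l) : Filter.Germ (U : Filter ι) (RatFunc l))) by
    obtain ⟨g, hg, -⟩ := exists_ratFunc_hom (F.comp f) _ hu
    exact ⟨g, hg⟩
  rw [injective_iff_map_eq_zero]
  intro p hp
  -- With `r` representing the values of `f`, the image of `p` is the germ of the polynomials with
  -- coefficients `r (p.coeff i) j`; if it vanishes, so does almost every coefficient.
  choose r hr using fun c => Quotient.exists_rep (f c)
  have hr : ∀ c, (r c : Filter.Germ (U : Filter ι) l) = f c := hr
  have e : Polynomial.eval₂RingHom (F.comp f) ((fun _ => RatFunc.X : ι → RatFunc l) :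
      Filter.Germ (U : Filter ι) (RatFunc l)) p = ((fun j => algebraMap (Polynomial l) (RatFunc l)
        (∑ i ∈ p.support, Polynomial.C (r (p.coeff i) j) * Polynomial.X ^ i) : ι → RatFunc l) :
        Filter.Germ (U : Filter ι) (RatFunc l)) := by
    rw [Polynomial.coe_eval₂RingHom, Polynomial.eval₂_eq_sum, Polynomial.sum]
    have : ∀ s : Finset ℕ, ∑ i ∈ s, (F.comp f) (p.coeff i) * ((fun _ => RatFunc.X : ι → RatFunc l) :
        Filter.Germ (U : Filter ι) (RatFunc l)) ^ i = ((fun j => algebraMap (Polynomial l)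
        (RatFunc l) (∑ i ∈ s, Polynomial.C (r (p.coeff i) j) * Polynomial.X ^ i) :
        ι → RatFunc l) : Filter.Germ (U : Filter ι) (RatFunc l)) := by
      classical
      intro s
      induction s using Finset.induction_on with
      | empty => simp only [Finset.sum_empty, map_zero]; rfl
      | insert i s hi ih =>
        rw [Finset.sum_insert hi, ih]
        simp only [Finset.sum_insert hi, map_add, map_mul, map_pow, RatFunc.algebraMap_X,
          RatFunc.algebraMap_C, RingHom.comp_apply, ← hr]
        rfl
    exact this _
  rw [e] at hp
  have hp : ∀ᶠ j in (U : Filter ι), _ := Filter.Germ.coe_eq.1 hp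
  ext i
  by_contra hi
  have hf : ∀ᶠ j in (U : Filter ι), r (p.coeff i) j = 0 := hp.mono fun j hj => by
    have hj : algebraMap (Polynomial l) (RatFunc l) _ = 0 := hj
    rw [map_eq_zero_iff _ (IsFractionRing.injective _ _)] at hj
    have := congrArg (Polynomial.coeff · i) hj
    simp only [Polynomial.finsetSum_coeff, Polynomial.coeff_C_mul_X_pow, Polynomial.coeff_zero]
      at this
    rwa [Finset.sum_ite_eq, if_pos (Polynomial.mem_support_iff.2 hi)] at this
  have : f (p.coeff i) = 0 := by rw [← hr]; exact Filter.Germ.coe_eq.2 hf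
  exact hi ((map_eq_zero f).1 this)

/-- Truth moves up along the embedding of `k(t)` into the ultrapower of `l(t)` and comes down at
almost every index. -/
theorem exTheory_ratFunc_subset {l : Type*} [Field l]
    (h : fieldTheory (exFragment _ _) k ⊆ fieldTheory (exFragment _ _) l) :
    pointedFieldTheory (exFragment _ _) (RatFunc k) RatFunc.X ⊆
      pointedFieldTheory (exFragment _ _) (RatFunc l) RatFunc.X := by
  obtain ⟨U, ⟨f⟩⟩ := exists_ringHom_germ_of_exTheory_subset h
  obtain ⟨g, hg⟩ := exists_ratFunc_hom_germ f
  intro φ hφ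
  obtain ⟨h1, h2⟩ := mem_pointedFieldTheory.1 hφ
  refine mem_pointedFieldTheory.2 ⟨h1, ?_⟩
  have := pointedHolds_map g (mem_exFragment.1 h1) h2
  rw [hg] at this
  have h3 := (pointedHolds_germ (U := U) (fun _ => (RatFunc.X : RatFunc l)) φ Fin.elim0).1 (by
    convert this using 1)
  obtain ⟨j, hj⟩ := h3.exists
  convert hj using 1

/-! ### Existential formulas with parameters from the constant field -/

/-- An infinite field is existentially closed in its rational function field. -/
theorem ringHolds_of_ratFunc [Infinite k] {n : ℕ}
    {φ : FirstOrder.Language.ring.BoundedFormula Empty n} (h : Level 1 φ) {v : Fin n → k}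
    (hφ : RingHolds (RatFunc k) φ (algebraMap k _ ∘ v)) : RingHolds k φ v := by
  -- The identity map represents an element of the ultrapower that is transcendental over the
  -- diagonal copy of `k`: a nonzero polynomial has finitely many zeros, and finite sets are not in
  -- the hyperfilter. So `k(t)` embeds over `k` in an ultrapower of `k`.
  let U : Ultrafilter k := Filter.hyperfilter k
  let F : k →+* Filter.Germ (U : Filter k) k := ringHomOfMap (fun c => ((fun _ => c : k → k) :
    Filter.Germ (U : Filter k) k)) rfl fun _ _ => ⟨rfl, rfl⟩
  have hu : Function.Injective
      (Polynomial.eval₂RingHom F ((fun x => x : k → k) : Filter.Germ (U : Filter k) k)) := by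
    have e : ∀ p, Polynomial.eval₂RingHom F ((fun x => x : k → k) : Filter.Germ (U : Filter k) k) p =
        ((fun x => p.eval x : k → k) : Filter.Germ (U : Filter k) k) := by
      intro p
      induction p using Polynomial.induction_on' with
      | add p q hp hq =>
        rw [map_add, hp, hq]
        exact congrArg _ (funext fun x => (Polynomial.eval_add).symm)
      | monomial n a =>
        simp only [Polynomial.coe_eval₂RingHom, Polynomial.eval₂_monomial, Polynomial.eval_monomial]
        rfl
    rw [injective_iff_map_eq_zero]
    intro p hp
    rw [e] at hp
    by_contra h0
    have hp : ∀ᶠ x in (U : Filter k), p.eval x = 0 := Filter.Germ.coe_eq.1 hp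
    have : {x | p.eval x = 0}.Finite := by
      refine (p.rootSet_finite k).subset fun x hx => ?_
      simpa [Polynomial.mem_rootSet, h0] using hx
    exact this.notMem_hyperfilter hp
  obtain ⟨g, -, hg⟩ := exists_ratFunc_hom F _ hu
  have := ringHolds_map g h hφ
  rw [← pointedHolds_liftFormula (a := ((fun _ => 0 : k → k) : Filter.Germ (U : Filter k) k))]
    at this
  obtain ⟨j, hj⟩ := ((pointedHolds_germ (U := U) (fun _ => (0 : k)) (liftFormula φ)
    (fun i _ => v i)).1 (by
      convert this using 1
      funext i
      exact (hg (v i)).symm)).exists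
  exact pointedHolds_liftFormula.1 hj

theorem ringHolds_ratFunc {n : ℕ}
    {φ : FirstOrder.Language.ring.BoundedFormula Empty n} (h : Level 1 φ) {v : Fin n → k}
    (hφ : RingHolds k φ v) : RingHolds (RatFunc k) φ (algebraMap k _ ∘ v) :=
  ringHolds_map (algebraMap k (RatFunc k)) h hφ

theorem pointedHolds_ratFunc_of_X {n : ℕ}
    {φ : ringWithConst.BoundedFormula Empty n} (h : Level 1 φ) {v : Fin n → k}
    (hφ : PointedHolds (RatFunc k) RatFunc.X φ (algebraMap k _ ∘ v)) {u : RatFunc k}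
    (hu : u ∉ Set.range (algebraMap k (RatFunc k))) :
    PointedHolds (RatFunc k) u φ (algebraMap k _ ∘ v) := by
  obtain ⟨g, hg, hc⟩ := exists_ratFunc_endomorphism hu
  have := pointedHolds_map g h hφ
  rw [hg] at this
  convert this using 1
  funext i
  exact (hc _).symm

theorem snoc_elim0 {M : Type*} (x : M) : (Fin.snoc Fin.elim0 x : Fin 1 → M) = fun _ => x := by
  ext i; rw [Fin.eq_zero i]; rfl

/-- A universal-existential sentence with one universal quantifier holds in `k(t)` if and only if
the existential formula holds for `t` and for the constants. -/
theorem ringHolds_all_ratFunc {φ : FirstOrder.Language.ring.BoundedFormula Empty 1}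
    (h : Level 1 φ) :
    RingHolds (RatFunc k) φ.all Fin.elim0 ↔ RingHolds (RatFunc k) φ (fun _ => RatFunc.X) ∧
      ∀ c : k, RingHolds (RatFunc k) φ (fun _ => algebraMap k _ c) := by
  simp only [ringHolds_all, snoc_elim0]
  refine ⟨fun h => ⟨h _, fun _ => h _⟩, fun ⟨h1, h2⟩ u => ?_⟩
  by_cases hu : u ∈ Set.range (algebraMap k (RatFunc k))
  · obtain ⟨c, rfl⟩ := hu
    exact h2 c
  · obtain ⟨g, hg, -⟩ := exists_ratFunc_endomorphism hu
    have := ringHolds_map g h h1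
    convert this using 1
    funext i
    exact hg.symm

end

/-! ### Universal-existential sentences with one universal quantifier -/

theorem Level.sentence_induction {L : FirstOrder.Language.{u, v}} {P : L.Sentence → Prop}
    (base : ∀ φ : L.Sentence, Level 1 φ → P φ)
    (all : ∀ φ : L.BoundedFormula Empty 1, Level 1 φ → P φ.all)
    (inf : ∀ φ ψ : L.Sentence, Level 3 φ → Level 3 ψ → P φ → P ψ → P (φ ⊓ ψ))
    (sup : ∀ φ ψ : L.Sentence, Level 3 φ → Level 3 ψ → P φ → P ψ → P (φ ⊔ ψ))
    {φ : L.Sentence} (h : Level 3 φ) : P φ := by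
  -- The level and the number of variables are generalized so that induction on the indexed family
  -- applies. The connectives keep `n = 0`, and the body of `∀` has level `1`, so no induction
  -- hypothesis under a binder is needed.
  suffices ∀ (m n : ℕ) (φ : L.BoundedFormula Empty n), Level m φ → m = 3 → ∀ hn : n = 0,
      P (hn ▸ φ : L.BoundedFormula Empty 0) from this 3 0 φ h rfl rfl
  clear h φ
  intro m n φ h
  induction h with
  | qf h1 => rintro rfl rfl; exact base _ (.qf h1)
  | ex h0 h1 => rintro rfl rfl; exact base _ (.ex le_rfl h1)
  | allMany => omega
  | allOnce h1 => rintro - rfl; exact all _ h1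
  | inf h1 h2 h3 h4 =>
    rintro rfl rfl
    exact inf _ _ h1 h2 (h3 rfl rfl) (h4 rfl rfl)
  | sup h1 h2 h3 h4 =>
    rintro rfl rfl
    exact sup _ _ h1 h2 (h3 rfl rfl) (h4 rfl rfl)

section

variable {k l : Type*} [Field k] [Field l]

theorem exTheory_subset_of_allNEx (h : fieldTheory (allNExFragment 1 _ _) k ⊆
    fieldTheory (allNExFragment 1 _ _) l) :
    fieldTheory (exFragment _ _) k ⊆ fieldTheory (exFragment _ _) l := by
  intro φ hφ
  obtain ⟨h1, h2⟩ := mem_fieldTheory.1 hφ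
  have h3 := mem_allNExFragment_one.2 ((mem_exFragment.1 h1).mono le_rfl (by omega))
  exact mem_fieldTheory.2 ⟨h1, (mem_fieldTheory.1 (h (mem_fieldTheory.2 ⟨h3, h2⟩))).2⟩

/-- The whole diagram of `k` is finite, so `k` embeds in `l`; and `∀ x, x ^ q = x`, with `q` the
cardinality of `k`, passes to `l`, which therefore has at most `q` elements. -/
theorem exists_surjective_ringHom_of_finite [Finite k] (h : fieldTheory (allNExFragment 1 _ _) k ⊆
    fieldTheory (allNExFragment 1 _ _) l) : ∃ f : k →+* l, Function.Surjective f := by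
  classical
  have := Fintype.ofFinite k
  obtain ⟨f, h1, hf⟩ := exists_map_of_exTheory_subset (exTheory_subset_of_allNEx h) Finset.univ
  let F : k →+* l := ringHomOfMap f h1 fun x y => hf (x, y) (Finset.mem_univ _)
  let q := Fintype.card k
  have hq : 1 < q := Fintype.one_lt_card
  have h2 : (polyEq (.of 0 ^ q) (.of 0) : FirstOrder.Language.ring.BoundedFormula Empty 1).all ∈
      fieldTheory (allNExFragment 1 _ _) l := by
    refine h (mem_fieldTheory.2 ⟨mem_allNExFragment_one.2 (.allOnce level_polyEq), ?_⟩)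
    rw [ringHolds_all]
    intro x
    rw [ringHolds_polyEq, map_pow, FreeCommRing.lift_of]
    exact FiniteField.pow_card _
  have h3 : ∀ x : l, x ^ q = x := by
    intro x
    have := ringHolds_all.1 (mem_fieldTheory.1 h2).2 x
    rwa [ringHolds_polyEq, map_pow, FreeCommRing.lift_of, snoc_elim0] at this
  have h4 : (Polynomial.X ^ q - Polynomial.X : Polynomial l) ≠ 0 :=
    FiniteField.X_pow_card_sub_X_ne_zero l hq
  have h5 : ∀ s : Finset l, s.card ≤ q := by
    intro s
    have : s.val ⊆ (Polynomial.X ^ q - Polynomial.X : Polynomial l).roots := by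
      intro x _
      rw [Polynomial.mem_roots h4]
      simp [h3]
    refine (Polynomial.card_le_degree_of_subset_roots this).trans ?_
    rw [FiniteField.X_pow_card_sub_X_natDegree_eq l hq]
  refine ⟨F, fun y => ?_⟩
  by_contra hy
  -- A point outside the image would give `q + 1` elements of `l`.
  have := h5 (insert y (Finset.univ.image F))
  rw [Finset.card_insert_of_notMem (by simpa using hy),
    Finset.card_image_of_injective _ F.injective, Finset.card_univ] at this
  omega

/-- For infinite `k`, constants satisfy `φ` in `k(t)` iff they do in `k`, and `∀ x φ(x)` passes to
`l`. For finite `k`, every constant of `l(t)` comes from `k` along a homomorphism that extends to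
`k(t)`. -/
theorem forall_ringHolds_const_of_subset (h : fieldTheory (allNExFragment 1 _ _) k ⊆
    fieldTheory (allNExFragment 1 _ _) l) {φ : FirstOrder.Language.ring.BoundedFormula Empty 1}
    (hφ : Level 1 φ) (hk : ∀ c : k, RingHolds (RatFunc k) φ (fun _ => algebraMap k _ c)) (c : l) :
    RingHolds (RatFunc l) φ (fun _ => algebraMap l _ c) := by
  rcases finite_or_infinite k with hfin | hinf
  · obtain ⟨f, hf⟩ := exists_surjective_ringHom_of_finite h
    obtain ⟨b, rfl⟩ := hf c
    obtain ⟨g, -, hg⟩ := exists_ratFunc_map f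
    convert ringHolds_map g hφ (hk b) using 1
    funext i
    exact (hg b).symm
  · have h1 : φ.all ∈ fieldTheory (allNExFragment 1 _ _) l := by
      refine h (mem_fieldTheory.2 ⟨mem_allNExFragment_one.2 (.allOnce hφ), ?_⟩)
      rw [ringHolds_all]
      exact fun x => ringHolds_of_ratFunc hφ (by rw [snoc_elim0]; exact hk x)
    have := ringHolds_all.1 (mem_fieldTheory.1 h1).2 c
    rw [snoc_elim0] at this
    exact ringHolds_ratFunc hφ this

theorem exTheory_ratFunc_holds (h : fieldTheory (exFragment _ _) k ⊆ fieldTheory (exFragment _ _) l)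
    {φ : ringWithConst.Sentence} (hφ : Level 1 φ)
    (hk : PointedHolds (RatFunc k) RatFunc.X φ Fin.elim0) :
    PointedHolds (RatFunc l) RatFunc.X φ Fin.elim0 :=
  (mem_pointedFieldTheory.1 (exTheory_ratFunc_subset h
    (mem_pointedFieldTheory.2 ⟨mem_exFragment.2 hφ, hk⟩))).2

/-- The constant symbol as a term. -/
def constTerm (n : ℕ) : ringWithConst.Term (Empty ⊕ Fin n) :=
  .func (l := 0) (.inr ()) Fin.elim0

/-- `φ(t)`, written as `∃ x (x = t ∧ φ(x))`. -/
def atConst (φ : ringWithConst.BoundedFormula Empty 1) : ringWithConst.Sentence :=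
  BoundedFormula.ex (.equal (.var (.inr 0)) (constTerm 1) ⊓ φ)

theorem level_atConst {φ : ringWithConst.BoundedFormula Empty 1} (h : Level 1 φ) :
    Level 1 (atConst φ) :=
  .ex le_rfl (.inf (.qf (.of_isAtomic (.equal _ _))) h)

theorem pointedHolds_atConst {a : k} {φ : ringWithConst.BoundedFormula Empty 1} :
    PointedHolds k a (atConst φ) Fin.elim0 ↔ PointedHolds k a φ (fun _ => a) := by
  simp only [atConst, pointedHolds_ex, pointedHolds_inf, snoc_elim0]
  constructor
  · rintro ⟨x, h1, h2⟩
    have h1 : x = a := h1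
    rwa [h1] at h2
  · exact fun h => ⟨a, rfl, h⟩

/-- By `ringHolds_all_ratFunc`, each universal part splits into the existential statement `φ(t)` and
a statement about constants, which transfer separately; positive Boolean combinations follow. -/
theorem allNExTheory_ratFunc_subset (h : fieldTheory (allNExFragment 1 _ _) k ⊆
    fieldTheory (allNExFragment 1 _ _) l) :
    fieldTheory (allNExFragment 1 _ _) (RatFunc k) ⊆
      fieldTheory (allNExFragment 1 _ _) (RatFunc l) := by
  intro φ hφ
  rw [mem_fieldTheory] at hφ ⊢
  refine ⟨hφ.1, ?_⟩
  obtain ⟨h0, h2⟩ := hφ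
  replace h0 := mem_allNExFragment_one.1 h0
  have hex := exTheory_subset_of_allNEx h
  have key : ∀ {φ : FirstOrder.Language.ring.Sentence}, Level 1 φ →
      RingHolds (RatFunc k) φ Fin.elim0 → RingHolds (RatFunc l) φ Fin.elim0 := by
    intro φ hφ h
    rw [← pointedHolds_liftFormula (a := RatFunc.X)] at h ⊢
    exact exTheory_ratFunc_holds hex (level_liftFormula hφ) h
  refine Level.sentence_induction (P := fun φ => RingHolds (RatFunc k) φ Fin.elim0 →
    RingHolds (RatFunc l) φ Fin.elim0) (fun φ => key) ?_ ?_ ?_ h0 h2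
  · intro φ h1 h2
    obtain ⟨h3, h4⟩ := (ringHolds_all_ratFunc h1).1 h2
    refine (ringHolds_all_ratFunc h1).2 ⟨?_, forall_ringHolds_const_of_subset h h1 h4⟩
    rw [← pointedHolds_liftFormula (a := RatFunc.X), ← pointedHolds_atConst] at h3 ⊢
    exact exTheory_ratFunc_holds hex (level_atConst (level_liftFormula h1)) h3
  · intro φ ψ _ _ h3 h4 h2
    rw [ringHolds_inf] at h2 ⊢
    exact ⟨h3 h2.1, h4 h2.2⟩
  · intro φ ψ _ _ h3 h4 h2
    rw [ringHolds_sup] at h2 ⊢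
    exact h2.imp h3 h4

end

end FieldFragments

/-! ### Primitive recursive functions in compositional form -/

attribute [fun_prop] Primrec
attribute [fun_prop] Primrec.id Primrec.const Primrec.comp Primrec.pair

namespace FieldFragments

open FirstOrder FirstOrder.Language

section

variable {α β γ σ : Type*} [Primcodable α] [Primcodable β] [Primcodable γ] [Primcodable σ]

@[fun_prop] theorem primrec_fst {f : α → β × γ} (hf : Primrec f) : Primrec fun a => (f a).1 :=
  Primrec.fst.comp hf

@[fun_prop] theorem primrec_snd {f : α → β × γ} (hf : Primrec f) : Primrec fun a => (f a).2 :=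
  Primrec.snd.comp hf

@[fun_prop] theorem primrec_add {f g : α → ℕ} (hf : Primrec f) (hg : Primrec g) :
    Primrec fun a => f a + g a := Primrec.nat_add.comp hf hg

@[fun_prop] theorem primrec_sub {f g : α → ℕ} (hf : Primrec f) (hg : Primrec g) :
    Primrec fun a => f a - g a := Primrec.nat_sub.comp hf hg

@[fun_prop] theorem primrec_mul {f g : α → ℕ} (hf : Primrec f) (hg : Primrec g) :
    Primrec fun a => f a * g a := Primrec.nat_mul.comp hf hg

@[fun_prop] theorem primrec_div {f g : α → ℕ} (hf : Primrec f) (hg : Primrec g) :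
    Primrec fun a => f a / g a := Primrec.nat_div.comp hf hg

@[fun_prop] theorem primrec_mod {f g : α → ℕ} (hf : Primrec f) (hg : Primrec g) :
    Primrec fun a => f a % g a := Primrec.nat_mod.comp hf hg

@[fun_prop] theorem primrec_natPair {f g : α → ℕ} (hf : Primrec f) (hg : Primrec g) :
    Primrec fun a => Nat.pair (f a) (g a) := Primrec₂.natPair.comp hf hg

@[fun_prop] theorem primrec_unpair {f : α → ℕ} (hf : Primrec f) :
    Primrec fun a => Nat.unpair (f a) := Primrec.unpair.comp hf

@[fun_prop] theorem primrec_encode {f : α → β} (hf : Primrec f) :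
    Primrec fun a => Encodable.encode (f a) := Primrec.encode.comp hf

@[fun_prop] theorem primrec_ofNatList {f : α → ℕ} (hf : Primrec f) :
    Primrec fun a => Denumerable.ofNat (List ℕ) (f a) := (Primrec.ofNat (List ℕ)).comp hf

@[fun_prop] theorem primrec_ite {f g : α → σ} {b c : α → ℕ} (hb : Primrec b) (hc : Primrec c)
    (hf : Primrec f) (hg : Primrec g) : Primrec fun a => if b a = c a then f a else g a :=
  Primrec.ite (Primrec.eq.comp hb hc) hf hg

@[fun_prop] theorem primrec_cond {c : α → Bool} {f g : α → σ} (hc : Primrec c)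
    (hf : Primrec f) (hg : Primrec g) : Primrec fun a => if c a = true then f a else g a :=
  Primrec.ite (Primrec.eq.comp hc (Primrec.const true)) hf hg

@[fun_prop] theorem primrec_decide_lt {b c : α → ℕ} (hb : Primrec b) (hc : Primrec c) :
    Primrec fun a => decide (b a < c a) := Primrec.nat_lt.decide.comp hb hc

@[fun_prop] theorem primrec_decide_eq {b c : α → ℕ} (hb : Primrec b) (hc : Primrec c) :
    Primrec fun a => decide (b a = c a) := Primrec.eq.decide.comp hb hc

@[fun_prop] theorem primrec_decide_eq_option {b c : α → Option ℕ} (hb : Primrec b)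
    (hc : Primrec c) : Primrec fun a => decide (b a = c a) := Primrec.eq.decide.comp hb hc

@[fun_prop] theorem primrec_and {b c : α → Bool} (hb : Primrec b) (hc : Primrec c) :
    Primrec fun a => b a && c a := Primrec.and.comp hb hc

@[fun_prop] theorem primrec_or {b c : α → Bool} (hb : Primrec b) (hc : Primrec c) :
    Primrec fun a => b a || c a := Primrec.or.comp hb hc

@[fun_prop] theorem primrec_map {f : α → List β} {g : α → β → σ} (hf : Primrec f)
    (hg : Primrec fun p : α × β => g p.1 p.2) : Primrec fun a => (f a).map (g a) :=
  Primrec.list_map hf hg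

@[fun_prop] theorem primrec_cons {f : α → β} {g : α → List β} (hf : Primrec f) (hg : Primrec g) :
    Primrec fun a => f a :: g a := Primrec.list_cons.comp hf hg

@[fun_prop] theorem primrec_length {f : α → List β} (hf : Primrec f) :
    Primrec fun a => (f a).length := Primrec.list_length.comp hf

@[fun_prop] theorem primrec_range {f : α → ℕ} (hf : Primrec f) :
    Primrec fun a => List.range (f a) := Primrec.list_range.comp hf

@[fun_prop] theorem primrec_getElem? {f : α → List β} {g : α → ℕ} (hf : Primrec f)
    (hg : Primrec g) : Primrec fun a => (f a)[g a]? := Primrec.list_getElem?.comp hf hg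

@[fun_prop] theorem primrec_getD {f : α → List β} {g : α → ℕ} {d : α → β} (hf : Primrec f)
    (hg : Primrec g) (hd : Primrec d) : Primrec fun a => (f a).getD (g a) (d a) :=
  (Primrec.option_getD.comp (Primrec.list_getElem?.comp hf hg) hd).of_eq fun a => by
    simp [List.getD]

@[fun_prop] theorem primrec_all {f : α → List Bool} (hf : Primrec f) :
    Primrec fun a => (f a).all id :=
  (Primrec.list_foldr (h := fun _ (p : Bool × Bool) => p.1 && p.2) hf (Primrec.const true)
    (by unfold Primrec₂; fun_prop)).of_eq fun a => by
      induction f a <;> simp_all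

/-- The function defined by recursion along a measure. -/
def measureRec (m : β → ℕ) (l : β → List β) (g : β → List σ → σ)
    (ord : ∀ b, ∀ b' ∈ l b, m b' < m b) (b : β) : σ :=
  g b ((l b).attach.map fun b' => measureRec m l g ord b'.1)
termination_by m b
decreasing_by exact ord _ _ b'.2

omit [Primcodable β] [Primcodable σ] in
theorem measureRec_eq {m : β → ℕ} {l : β → List β} {g : β → List σ → σ}
    {ord : ∀ b, ∀ b' ∈ l b, m b' < m b} (b : β) :
    measureRec m l g ord b = g b ((l b).map (measureRec m l g ord)) := by
  rw [measureRec]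
  congr 1
  simp

/-- Course-of-values recursion: the measure bounds the depth, and both the recursive calls and the
step are primitive recursive. -/
theorem primrec_measureRec {m : β → ℕ} {l : β → List β} {g : β → List σ → σ}
    {ord : ∀ b, ∀ b' ∈ l b, m b' < m b} (hm : Primrec m) (hl : Primrec l)
    (hg : Primrec fun p : β × List σ => g p.1 p.2) : Primrec (measureRec m l g ord) :=
  Primrec.nat_omega_rec' _ (g := fun b r => some (g b r)) hm hl
    (Primrec.option_some.comp hg) ord fun b => by rw [measureRec_eq]

end

/-! ### Arithmetic of Gödel numbers -/



def impCode (a b : ℕ) : ℕ := 4 * Nat.pair a b + 3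
def allCode (a : ℕ) : ℕ := 4 * a + 4
def eqCode (s t : ℕ) : ℕ := 4 * Nat.pair s t + 1
def notCode (a : ℕ) : ℕ := impCode a 0
def exCode (a : ℕ) : ℕ := notCode (allCode (notCode a))
def infCode (a b : ℕ) : ℕ := notCode (impCode a (notCode b))
def supCode (a b : ℕ) : ℕ := impCode (notCode a) b

theorem impCode_inj {a b c d : ℕ} : impCode a b = impCode c d ↔ a = c ∧ b = d := by
  simp [impCode, Nat.pair_eq_pair]

theorem notCode_inj {a b : ℕ} : notCode a = notCode b ↔ a = b := by simp [notCode, impCode_inj]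

theorem allCode_inj {a b : ℕ} : allCode a = allCode b ↔ a = b := by simp [allCode]

theorem impCode_ne_zero {a b : ℕ} : impCode a b ≠ 0 := by simp [impCode]

theorem impCode_ne_allCode {a b c : ℕ} : impCode a b ≠ allCode c := by
  simp only [impCode, allCode]; omega

theorem impCode_ne_eqCode {a b c d : ℕ} : impCode a b ≠ eqCode c d := by
  simp only [impCode, eqCode]; omega

theorem allCode_ne_eqCode {a c d : ℕ} : allCode a ≠ eqCode c d := by
  simp only [allCode, eqCode]; omega

theorem lt_impCode {a b : ℕ} : a < impCode a b ∧ b < impCode a b := by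
  have := Nat.left_le_pair a b
  have := Nat.right_le_pair a b
  simp only [impCode]; omega

theorem lt_eqCode {a b : ℕ} : a < eqCode a b ∧ b < eqCode a b := by
  have := Nat.left_le_pair a b
  have := Nat.right_le_pair a b
  simp only [eqCode]; omega

theorem lt_allCode {a : ℕ} : a < allCode a := by simp only [allCode]; omega

theorem lt_notCode {a : ℕ} : a < notCode a := lt_impCode.1

theorem lt_exCode {a : ℕ} : a < exCode a := lt_notCode.trans (lt_allCode.trans lt_notCode)

theorem lt_infCode {a b : ℕ} : a < infCode a b ∧ b < infCode a b :=
  ⟨lt_impCode.1.trans lt_notCode, lt_notCode.trans (lt_impCode.2.trans lt_notCode)⟩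

theorem lt_supCode {a b : ℕ} : a < supCode a b ∧ b < supCode a b :=
  ⟨lt_notCode.trans lt_impCode.1, lt_impCode.2⟩

/-- Outermost logical symbol of the formula with a given number, and the numbers of its parts.
The derived symbols `∃`, `⊓` and `⊔` take precedence over implication. -/
def shape (m : ℕ) : ℕ × ℕ × ℕ :=
  if m = exCode ((((m / 4).unpair.1 / 4 - 1) / 4).unpair.1) then
    (1, (((m / 4).unpair.1 / 4 - 1) / 4).unpair.1, 0)
  else if m = infCode ((m / 4).unpair.1 / 4).unpair.1
      ((((m / 4).unpair.1 / 4).unpair.2 / 4).unpair.1) then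
    (2, ((m / 4).unpair.1 / 4).unpair.1, ((((m / 4).unpair.1 / 4).unpair.2 / 4).unpair.1))
  else if m = supCode ((m / 4).unpair.1 / 4).unpair.1 (m / 4).unpair.2 then
    (3, ((m / 4).unpair.1 / 4).unpair.1, (m / 4).unpair.2)
  else if m = impCode (m / 4).unpair.1 (m / 4).unpair.2 then
    (4, (m / 4).unpair.1, (m / 4).unpair.2)
  else if m = allCode (m / 4 - 1) then (5, m / 4 - 1, 0)
  else if m = eqCode (m / 4).unpair.1 (m / 4).unpair.2 then
    (6, (m / 4).unpair.1, (m / 4).unpair.2)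
  else if m = 0 then (0, 0, 0) else (7, 0, 0)

@[fun_prop] theorem primrec_impCode {α : Type*} [Primcodable α] {f g : α → ℕ} (hf : Primrec f)
    (hg : Primrec g) : Primrec fun a => impCode (f a) (g a) := by unfold impCode; fun_prop

@[fun_prop] theorem primrec_eqCode {α : Type*} [Primcodable α] {f g : α → ℕ} (hf : Primrec f)
    (hg : Primrec g) : Primrec fun a => eqCode (f a) (g a) := by unfold eqCode; fun_prop

@[fun_prop] theorem primrec_allCode {α : Type*} [Primcodable α] {f : α → ℕ} (hf : Primrec f) :
    Primrec fun a => allCode (f a) := by unfold allCode; fun_prop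

@[fun_prop] theorem primrec_exCode {α : Type*} [Primcodable α] {f : α → ℕ} (hf : Primrec f) :
    Primrec fun a => exCode (f a) := by unfold exCode notCode; fun_prop

@[fun_prop] theorem primrec_infCode {α : Type*} [Primcodable α] {f g : α → ℕ} (hf : Primrec f)
    (hg : Primrec g) : Primrec fun a => infCode (f a) (g a) := by
  unfold infCode notCode; fun_prop

@[fun_prop] theorem primrec_supCode {α : Type*} [Primcodable α] {f g : α → ℕ} (hf : Primrec f)
    (hg : Primrec g) : Primrec fun a => supCode (f a) (g a) := by
  unfold supCode notCode; fun_prop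

@[fun_prop] theorem primrec_shape {α : Type*} [Primcodable α] {f : α → ℕ} (hf : Primrec f) :
    Primrec fun a => shape (f a) := by unfold shape; fun_prop

theorem shape_exCode (a : ℕ) : shape (exCode a) = (1, a, 0) := by
  have h : (((exCode a / 4).unpair.1 / 4 - 1) / 4).unpair.1 = a := by
    have h1 : exCode a / 4 = Nat.pair (allCode (notCode a)) 0 := by
      simp only [exCode]; rw [notCode, impCode]; omega
    have h2 : (allCode (notCode a) / 4 - 1) / 4 = Nat.pair a 0 := by
      simp only [allCode, notCode, impCode]; omega
    rw [h1, Nat.unpair_pair, h2, Nat.unpair_pair]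
  rw [shape, h, if_pos rfl]

/-- All three derived symbols unfold to implications. This and the next two lemmas show that their
patterns are disjoint, so that `shape` can recover each of them. -/
theorem infCode_ne_exCode {a b c : ℕ} : infCode a b ≠ exCode c := by
  simp [infCode, exCode, notCode_inj, impCode_ne_allCode]

theorem supCode_ne_exCode {a b c : ℕ} : supCode a b ≠ exCode c := by
  simp [supCode, exCode, notCode, impCode_inj, impCode_ne_allCode]

theorem supCode_ne_infCode {a b c d : ℕ} : supCode a b ≠ infCode c d := by
  simp [supCode, infCode, notCode, impCode_inj, impCode_ne_zero.symm]

theorem shape_infCode (a b : ℕ) : shape (infCode a b) = (2, a, b) := by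
  have h1 : infCode a b / 4 = Nat.pair (impCode a (notCode b)) 0 := by
    simp only [infCode]; rw [notCode, impCode]; omega
  have h2 : impCode a (notCode b) / 4 = Nat.pair a (notCode b) := by
    simp only [impCode]; omega
  have h3 : notCode b / 4 = Nat.pair b 0 := by
    simp only [notCode, impCode]; omega
  rw [shape, if_neg infCode_ne_exCode]
  simp only [h1, h2, h3, Nat.unpair_pair, if_true]

theorem shape_supCode (a b : ℕ) : shape (supCode a b) = (3, a, b) := by
  have h1 : supCode a b / 4 = Nat.pair (notCode a) b := by
    simp only [supCode, impCode]; omega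
  have h2 : notCode a / 4 = Nat.pair a 0 := by
    simp only [notCode, impCode]; omega
  rw [shape, if_neg supCode_ne_exCode, if_neg supCode_ne_infCode]
  simp only [h1, h2, Nat.unpair_pair, if_true]

/-- Not every implication is reported as such: its number may also be that of a derived symbol, and
then that reading wins. -/
theorem shape_impCode (a b : ℕ) : (∃ c, impCode a b = exCode c) ∨
    (∃ c d, impCode a b = infCode c d) ∨ (∃ c d, impCode a b = supCode c d) ∨
    shape (impCode a b) = (4, a, b) := by
  have h1 : impCode a b / 4 = Nat.pair a b := by
    simp only [impCode]; omega
  rw [shape]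
  split_ifs with h2 h3 h4 h5
  · exact .inl ⟨_, h2⟩
  · exact .inr (.inl ⟨_, _, h3⟩)
  · exact .inr (.inr (.inl ⟨_, _, h4⟩))
  · simp [h1]
  all_goals simp [h1] at h5

theorem shape_allCode (a : ℕ) : shape (allCode a) = (5, a, 0) := by
  have h1 : allCode a / 4 - 1 = a := by simp only [allCode]; omega
  have h2 : ∀ c, allCode a ≠ exCode c := fun _ => impCode_ne_allCode.symm
  have h3 : ∀ c d, allCode a ≠ infCode c d := fun _ _ => impCode_ne_allCode.symm
  have h4 : ∀ c d, allCode a ≠ supCode c d := fun _ _ => impCode_ne_allCode.symm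
  rw [shape, if_neg (h2 _), if_neg (h3 _ _), if_neg (h4 _ _), if_neg impCode_ne_allCode.symm, h1,
    if_pos rfl]

theorem shape_eqCode (a b : ℕ) : shape (eqCode a b) = (6, a, b) := by
  have h1 : eqCode a b / 4 = Nat.pair a b := by simp only [eqCode]; omega
  have h2 : ∀ c, eqCode a b ≠ exCode c := fun _ => impCode_ne_eqCode.symm
  have h3 : ∀ c d, eqCode a b ≠ infCode c d := fun _ _ => impCode_ne_eqCode.symm
  have h4 : ∀ c d, eqCode a b ≠ supCode c d := fun _ _ => impCode_ne_eqCode.symm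
  rw [shape, if_neg (h2 _), if_neg (h3 _ _), if_neg (h4 _ _), if_neg impCode_ne_eqCode.symm,
    if_neg allCode_ne_eqCode.symm]
  simp [h1]

theorem shape_zero : shape 0 = (0, 0, 0) := by
  simp [shape, exCode, infCode, supCode, notCode, impCode, allCode, eqCode]

theorem shape_cases (m : ℕ) : m = 0 ∨ (∃ a, m = exCode a) ∨ (∃ a b, m = infCode a b) ∨
    (∃ a b, m = supCode a b) ∨ (∃ a b, m = impCode a b ∧ shape m = (4, a, b)) ∨
    (∃ a, m = allCode a) ∨ (∃ a b, m = eqCode a b) ∨ shape m = (7, 0, 0) := by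
  rw [shape]
  split_ifs with h1 h2 h3 h4 h5 h6 h7
  · exact .inr (.inl ⟨_, h1⟩)
  · exact .inr (.inr (.inl ⟨_, _, h2⟩))
  · exact .inr (.inr (.inr (.inl ⟨_, _, h3⟩)))
  · exact .inr (.inr (.inr (.inr (.inl ⟨_, _, h4, rfl⟩))))
  · exact .inr (.inr (.inr (.inr (.inr (.inl ⟨_, h5⟩)))))
  · exact .inr (.inr (.inr (.inr (.inr (.inr (.inl ⟨_, _, h6⟩))))))
  · exact .inl h7
  · simp

/-- Ensures termination of the recursions along `shape`. The values `0` and `7` are excluded because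
they have no parts. -/
theorem shape_lt {m : ℕ} (h1 : (shape m).1 ≠ 0) (h7 : (shape m).1 ≠ 7) :
    (shape m).2.1 < m ∧ (shape m).2.2 < m := by
  obtain rfl | ⟨a, rfl⟩ | ⟨a, b, rfl⟩ | ⟨a, b, rfl⟩ | ⟨a, b, rfl, h⟩ | ⟨a, rfl⟩ | ⟨a, b, rfl⟩ | h :=
    shape_cases m
  · exact absurd (congrArg Prod.fst shape_zero) h1
  · rw [shape_exCode]; exact ⟨lt_exCode, lt_exCode.pos⟩
  · rw [shape_infCode]; exact lt_infCode
  · rw [shape_supCode]; exact lt_supCode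
  · rw [h]; exact lt_impCode
  · rw [shape_allCode]; exact ⟨lt_allCode, lt_allCode.pos⟩
  · rw [shape_eqCode]; exact lt_eqCode
  · exact absurd (congrArg Prod.fst h) h7

/-! ### Gödel numbers of terms -/

def varCode (i : ℕ) : ℕ := 2 * i
def funcCode (f : ℕ) (l : List ℕ) : ℕ := 2 * Nat.pair f (Encodable.encode l) + 1

/-- Numbers of the arguments of the outermost function symbol. -/
def termArgs (m : ℕ) : List ℕ :=
  if m % 2 = 0 then [] else Denumerable.ofNat (List ℕ) (m / 2).unpair.2

/-- A nonempty list is encoded as the successor of a pair, which dominates the head and the code of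
the tail. -/
theorem mem_le_encode_list {a : ℕ} : ∀ {l : List ℕ}, a ∈ l → a < Encodable.encode l
  | b :: l, h => by
    rw [Encodable.encode_list_cons, Encodable.encode_nat]
    have h1 := Nat.left_le_pair b (Encodable.encode l)
    have h2 := Nat.right_le_pair b (Encodable.encode l)
    rcases List.mem_cons.1 h with rfl | h
    · omega
    · have := mem_le_encode_list h
      omega

theorem termArgs_funcCode (f : ℕ) (l : List ℕ) : termArgs (funcCode f l) = l := by
  have h1 : funcCode f l / 2 = Nat.pair f (Encodable.encode l) := by simp only [funcCode]; omega
  have h2 : funcCode f l % 2 ≠ 0 := by simp only [funcCode]; omega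
  rw [termArgs, if_neg h2, h1, Nat.unpair_pair, Denumerable.ofNat_encode]

theorem funcCode_head (f : ℕ) (l : List ℕ) : (funcCode f l / 2).unpair.1 = f := by
  have h1 : funcCode f l / 2 = Nat.pair f (Encodable.encode l) := by simp only [funcCode]; omega
  rw [h1, Nat.unpair_pair]

theorem lt_funcCode {f a : ℕ} {l : List ℕ} (h : a ∈ l) : a < funcCode f l := by
  have := mem_le_encode_list h
  have := Nat.right_le_pair f (Encodable.encode l)
  simp only [funcCode]; omega

theorem term_cases (m : ℕ) : (∃ i, m = varCode i) ∨ ∃ f l, m = funcCode f l := by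
  rcases Nat.even_or_odd' m with ⟨x, h | h⟩
  · exact .inl ⟨x, h⟩
  · refine .inr ⟨x.unpair.1, Denumerable.ofNat (List ℕ) x.unpair.2, ?_⟩
    rw [funcCode, Denumerable.encode_ofNat, Nat.pair_unpair, h]

theorem varCode_mod (i : ℕ) : varCode i % 2 = 0 := by simp [varCode]
theorem varCode_div (i : ℕ) : varCode i / 2 = i := by simp [varCode]
theorem funcCode_mod (f : ℕ) (l : List ℕ) : ¬ funcCode f l % 2 = 0 := by
  simp only [funcCode]; omega

theorem termArgs_lt (m : ℕ) : ∀ a ∈ termArgs m, a < m := by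
  obtain ⟨i, rfl⟩ | ⟨f, l, rfl⟩ := term_cases m
  · simp [termArgs, varCode]
  · rw [termArgs_funcCode]
    exact fun a h => lt_funcCode h

@[fun_prop] theorem primrec_termArgs {α : Type*} [Primcodable α] {f : α → ℕ} (hf : Primrec f) :
    Primrec fun a => termArgs (f a) := by unfold termArgs; fun_prop

@[fun_prop] theorem primrec_funcCode {α : Type*} [Primcodable α] {f : α → ℕ} {g : α → List ℕ}
    (hf : Primrec f) (hg : Primrec g) : Primrec fun a => funcCode (f a) (g a) := by
  unfold funcCode; fun_prop

/-! ### Recognizing Gödel numbers of terms and formulas -/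

/-- Whether `p.2` is the number of a term in `p.1` variables; `ar` lists the arities of the
function symbols. -/
def termValid (ar : List ℕ) : ℕ × ℕ → Bool :=
  measureRec Prod.snd (fun b => (termArgs b.2).map fun a => (b.1, a))
    (fun b r => if b.2 % 2 = 0 then decide (b.2 / 2 < b.1)
      else decide (ar[(b.2 / 2).unpair.1]? = some (termArgs b.2).length) && r.all id)
    (by
      intro b b' h
      obtain ⟨a, ha, rfl⟩ := List.mem_map.1 h
      exact termArgs_lt _ _ ha)

@[fun_prop] theorem primrec_termValid (ar : List ℕ) : Primrec (termValid ar) := by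
  have h : Primrec fun n : ℕ => some n := Primrec.option_some
  refine primrec_measureRec ?_ ?_ ?_ <;> fun_prop

theorem termValid_varCode (ar : List ℕ) (n i : ℕ) :
    termValid ar (n, varCode i) = decide (i < n) := by
  rw [termValid, measureRec_eq]
  simp [varCode_mod, varCode_div]

theorem termValid_funcCode (ar : List ℕ) (n f : ℕ) (l : List ℕ) :
    termValid ar (n, funcCode f l) =
      (decide (ar[f]? = some l.length) && l.all fun a => termValid ar (n, a)) := by
  rw [termValid, measureRec_eq]
  simp [funcCode_mod, funcCode_head, termArgs_funcCode, Function.comp_def, List.all_map]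

/-- Recursive calls in the recognition of formulas. -/
def formCalls (b : ℕ × ℕ × ℕ) : List (ℕ × ℕ × ℕ) :=
  if (shape b.2.2).1 = 1 then [(1, b.2.1 + 1, (shape b.2.2).2.1)]
  else if (shape b.2.2).1 = 2 then [(b.1, b.2.1, (shape b.2.2).2.1), (b.1, b.2.1, (shape b.2.2).2.2)]
  else if (shape b.2.2).1 = 3 then [(b.1, b.2.1, (shape b.2.2).2.1), (b.1, b.2.1, (shape b.2.2).2.2)]
  else if (shape b.2.2).1 = 4 then [(0, b.2.1, (shape b.2.2).2.1), (0, b.2.1, (shape b.2.2).2.2)]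
  else if (shape b.2.2).1 = 5 then [(if b.1 = 3 then 1 else b.1, b.2.1 + 1, (shape b.2.2).2.1)]
  else []

/-- Whether `b.2.2` is the number of a formula of level `b.1` in `b.2.1` variables. -/
def formValid (ar : List ℕ) : ℕ × ℕ × ℕ → Bool :=
  measureRec (fun b => b.2.2) formCalls
    (fun b r =>
      if (shape b.2.2).1 = 0 then true
      else if (shape b.2.2).1 = 1 then decide (0 < b.1) && r.all id
      else if (shape b.2.2).1 = 5 then (decide (b.1 = 2) || decide (b.1 = 3)) && r.all id
      else if (shape b.2.2).1 = 6 then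
        termValid ar (b.2.1, (shape b.2.2).2.1) && termValid ar (b.2.1, (shape b.2.2).2.2)
      else if (shape b.2.2).1 = 7 then false
      else r.all id)
    (by
      intro b b' h
      have key := @shape_lt b.2.2
      unfold formCalls at h
      split_ifs at h with h1 h2 h3 h4 h5 h6 <;>
        simp only [List.mem_cons, List.not_mem_nil, or_false] at h
      · subst h; exact (key (by omega) (by omega)).1
      · rcases h with rfl | rfl
        · exact (key (by omega) (by omega)).1
        · exact (key (by omega) (by omega)).2
      · rcases h with rfl | rfl
        · exact (key (by omega) (by omega)).1
        · exact (key (by omega) (by omega)).2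
      · rcases h with rfl | rfl
        · exact (key (by omega) (by omega)).1
        · exact (key (by omega) (by omega)).2
      · subst h; exact (key (by omega) (by omega)).1
      · subst h; exact (key (by omega) (by omega)).1)

@[fun_prop] theorem primrec_formValid (ar : List ℕ) : Primrec (formValid ar) := by
  refine primrec_measureRec ?_ ?_ ?_
  · fun_prop
  · unfold formCalls; fun_prop
  · fun_prop

section

variable (ar : List ℕ) (l n : ℕ)

theorem formValid_zero : formValid ar (l, n, 0) = true := by
  rw [formValid, measureRec_eq]; simp [shape_zero]

theorem formValid_exCode (a : ℕ) : formValid ar (l, n, exCode a) =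
    (decide (0 < l) && formValid ar (1, n + 1, a)) := by
  rw [formValid, measureRec_eq]; simp [formCalls, shape_exCode]

theorem formValid_infCode (a b : ℕ) : formValid ar (l, n, infCode a b) =
    (formValid ar (l, n, a) && formValid ar (l, n, b)) := by
  rw [formValid, measureRec_eq]; simp [formCalls, shape_infCode]

theorem formValid_supCode (a b : ℕ) : formValid ar (l, n, supCode a b) =
    (formValid ar (l, n, a) && formValid ar (l, n, b)) := by
  rw [formValid, measureRec_eq]; simp [formCalls, shape_supCode]

theorem formValid_impCode {a b : ℕ} (h : shape (impCode a b) = (4, a, b)) :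
    formValid ar (l, n, impCode a b) = (formValid ar (0, n, a) && formValid ar (0, n, b)) := by
  rw [formValid, measureRec_eq]; simp [formCalls, h]

theorem formValid_allCode (a : ℕ) : formValid ar (l, n, allCode a) =
    ((decide (l = 2) || decide (l = 3)) &&
      formValid ar (if l = 3 then 1 else l, n + 1, a)) := by
  rw [formValid, measureRec_eq]; simp [formCalls, shape_allCode]

theorem formValid_eqCode (a b : ℕ) : formValid ar (l, n, eqCode a b) =
    (termValid ar (n, a) && termValid ar (n, b)) := by
  rw [formValid, measureRec_eq]; simp [shape_eqCode]

theorem formValid_of_shape {m : ℕ} (h : shape m = (7, 0, 0)) :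
    formValid ar (l, n, m) = false := by
  rw [formValid, measureRec_eq]; simp [h]

end

/-! ### Correctness of the recognition of Gödel numbers -/

section

variable {L : FirstOrder.Language.{u, v}} (P : Presentation L) {n : ℕ}

theorem termCode_func {k : ℕ} (f : L.Functions k) (ts : Fin k → L.Term (Empty ⊕ Fin n)) :
    P.termCode (.func f ts) = funcCode (P.funcNum ⟨k, f⟩) (List.ofFn fun i => P.termCode (ts i)) :=
  rfl

theorem termCode_var (i : Fin n) : P.termCode (.var (.inr i) : L.Term (Empty ⊕ Fin n)) =
    varCode i := rfl

theorem code_equal (s t : L.Term (Empty ⊕ Fin n)) :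
    P.code (.equal s t) = eqCode (P.termCode s) (P.termCode t) := rfl

theorem code_imp (φ ψ : L.BoundedFormula Empty n) :
    P.code (φ.imp ψ) = impCode (P.code φ) (P.code ψ) := rfl

theorem code_all (φ : L.BoundedFormula Empty (n + 1)) : P.code φ.all = allCode (P.code φ) := rfl

theorem code_ex (φ : L.BoundedFormula Empty (n + 1)) : P.code φ.ex = exCode (P.code φ) := rfl

theorem code_inf (φ ψ : L.BoundedFormula Empty n) :
    P.code (φ ⊓ ψ) = infCode (P.code φ) (P.code ψ) := rfl

theorem code_sup (φ ψ : L.BoundedFormula Empty n) :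
    P.code (φ ⊔ ψ) = supCode (P.code φ) (P.code ψ) := rfl

variable {P} {ar : List ℕ}

theorem termValid_iff (har : ∀ N k, ar[N]? = some k ↔ ∃ f : L.Functions k, P.funcNum ⟨k, f⟩ = N)
    {m : ℕ} : termValid ar (n, m) = true ↔ ∃ t : L.Term (Empty ⊕ Fin n), P.termCode t = m := by
  constructor
  · induction m using Nat.strong_induction_on with
    | _ m ih =>
      intro h
      obtain ⟨i, rfl⟩ | ⟨f, l, rfl⟩ := term_cases m
      · rw [termValid_varCode, decide_eq_true_iff] at h
        exact ⟨.var (.inr ⟨i, h⟩), rfl⟩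
      · rw [termValid_funcCode, Bool.and_eq_true, decide_eq_true_iff, har, List.all_eq_true] at h
        obtain ⟨⟨g, hg⟩, h⟩ := h
        have : ∀ i : Fin l.length, ∃ t : L.Term (Empty ⊕ Fin n), P.termCode t = l[i] := fun i =>
          ih _ (lt_funcCode (List.getElem_mem _)) (h _ (List.getElem_mem _))
        choose ts hts using this
        refine ⟨.func g ts, ?_⟩
        rw [termCode_func, hg]
        simp only [hts]
        congr 1
        exact List.ofFn_getElem
  · rintro ⟨t, rfl⟩
    induction t with
    | var x =>
      rcases x with x | x
      · exact x.elim
      · rw [termCode_var, termValid_varCode, decide_eq_true_iff]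
        exact x.2
    | func f ts ih =>
      rw [termCode_func, termValid_funcCode, Bool.and_eq_true, decide_eq_true_iff, har,
        List.all_eq_true, List.length_ofFn]
      refine ⟨⟨f, rfl⟩, fun a ha => ?_⟩
      obtain ⟨i, rfl⟩ := (List.mem_ofFn' _ _).1 ha
      exact ih i

theorem isQF_of_code_eq_impCode {φ : L.BoundedFormula Empty n} (h : φ.IsQF) {a b : ℕ}
    (hc : P.code φ = impCode a b) : ∃ ψ χ : L.BoundedFormula Empty n, ψ.IsQF ∧ χ.IsQF ∧
      P.code ψ = a ∧ P.code χ = b := by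
  cases h with
  | falsum => exact absurd hc.symm impCode_ne_zero
  | of_isAtomic h =>
    cases h with
    | equal s t => exact absurd hc.symm impCode_ne_eqCode
    | rel R ts =>
      simp only [Relations.boundedFormula, Presentation.code, impCode] at hc
      omega
  | imp h1 h2 =>
    obtain ⟨h3, h4⟩ := impCode_inj.1 hc
    exact ⟨_, _, h1, h2, h3, h4⟩

theorem code_ne_allCode_of_isQF {φ : L.BoundedFormula Empty n} (h : φ.IsQF) (a : ℕ) :
    P.code φ ≠ allCode a := by
  cases h with
  | falsum => simp [Presentation.code, allCode]
  | of_isAtomic h =>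
    cases h with
    | equal s t => exact allCode_ne_eqCode.symm
    | rel R ts =>
      simp only [Relations.boundedFormula, Presentation.code, allCode]
      omega
  | imp h1 h2 => exact impCode_ne_allCode

/-- The recognizer may read a quantifier-free implication as `⊓` or `⊔`. The parts in that reading
are quantifier-free too, so induction on the number works where induction on the formula would not.
A reading as `∃` is impossible, since it would exhibit a quantifier. -/
theorem formValid_of_isQF [∀ k, IsEmpty (L.Relations k)]
    (har : ∀ N k, ar[N]? = some k ↔ ∃ f : L.Functions k, P.funcNum ⟨k, f⟩ = N)
    (m l : ℕ) {φ : L.BoundedFormula Empty n} (h : φ.IsQF) (hm : P.code φ = m) :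
    formValid ar (l, n, m) = true := by
  induction m using Nat.strong_induction_on generalizing l φ with
  | _ m ih =>
    by_cases hi : ∃ a b, m = impCode a b
    · obtain ⟨a, b, rfl⟩ := hi
      obtain ⟨c, hc⟩ | ⟨c, d, hc⟩ | ⟨c, d, hc⟩ | hc := shape_impCode a b
      · obtain ⟨ψ, χ, h1, h2, h3, h4⟩ := isQF_of_code_eq_impCode h hm
        exact absurd (h3.trans (impCode_inj.1 hc).1) (code_ne_allCode_of_isQF h1 _)
      · rw [hc] at hm ih ⊢
        obtain ⟨ψ, -, h1, -, h3, -⟩ := isQF_of_code_eq_impCode h hm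
        obtain ⟨ψ', χ, h5, h6, h7, h8⟩ := isQF_of_code_eq_impCode h1 h3
        obtain ⟨χ', -, h9, -, h10, -⟩ := isQF_of_code_eq_impCode h6 h8
        rw [formValid_infCode, ih _ lt_infCode.1 _ h5 h7, ih _ lt_infCode.2 _ h9 h10]
        rfl
      · rw [hc] at hm ih ⊢
        obtain ⟨ψ, χ, h1, h2, h3, h4⟩ := isQF_of_code_eq_impCode h hm
        obtain ⟨ψ', -, h5, -, h7, -⟩ := isQF_of_code_eq_impCode h1 h3
        rw [formValid_supCode, ih _ lt_supCode.1 _ h5 h7, ih _ lt_supCode.2 _ h2 h4]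
        rfl
      · obtain ⟨ψ, χ, h1, h2, h3, h4⟩ := isQF_of_code_eq_impCode h hm
        rw [formValid_impCode _ _ _ hc, ih _ lt_impCode.1 _ h1 h3, ih _ lt_impCode.2 _ h2 h4]
        rfl
    · cases h with
      | falsum =>
        subst hm
        exact formValid_zero _ _ _
      | of_isAtomic h =>
        cases h with
        | equal s t =>
          subst hm
          rw [Term.bdEqual, code_equal, formValid_eqCode, (termValid_iff har).2 ⟨s, rfl⟩,
            (termValid_iff har).2 ⟨t, rfl⟩]
          rfl
        | rel R ts => exact isEmptyElim R
      | imp h1 h2 => exact absurd ⟨_, _, hm.symm⟩ hi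

/-- From number to formula, the recursion follows `shape`; a plain implication is admitted only
between formulas of level `0`, that is, quantifier-free ones. -/
theorem formValid_iff [∀ k, IsEmpty (L.Relations k)]
    (har : ∀ N k, ar[N]? = some k ↔ ∃ f : L.Functions k, P.funcNum ⟨k, f⟩ = N)
    {m l : ℕ} : formValid ar (l, n, m) = true ↔
      ∃ φ : L.BoundedFormula Empty n, Level l φ ∧ P.code φ = m := by
  constructor
  · induction m using Nat.strong_induction_on generalizing l n with
    | _ m ih =>
      intro h
      obtain rfl | ⟨a, rfl⟩ | ⟨a, b, rfl⟩ | ⟨a, b, rfl⟩ | ⟨a, b, rfl, hs⟩ | ⟨a, rfl⟩ | ⟨a, b, rfl⟩ |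
        hs := shape_cases m
      · exact ⟨.falsum, .qf .falsum, rfl⟩
      · rw [formValid_exCode, Bool.and_eq_true, decide_eq_true_iff] at h
        obtain ⟨φ, h1, rfl⟩ := ih _ lt_exCode h.2
        exact ⟨φ.ex, .ex h.1 h1, rfl⟩
      · rw [formValid_infCode, Bool.and_eq_true] at h
        obtain ⟨φ, h1, rfl⟩ := ih _ lt_infCode.1 h.1
        obtain ⟨ψ, h2, rfl⟩ := ih _ lt_infCode.2 h.2
        exact ⟨φ ⊓ ψ, .inf h1 h2, rfl⟩
      · rw [formValid_supCode, Bool.and_eq_true] at h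
        obtain ⟨φ, h1, rfl⟩ := ih _ lt_supCode.1 h.1
        obtain ⟨ψ, h2, rfl⟩ := ih _ lt_supCode.2 h.2
        exact ⟨φ ⊔ ψ, .sup h1 h2, rfl⟩
      · rw [formValid_impCode _ _ _ hs, Bool.and_eq_true] at h
        obtain ⟨φ, h1, rfl⟩ := ih _ lt_impCode.1 h.1
        obtain ⟨ψ, h2, rfl⟩ := ih _ lt_impCode.2 h.2
        exact ⟨φ.imp ψ, .qf ((isQF_of_level_zero h1 rfl).imp (isQF_of_level_zero h2 rfl)), rfl⟩
      · rw [formValid_allCode, Bool.and_eq_true, Bool.or_eq_true, decide_eq_true_iff,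
          decide_eq_true_iff] at h
        obtain ⟨φ, h1, rfl⟩ := ih _ lt_allCode h.2
        rcases h.1 with rfl | rfl
        · exact ⟨φ.all, .allMany (by simpa using h1), rfl⟩
        · exact ⟨φ.all, .allOnce (by simpa using h1), rfl⟩
      · rw [formValid_eqCode, Bool.and_eq_true] at h
        obtain ⟨s, rfl⟩ := (termValid_iff har).1 h.1
        obtain ⟨t, rfl⟩ := (termValid_iff har).1 h.2
        exact ⟨.equal s t, .qf (.of_isAtomic (.equal _ _)), rfl⟩
      · rw [formValid_of_shape _ _ _ hs] at h
        exact absurd h (by simp)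
  · rintro ⟨φ, h, rfl⟩
    induction h with
    | qf h => exact formValid_of_isQF har _ _ h rfl
    | ex h1 _ ih =>
      rw [code_ex, formValid_exCode, ih, Bool.and_true, decide_eq_true_iff]
      exact h1
    | allMany _ ih => rw [code_all, formValid_allCode]; simpa using ih
    | allOnce _ ih => rw [code_all, formValid_allCode]; simpa using ih
    | inf _ _ h1 h2 => rw [code_inf, formValid_infCode, h1, h2]; rfl
    | sup _ _ h1 h2 => rw [code_sup, formValid_supCode, h1, h2]; rfl

end

/-- Arities of the function symbols of the language of rings. -/
def ringArities : List ℕ := [2, 2, 1, 0, 0]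

/-- Arities of the function symbols of the language of rings with a constant symbol. -/
def pointedArities : List ℕ := [2, 2, 1, 0, 0, 0]

theorem ringArities_iff (N k : ℕ) : ringArities[N]? = some k ↔
    ∃ f : FirstOrder.Language.ring.Functions k, ringPresentation.funcNum ⟨k, f⟩ = N := by
  constructor
  · match N with
    | 0 => rintro ⟨⟩; exact ⟨.add, rfl⟩
    | 1 => rintro ⟨⟩; exact ⟨.mul, rfl⟩
    | 2 => rintro ⟨⟩; exact ⟨.neg, rfl⟩
    | 3 => rintro ⟨⟩; exact ⟨.zero, rfl⟩
    | 4 => rintro ⟨⟩; exact ⟨.one, rfl⟩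
    | N + 5 => intro h; simp [ringArities] at h
  · rintro ⟨f, rfl⟩
    cases f <;> rfl

theorem pointedArities_iff (N k : ℕ) : pointedArities[N]? = some k ↔
    ∃ f : ringWithConst.Functions k, ringWithConstPresentation.funcNum ⟨k, f⟩ = N := by
  constructor
  · match N with
    | 0 => rintro ⟨⟩; exact ⟨.inl .add, rfl⟩
    | 1 => rintro ⟨⟩; exact ⟨.inl .mul, rfl⟩
    | 2 => rintro ⟨⟩; exact ⟨.inl .neg, rfl⟩
    | 3 => rintro ⟨⟩; exact ⟨.inl .zero, rfl⟩
    | 4 => rintro ⟨⟩; exact ⟨.inl .one, rfl⟩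
    | 5 => rintro ⟨⟩; exact ⟨.inr (), rfl⟩
    | N + 6 => intro h; simp [pointedArities] at h
  · rintro ⟨f | f, rfl⟩
    · cases f <;> rfl
    · match k, f with
      | 0, f => rfl

instance (k : ℕ) : IsEmpty (FirstOrder.Language.ring.Relations k) := ⟨Empty.elim⟩

instance (k : ℕ) : IsEmpty (ringWithConst.Relations k) :=
  ⟨fun R => Sum.elim Empty.elim Empty.elim R⟩

theorem formValid_ring_iff {l n m : ℕ} : formValid ringArities (l, n, m) = true ↔
    ∃ φ : FirstOrder.Language.ring.BoundedFormula Empty n, Level l φ ∧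
      ringPresentation.code φ = m := formValid_iff ringArities_iff

theorem formValid_pointed_iff {l n m : ℕ} : formValid pointedArities (l, n, m) = true ↔
    ∃ φ : ringWithConst.BoundedFormula Empty n, Level l φ ∧
      ringWithConstPresentation.code φ = m := formValid_iff pointedArities_iff

/-! ### Gödel numbers determine formulas -/

theorem termCode_injective {L : FirstOrder.Language.{u, v}} (P : Presentation L) {n : ℕ} :
    Function.Injective (P.termCode (n := n)) := by
  intro s t h
  induction s generalizing t with
  | var x =>
    rcases x with x | x
    · exact x.elim
    rcases t with (y | y) | ⟨g, us⟩
    · exact y.elim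
    · have h : 2 * (x : ℕ) = 2 * (y : ℕ) := h
      rw [Fin.ext (by omega : (x : ℕ) = y)]
    · rw [termCode_var, termCode_func, varCode, funcCode] at h
      omega
  | @func k f ts ih =>
    rcases t with (y | y) | ⟨g, us⟩
    · exact y.elim
    · rw [termCode_var, termCode_func, varCode, funcCode] at h
      omega
    · rw [termCode_func, termCode_func, funcCode, funcCode] at h
      obtain ⟨h1, h2⟩ := Nat.pair_eq_pair.1 (mul_left_cancel₀ two_ne_zero (Nat.succ.inj h))
      obtain ⟨rfl, h3⟩ := Sigma.mk.inj (P.funcNum_injective h1)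
      obtain rfl := eq_of_heq h3
      have h4 := List.ofFn_injective (Encodable.encode_injective h2)
      congr 1
      funext i
      exact ih i (congrFun h4 i)

/-- Residues modulo `4` separate the symbols; `⊥` and `∀` share the residue `0`, but only `⊥` has
number `0`. -/
theorem code_injective {L : FirstOrder.Language.{u, v}} [∀ k, IsEmpty (L.Relations k)]
    (P : Presentation L) {n : ℕ} : Function.Injective (P.code (n := n)) := by
  intro φ ψ h
  induction φ with
  | falsum =>
    cases ψ with
    | falsum => rfl
    | rel R => exact isEmptyElim R
    | _ => simp only [Presentation.code] at h; omega
  | equal s t =>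
    cases ψ with
    | rel R => exact isEmptyElim R
    | equal s' t' =>
      simp only [Presentation.code] at h
      obtain ⟨h1, h2⟩ := Nat.pair_eq_pair.1 (mul_left_cancel₀ four_ne_zero (Nat.succ.inj h))
      rw [termCode_injective P h1, termCode_injective P h2]
    | _ => simp only [Presentation.code] at h; omega
  | rel R => exact isEmptyElim R
  | imp φ₁ φ₂ h1 h2 =>
    cases ψ with
    | rel R => exact isEmptyElim R
    | imp ψ₁ ψ₂ =>
      obtain ⟨h3, h4⟩ := impCode_inj.1 h
      rw [h1 h3, h2 h4]
    | _ => simp only [Presentation.code] at h; omega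
  | all φ ih =>
    cases ψ with
    | rel R => exact isEmptyElim R
    | all ψ => rw [ih (allCode_inj.1 h)]
    | _ => simp only [Presentation.code] at h; omega

theorem termCode_lift {n : ℕ} (t : FirstOrder.Language.ring.Term (Empty ⊕ Fin n)) :
    ringWithConstPresentation.termCode ((FirstOrder.Language.ring.lhomWithConstants Unit).onTerm t)
      = ringPresentation.termCode t := by
  induction t with
  | var x => rfl
  | func f ts ih =>
    rw [LHom.onTerm, termCode_func, termCode_func]
    simp only [ih]
    rfl

/-- The two presentations agree on the ring symbols, so passing to the larger language requires no
computation. -/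
theorem code_liftFormula {n : ℕ} (φ : FirstOrder.Language.ring.BoundedFormula Empty n) :
    ringWithConstPresentation.code (liftFormula φ) = ringPresentation.code φ := by
  induction φ with
  | falsum => rfl
  | equal s t => exact congrArg₂ eqCode (termCode_lift s) (termCode_lift t)
  | rel R => exact isEmptyElim R
  | imp _ _ h1 h2 => exact congrArg₂ impCode h1 h2
  | all _ ih => exact congrArg allCode ih

/-! ### Substitution on Gödel numbers -/

/-- In the term with number `b.2`, variable `i` becomes variable `σ i` for `i` in the range of
the list `σ = b.1.1`, and `i + b.1.2.1` otherwise; the constant symbol becomes the term with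
number `b.1.2.2`. -/
def substTermCode : (List ℕ × ℕ × ℕ) × ℕ → ℕ :=
  measureRec Prod.snd (fun b => (termArgs b.2).map fun a => (b.1, a))
    (fun b r => if b.2 % 2 = 0 then varCode (b.1.1.getD (b.2 / 2) (b.2 / 2 + b.1.2.1))
      else if (b.2 / 2).unpair.1 = 5 then b.1.2.2 else funcCode (b.2 / 2).unpair.1 r)
    (by
      intro b b' h
      obtain ⟨a, ha, rfl⟩ := List.mem_map.1 h
      exact termArgs_lt _ _ ha)

@[fun_prop] theorem primrec_substTermCode : Primrec substTermCode := by
  refine primrec_measureRec ?_ ?_ ?_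
  · fun_prop
  · fun_prop
  · unfold varCode; fun_prop

theorem substTermCode_varCode (e : List ℕ × ℕ × ℕ) (i : ℕ) :
    substTermCode (e, varCode i) = varCode (e.1.getD i (i + e.2.1)) := by
  rw [substTermCode, measureRec_eq]
  simp [varCode_mod, varCode_div]

theorem substTermCode_funcCode (e : List ℕ × ℕ × ℕ) (f : ℕ) (l : List ℕ) :
    substTermCode (e, funcCode f l) =
      if f = 5 then e.2.2 else funcCode f (l.map fun a => substTermCode (e, a)) := by
  rw [substTermCode, measureRec_eq]
  simp [funcCode_mod, funcCode_head, termArgs_funcCode, Function.comp_def]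

/-- The substitution `substTermCode` on formulas. -/
def substCode : (List ℕ × ℕ × ℕ) × ℕ → ℕ :=
  measureRec Prod.snd
    (fun b => if b.2 = 0 then [] else if b.2 % 4 = 3 then
      [(b.1, (b.2 / 4).unpair.1), (b.1, (b.2 / 4).unpair.2)]
      else if b.2 % 4 = 0 then [(b.1, b.2 / 4 - 1)] else [])
    (fun b r => if b.2 = 0 then 0
      else if b.2 % 4 = 3 then impCode (r.getD 0 0) (r.getD 1 0)
      else if b.2 % 4 = 0 then allCode (r.getD 0 0)
      else eqCode (substTermCode (b.1, (b.2 / 4).unpair.1))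
        (substTermCode (b.1, (b.2 / 4).unpair.2)))
    (by
      intro b b' h
      have h1 := Nat.unpair_left_le (b.2 / 4)
      have h2 := Nat.unpair_right_le (b.2 / 4)
      split_ifs at h <;> simp only [List.mem_cons, List.not_mem_nil, or_false] at h
      · rcases h with rfl | rfl <;> dsimp only <;> omega
      · subst h; dsimp only; omega)

theorem primrec_substCode : Primrec substCode := by
  refine primrec_measureRec ?_ ?_ ?_ <;> fun_prop

@[fun_prop] theorem primrec_substCode_comp {α : Type*} [Primcodable α]
    {f : α → (List ℕ × ℕ × ℕ) × ℕ} (hf : Primrec f) : Primrec fun a => substCode (f a) :=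
  primrec_substCode.comp hf

theorem substCode_zero (e : List ℕ × ℕ × ℕ) : substCode (e, 0) = 0 := by
  rw [substCode, measureRec_eq]; simp

theorem substCode_impCode (e : List ℕ × ℕ × ℕ) (a b : ℕ) :
    substCode (e, impCode a b) = impCode (substCode (e, a)) (substCode (e, b)) := by
  have h1 : impCode a b / 4 = Nat.pair a b := by simp only [impCode]; omega
  have h2 : impCode a b % 4 = 3 := by simp only [impCode]; omega
  rw [substCode, measureRec_eq]
  simp [h1, h2, impCode_ne_zero]

theorem substCode_allCode (e : List ℕ × ℕ × ℕ) (a : ℕ) :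
    substCode (e, allCode a) = allCode (substCode (e, a)) := by
  have h1 : allCode a / 4 - 1 = a := by simp only [allCode]; omega
  have h2 : allCode a % 4 = 0 := by simp only [allCode]; omega
  have h3 : allCode a ≠ 0 := by simp only [allCode]; omega
  rw [substCode, measureRec_eq]
  simp [h1, h2, h3]

theorem substCode_eqCode (e : List ℕ × ℕ × ℕ) (a b : ℕ) :
    substCode (e, eqCode a b) = eqCode (substTermCode (e, a)) (substTermCode (e, b)) := by
  have h1 : eqCode a b / 4 = Nat.pair a b := by simp only [eqCode]; omega
  have h2 : eqCode a b % 4 = 1 := by simp only [eqCode]; omega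
  have h3 : eqCode a b ≠ 0 := by simp only [eqCode]; omega
  rw [substCode, measureRec_eq]
  simp [h1, h2, h3]

/-! ### Substitution in formulas -/

section

variable {L : FirstOrder.Language.{u, v}} (ι : ∀ k, FirstOrder.Language.ring.Functions k → L.Functions k)
  (c : ∀ m, L.Term (Empty ⊕ Fin (m + 1)))

/-- Renaming of the variables of a term along `g`, with the constant symbol replaced by a term. -/
def substTerm {n m : ℕ} (g : Fin n → Fin (m + 1)) :
    ringWithConst.Term (Empty ⊕ Fin n) → L.Term (Empty ⊕ Fin (m + 1))
  | .var x => .var (.inr (g (Sum.elim Empty.elim id x)))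
  | .func (.inl f) ts => .func (ι _ f) fun i => substTerm g (ts i)
  | .func (.inr _) _ => c m

/-- Extension of a renaming to one more bound variable. -/
def extendRenaming {n m : ℕ} (g : Fin n → Fin (m + 1)) : Fin (n + 1) → Fin (m + 1 + 1) :=
  Fin.snoc (α := fun _ => Fin (m + 1 + 1)) (fun i => (g i).castSucc) (Fin.last _)

/-- The substitution `substTerm` on formulas. -/
def substFormula : ∀ {n m : ℕ}, (Fin n → Fin (m + 1)) → ringWithConst.BoundedFormula Empty n →
    L.BoundedFormula Empty (m + 1)
  | _, _, _, .falsum => .falsum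
  | _, _, g, .equal s t => .equal (substTerm ι c g s) (substTerm ι c g t)
  | _, _, _, .rel R _ => isEmptyElim R
  | _, _, g, .imp φ ψ => (substFormula g φ).imp (substFormula g ψ)
  | _, _, g, .all φ => (substFormula (extendRenaming g) φ).all

variable {ι c}

theorem level_substFormula {l n m : ℕ} {φ : ringWithConst.BoundedFormula Empty n} (h : Level l φ)
    (g : Fin n → Fin (m + 1)) : Level l (substFormula ι c g φ) := by
  induction h generalizing m with
  | qf h =>
    refine .qf ?_
    induction h with
    | falsum => exact .falsum
    | of_isAtomic h =>
      cases h with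
      | equal => exact .of_isAtomic (.equal _ _)
      | rel R => exact isEmptyElim R
    | imp _ _ h1 h2 => exact h1.imp h2
  | ex h1 _ ih => exact .ex h1 (ih _)
  | allMany _ ih => exact .allMany (ih _)
  | allOnce _ ih => exact .allOnce (ih _)
  | inf _ _ h1 h2 => exact .inf (h1 _) (h2 _)
  | sup _ _ h1 h2 => exact .sup (h1 _) (h2 _)

/-- The data `e` for `substCode` describe the renaming `g`. -/
structure Describes (e : List ℕ × ℕ × ℕ) {n m : ℕ} (g : Fin n → Fin (m + 1)) : Prop where
  length_le : e.1.length ≤ n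
  add_shift : n + e.2.1 = m + 1
  getD_eq : ∀ i : Fin n, e.1.getD i (i + e.2.1) = g i

/-- Variables beyond the list are shifted by a fixed amount, and so are newly bound ones. Hence the
same data work under every quantifier, and `substCode` need not keep track of binders. -/
theorem Describes.extend {e : List ℕ × ℕ × ℕ} {n m : ℕ} {g : Fin n → Fin (m + 1)}
    (h : Describes e g) : Describes e (extendRenaming g) where
  length_le := h.length_le.trans (Nat.le_succ _)
  add_shift := by have := h.add_shift; omega
  getD_eq i := by
    refine Fin.lastCases ?_ (fun i => ?_) i
    · rw [List.getD_eq_default _ _ (by simpa using h.length_le)]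
      simpa [extendRenaming] using h.add_shift
    · simpa [extendRenaming] using h.getD_eq i

variable {P : Presentation L}

theorem termCode_substTerm {e : List ℕ × ℕ × ℕ} (hι : ∀ k f, P.funcNum ⟨k, ι k f⟩ = ringPresentation.funcNum ⟨k, f⟩)
    (hc : ∀ m, P.termCode (c m) = e.2.2) {n m : ℕ} {g : Fin n → Fin (m + 1)} (h : Describes e g)
    (t : ringWithConst.Term (Empty ⊕ Fin n)) :
    P.termCode (substTerm ι c g t) = substTermCode (e, ringWithConstPresentation.termCode t) := by
  induction t with
  | var x =>
    rcases x with x | x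
    · exact x.elim
    · rw [termCode_var, substTermCode_varCode, h.getD_eq]
      rfl
  | func f ts ih =>
    rw [termCode_func, substTermCode_funcCode]
    rcases f with f | f
    · refine Eq.trans ?_ (if_neg (ringFuncNum_lt f).ne).symm
      refine (termCode_func P _ _).trans ?_
      rw [hι, List.map_ofFn]
      simp only [ih]
      rfl
    · exact (hc m).trans (if_pos rfl).symm

theorem code_substFormula {e : List ℕ × ℕ × ℕ} (hι : ∀ k f, P.funcNum ⟨k, ι k f⟩ = ringPresentation.funcNum ⟨k, f⟩)
    (hc : ∀ m, P.termCode (c m) = e.2.2) {n : ℕ} (φ : ringWithConst.BoundedFormula Empty n) {m : ℕ}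
    {g : Fin n → Fin (m + 1)} (h : Describes e g) :
    P.code (substFormula ι c g φ) = substCode (e, ringWithConstPresentation.code φ) := by
  induction φ generalizing m with
  | falsum => exact (substCode_zero e).symm
  | equal s t =>
    rw [substFormula, code_equal, code_equal, substCode_eqCode, termCode_substTerm hι hc h,
      termCode_substTerm hι hc h]
  | rel R => exact isEmptyElim R
  | imp φ ψ h1 h2 =>
    rw [substFormula, code_imp, code_imp, substCode_impCode, h1 h, h2 h]
  | all φ ih =>
    rw [substFormula, code_all, code_all, substCode_allCode, ih h.extend]

end

theorem snoc_comp_extendRenaming {K : Type*} {n m : ℕ} (g : Fin n → Fin (m + 1))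
    (v : Fin (m + 1) → K) (x : K) :
    (Fin.snoc v x : Fin (m + 1 + 1) → K) ∘ extendRenaming g = Fin.snoc (v ∘ g) x := by
  funext i
  refine Fin.lastCases ?_ (fun i => ?_) i <;> simp [extendRenaming]

theorem snoc_apply_zero {K : Type*} {m : ℕ} (v : Fin (m + 1) → K) (x : K) :
    (Fin.snoc v x : Fin (m + 1 + 1) → K) 0 = v 0 := by
  rw [← Fin.castSucc_zero, Fin.snoc_castSucc]

/-- A function symbol of the language of rings in the language with a constant. -/
def ringSymbol (k : ℕ) (f : FirstOrder.Language.ring.Functions k) : ringWithConst.Functions k :=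
  Sum.inl f

/-- Renaming of the free variables. -/
def rename {n m : ℕ} (g : Fin n → Fin (m + 1)) (φ : ringWithConst.BoundedFormula Empty n) :
    ringWithConst.BoundedFormula Empty (m + 1) :=
  substFormula ringSymbol (fun m => constTerm (m + 1)) g φ

/-- The variable `x_0` is put in place of the constant symbol, and all others are shifted. -/
def constToVar {n : ℕ} (φ : ringWithConst.BoundedFormula Empty n) :
    FirstOrder.Language.ring.BoundedFormula Empty (n + 1) :=
  substFormula (fun _ => id) (fun _ => .var (.inr 0)) Fin.succ φ

/-- Gödel number of the constant symbol as a term. -/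
def constCode : ℕ := funcCode 5 []

theorem code_rename {σ : List ℕ} {s n m : ℕ} {g : Fin n → Fin (m + 1)}
    (h : Describes (σ, s, constCode) g) (φ : ringWithConst.BoundedFormula Empty n) :
    ringWithConstPresentation.code (rename g φ) =
      substCode ((σ, s, constCode), ringWithConstPresentation.code φ) :=
  code_substFormula (ι := ringSymbol) (c := fun m => constTerm (m + 1)) (P := ringWithConstPresentation) (fun _ _ => rfl)
    (fun _ => rfl) φ h

/-- The last `0` in the data is the number of the variable `x_0` as a term; the shift by `1` makes
room for it. -/
theorem code_constToVar {n : ℕ} (φ : ringWithConst.BoundedFormula Empty n) :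
    ringPresentation.code (constToVar φ) =
      substCode (([], 1, 0), ringWithConstPresentation.code φ) :=
  code_substFormula (fun _ _ => rfl) (fun _ => rfl) φ ⟨Nat.zero_le _, rfl, fun _ => rfl⟩

/-! ### Truth under substitution -/

section

variable {K : Type*} [Field K] {a : K}

theorem pointedValue_rename {n m : ℕ} {g : Fin n → Fin (m + 1)}
    {t : ringWithConst.Term (Empty ⊕ Fin n)} {v : Fin (m + 1) → K} :
    pointedValue K a (substTerm ringSymbol (fun m => constTerm (m + 1)) g t) v =
      pointedValue K a t (v ∘ g) := by
  induction t with
  | var x => rcases x with x | x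
             · exact x.elim
             · rfl
  | func f ts ih =>
    rcases f with f | f
    · cases f
      · exact congrArg₂ (· + ·) (ih 0) (ih 1)
      · exact congrArg₂ (· * ·) (ih 0) (ih 1)
      · exact congrArg (- ·) (ih 0)
      · rfl
      · rfl
    · rename_i k
      match k, f with
      | 0, f => rfl

theorem pointedHolds_rename {n m : ℕ} {g : Fin n → Fin (m + 1)}
    {φ : ringWithConst.BoundedFormula Empty n} {v : Fin (m + 1) → K} :
    PointedHolds K a (rename g φ) v ↔ PointedHolds K a φ (v ∘ g) := by
  unfold rename
  induction φ generalizing m with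
  | falsum => rfl
  | equal s t =>
    rw [pointedHolds_equal, ← pointedValue_rename, ← pointedValue_rename]
    rfl
  | rel R => exact isEmptyElim R
  | imp φ ψ h1 h2 => rw [pointedHolds_imp, ← h1, ← h2]; rfl
  | all φ ih =>
    simp only [substFormula, pointedHolds_all, ih, snoc_comp_extendRenaming]

theorem level_rename {l n m : ℕ} {g : Fin n → Fin (m + 1)}
    {φ : ringWithConst.BoundedFormula Empty n} (h : Level l φ) : Level l (rename g φ) :=
  level_substFormula h g

theorem level_constToVar {l n : ℕ} {φ : ringWithConst.BoundedFormula Empty n} (h : Level l φ) :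
    Level l (constToVar φ) :=
  level_substFormula h _

/-- Value of a term of the language of rings. -/
def ringValue (K : Type*) [Field K] {n : ℕ}
    (t : FirstOrder.Language.ring.Term (Empty ⊕ Fin n)) (v : Fin n → K) : K :=
  letI := Ring.compatibleRingOfRing K
  t.realize (Sum.elim default v)

theorem ringValue_constToVar {n m : ℕ} {g : Fin n → Fin (m + 1)}
    {t : ringWithConst.Term (Empty ⊕ Fin n)} {v : Fin (m + 1) → K} :
    ringValue K (substTerm (fun _ => id) (fun _ => .var (.inr 0)) g t) v =
      pointedValue K (v 0) t (v ∘ g) := by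
  induction t with
  | var x => rcases x with x | x
             · exact x.elim
             · rfl
  | func f ts ih =>
    rcases f with f | f
    · cases f
      · exact congrArg₂ (· + ·) (ih 0) (ih 1)
      · exact congrArg₂ (· * ·) (ih 0) (ih 1)
      · exact congrArg (- ·) (ih 0)
      · rfl
      · rfl
    · rename_i k
      match k, f with
      | 0, f => rfl

theorem ringHolds_substFormula {n m : ℕ} {g : Fin n → Fin (m + 1)}
    {φ : ringWithConst.BoundedFormula Empty n} {v : Fin (m + 1) → K} :
    RingHolds K (substFormula (fun _ => id) (fun _ => .var (.inr 0)) g φ) v ↔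
      PointedHolds K (v 0) φ (v ∘ g) := by
  induction φ generalizing m with
  | falsum => rfl
  | equal s t =>
    rw [pointedHolds_equal, ← ringValue_constToVar, ← ringValue_constToVar]
    rfl
  | rel R => exact isEmptyElim R
  | imp φ ψ h1 h2 => rw [pointedHolds_imp, ← h1, ← h2]; rfl
  | all φ ih =>
    simp only [substFormula, ringHolds_all, pointedHolds_all, ih, snoc_comp_extendRenaming,
      snoc_apply_zero]

theorem ringHolds_constToVar {n : ℕ} {φ : ringWithConst.BoundedFormula Empty n}
    {v : Fin (n + 1) → K} :
    RingHolds K (constToVar φ) v ↔ PointedHolds K (v 0) φ (Fin.tail v) :=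
  ringHolds_substFormula

end

/-! ### Merging universal quantifiers by a definable pairing -/

/-- The renaming that fixes the variables below `j` and raises all others by `s + 1`. -/
def shiftFrom (j s : ℕ) {n : ℕ} (i : Fin n) : Fin (n + s + 1) :=
  ⟨if (i : ℕ) < j then i else i + (s + 1), by split <;> omega⟩

theorem describes_shiftFrom {j s n : ℕ} (h : j ≤ n) :
    Describes (List.range j, s + 1, constCode) (shiftFrom j s : Fin n → Fin (n + s + 1)) where
  length_le := by simpa using h
  add_shift := by simp only; omega
  getD_eq i := by
    simp only [shiftFrom]
    split_ifs with hi
    · rw [List.getD_eq_getElem _ _ (by simpa using hi)]; simp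
    · rw [List.getD_eq_default _ _ (by simpa using hi)]

theorem describes_natAdd {n : ℕ} :
    Describes (([] : List ℕ), n, constCode) (Fin.natAdd n : Fin 3 → Fin (n + 2 + 1)) where
  length_le := Nat.zero_le _
  add_shift := by simp only; omega
  getD_eq i := by simp [add_comm]

section

variable {K : Type*} {n : ℕ} (x : Fin n → K) (z u w : K)

theorem snoc_comp_shiftFrom_zero :
    (Fin.snoc (Fin.snoc x z : Fin (n + 1) → K) u : Fin (n + 1 + 1) → K) ∘
      (shiftFrom n 0 : Fin (n + 1) → Fin (n + 1 + 1)) = Fin.snoc x u := by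
  funext i
  refine Fin.lastCases ?_ (fun i => ?_) i
  · simp [Fin.snoc, shiftFrom]
  · simp [Fin.snoc, shiftFrom, i.2.trans (Nat.lt_succ_self n)]

theorem snoc_comp_shiftFrom_one :
    (Fin.snoc (Fin.snoc (Fin.snoc x z : Fin (n + 1) → K) u : Fin (n + 1 + 1) → K) w :
      Fin (n + 1 + 1 + 1) → K) ∘
      (shiftFrom n 1 : Fin (n + 1) → Fin (n + 1 + 1 + 1)) = Fin.snoc x w := by
  funext i
  refine Fin.lastCases ?_ (fun i => ?_) i
  · simp [Fin.snoc, shiftFrom]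
  · simp [Fin.snoc, shiftFrom, i.2.trans (Nat.lt_succ_self n),
      i.2.trans ((Nat.lt_succ_self n).trans (Nat.lt_succ_self _))]

theorem snoc_snoc_comp_shiftFrom_zero :
    (Fin.snoc (Fin.snoc (Fin.snoc x z : Fin (n + 1) → K) u : Fin (n + 1 + 1) → K) w :
      Fin (n + 1 + 1 + 1) → K) ∘
      (shiftFrom n 0 : Fin (n + 1 + 1) → Fin (n + 1 + 1 + 1)) =
        Fin.snoc (Fin.snoc x u : Fin (n + 1) → K) w := by
  funext i
  refine Fin.lastCases ?_ (fun i => Fin.lastCases ?_ (fun i => ?_) i) i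
  · simp [Fin.snoc, shiftFrom]
  · simp [Fin.snoc, shiftFrom]
  · simp [Fin.snoc, shiftFrom, i.2.trans (Nat.lt_succ_self n),
      i.2.trans ((Nat.lt_succ_self n).trans (Nat.lt_succ_self _))]

theorem snoc_comp_shiftFrom_self (y : Fin n → K) :
    (Fin.snoc y z : Fin (n + 1) → K) ∘ (shiftFrom n 0 : Fin n → Fin (n + 1)) = y := by
  funext i
  simp [Fin.snoc, shiftFrom]

theorem snoc_comp_natAdd :
    (Fin.snoc (Fin.snoc (Fin.snoc x z : Fin (n + 1) → K) u : Fin (n + 1 + 1) → K) w :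
      Fin (n + 1 + 1 + 1) → K) ∘ (Fin.natAdd n : Fin 3 → Fin (n + 2 + 1)) = ![z, u, w] := by
  funext i
  fin_cases i <;> simp [Fin.snoc]

end

/-- `∃ u v (D(z, u, v) ∧ χ)`, where `z` is the variable `x_n`. -/
def unpairFormula (D : ringWithConst.BoundedFormula Empty 3) {n : ℕ}
    (χ : ringWithConst.BoundedFormula Empty (n + 1 + 1 + 1)) :
    ringWithConst.BoundedFormula Empty (n + 1) :=
  (rename (Fin.natAdd n : Fin 3 → Fin (n + 2 + 1)) D ⊓ χ).ex.ex

/-- The formula `D(z, u, v)` defines a surjective map from the field to the pairs of its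
elements. -/
structure IsPairing (D : ringWithConst.BoundedFormula Empty 3) (K : Type*) [Field K] (a : K) :
    Prop where
  total : ∀ z, ∃ u w, PointedHolds K a D ![z, u, w]
  unique : ∀ {z u w u' w'}, PointedHolds K a D ![z, u, w] → PointedHolds K a D ![z, u', w'] →
    u = u' ∧ w = w'
  surjective : ∀ u w, ∃ z, PointedHolds K a D ![z, u, w]

/-- Surjectivity makes the values on all `z` exhaust the pairs; uniqueness identifies the witnesses
`u, w` with the prescribed pair. The existential form on the left keeps the body in the existential
fragment. -/
theorem IsPairing.forall_iff {D : ringWithConst.BoundedFormula Empty 3} {K : Type*} [Field K]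
    {a : K} (h : IsPairing D K a) {Q : K → K → Prop} :
    (∀ z, ∃ u w, PointedHolds K a D ![z, u, w] ∧ Q u w) ↔ ∀ u w, Q u w := by
  constructor
  · intro hQ u w
    obtain ⟨z, hz⟩ := h.surjective u w
    obtain ⟨u', w', hz', hq⟩ := hQ z
    obtain ⟨rfl, rfl⟩ := h.unique hz hz'
    exact hq
  · intro hQ z
    obtain ⟨u, w, hz⟩ := h.total z
    exact ⟨u, w, hz, hQ u w⟩

/-- `MergeRel D φ θ`: the existential formula `θ` has one variable more than `φ`, and `φ` is
equivalent to `∀ z θ(z)` if `D` defines a pairing. -/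
inductive MergeRel (D : ringWithConst.BoundedFormula Empty 3) : ∀ {n : ℕ},
    ringWithConst.BoundedFormula Empty n → ringWithConst.BoundedFormula Empty (n + 1) → Prop
  | ex {n : ℕ} {φ : ringWithConst.BoundedFormula Empty n} :
      Level 1 φ → MergeRel D φ (rename (shiftFrom n 0) φ)
  | all {n : ℕ} {φ : ringWithConst.BoundedFormula Empty (n + 1)}
      {θ : ringWithConst.BoundedFormula Empty (n + 1 + 1)} : MergeRel D φ θ →
      MergeRel D φ.all (unpairFormula D (rename (shiftFrom n 0) θ))
  | inf {n : ℕ} {φ ψ : ringWithConst.BoundedFormula Empty n}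
      {θ η : ringWithConst.BoundedFormula Empty (n + 1)} : MergeRel D φ θ → MergeRel D ψ η →
      MergeRel D (φ ⊓ ψ) (unpairFormula D
        (rename (shiftFrom (n + 1 + 1) 0) (rename (shiftFrom n 0) θ) ⊓ rename (shiftFrom n 1) η))
  | sup {n : ℕ} {φ ψ : ringWithConst.BoundedFormula Empty n}
      {θ η : ringWithConst.BoundedFormula Empty (n + 1)} : MergeRel D φ θ → MergeRel D ψ η →
      MergeRel D (φ ⊔ ψ) (unpairFormula D
        (rename (shiftFrom (n + 1 + 1) 0) (rename (shiftFrom n 0) θ) ⊔ rename (shiftFrom n 1) η))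

section

variable {D : ringWithConst.BoundedFormula Empty 3} {n : ℕ}
  {φ : ringWithConst.BoundedFormula Empty n} {θ : ringWithConst.BoundedFormula Empty (n + 1)}

theorem MergeRel.level (hD : Level 1 D) (h : MergeRel D φ θ) : Level 1 θ := by
  have key : ∀ {n : ℕ} {χ : ringWithConst.BoundedFormula Empty (n + 1 + 1 + 1)}, Level 1 χ →
      Level 1 (unpairFormula D χ) := fun hχ =>
    .ex le_rfl (.ex le_rfl (.inf (level_rename hD) hχ))
  induction h with
  | ex h => exact level_rename h
  | all _ ih => exact key (level_rename ih)
  | inf _ _ h1 h2 => exact key (.inf (level_rename (level_rename h1)) (level_rename h2))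
  | sup _ _ h1 h2 => exact key (.sup (level_rename (level_rename h1)) (level_rename h2))

theorem pointedHolds_unpairFormula {K : Type*} [Field K] {a : K}
    {χ : ringWithConst.BoundedFormula Empty (n + 1 + 1 + 1)} {x : Fin n → K} {z : K} :
    PointedHolds K a (unpairFormula D χ) (Fin.snoc x z) ↔
      ∃ u w, PointedHolds K a D ![z, u, w] ∧ PointedHolds K a χ (Fin.snoc (Fin.snoc
        (Fin.snoc x z : Fin (n + 1) → K) u : Fin (n + 1 + 1) → K) w) := by
  rw [unpairFormula, pointedHolds_ex]
  refine exists_congr fun u => ?_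
  rw [pointedHolds_ex]
  refine exists_congr fun w => ?_
  rw [pointedHolds_inf]
  refine and_congr_left fun _ => ?_
  exact pointedHolds_rename.trans (by rw [← snoc_comp_natAdd x z u w])

/-- By induction, the parts of `φ` are equivalent to `∀ u θ` and `∀ w η`. Both `∧` and `∨` commute
with universal quantifiers over distinct variables, so two such quantifiers remain in each case, and
the pairing merges them. -/
theorem MergeRel.pointedHolds_iff {K : Type*} [Field K] {a : K} (hD : IsPairing D K a)
    (h : MergeRel D φ θ) (x : Fin n → K) :
    PointedHolds K a φ x ↔ ∀ z, PointedHolds K a θ (Fin.snoc x z) := by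
  have key : ∀ {n : ℕ} {χ : ringWithConst.BoundedFormula Empty (n + 1 + 1 + 1)} {x : Fin n → K}
      {Q : K → K → Prop}, (∀ z u w, PointedHolds K a χ (Fin.snoc (Fin.snoc
        (Fin.snoc x z : Fin (n + 1) → K) u : Fin (n + 1 + 1) → K) w) ↔ Q u w) →
      ((∀ z, PointedHolds K a (unpairFormula D χ) (Fin.snoc x z)) ↔ ∀ u w, Q u w) := by
    intro n χ x Q h
    rw [← hD.forall_iff]
    simp only [pointedHolds_unpairFormula, h]
  -- In the block `x, z, u, w` the first part reads `u` in place of its own last variable, the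
  -- second part reads `w`; neither mentions `z`.
  have left : ∀ {n : ℕ} {θ : ringWithConst.BoundedFormula Empty (n + 1)} (x : Fin n → K) (z u w : K),
      PointedHolds K a (rename (shiftFrom (n + 1 + 1) 0) (rename (shiftFrom n 0) θ)) (Fin.snoc
        (Fin.snoc (Fin.snoc x z : Fin (n + 1) → K) u : Fin (n + 1 + 1) → K) w) ↔
      PointedHolds K a θ (Fin.snoc x u) := by
    intro n θ x z u w
    refine pointedHolds_rename.trans (pointedHolds_rename.trans ?_)
    rw [snoc_comp_shiftFrom_self, snoc_comp_shiftFrom_zero]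
  have right : ∀ {n : ℕ} {θ : ringWithConst.BoundedFormula Empty (n + 1)} (x : Fin n → K)
      (z u w : K), PointedHolds K a (rename (shiftFrom n 1) θ) (Fin.snoc
        (Fin.snoc (Fin.snoc x z : Fin (n + 1) → K) u : Fin (n + 1 + 1) → K) w) ↔
      PointedHolds K a θ (Fin.snoc x w) := by
    intro n θ x z u w
    refine pointedHolds_rename.trans ?_
    rw [snoc_comp_shiftFrom_one]
  induction h with
  | @ex n φ h =>
    refine Iff.trans ?_ (forall_congr' fun z => (pointedHolds_rename (K := K) (a := a)
      (g := shiftFrom n 0) (φ := φ) (v := (Fin.snoc x z : Fin (n + 1) → K))).symm)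
    simp only [snoc_comp_shiftFrom_self, forall_const]
  | @all n φ θ _ ih =>
    rw [key (Q := fun u w => PointedHolds K a θ (Fin.snoc (Fin.snoc x u : Fin (n + 1) → K) w))]
    · exact forall_congr' fun u => ih _
    · intro z u w
      refine pointedHolds_rename.trans ?_
      rw [snoc_snoc_comp_shiftFrom_zero]
  | @inf n φ ψ θ η _ _ h1 h2 =>
    have h1 : _ ↔ _ := h1 x
    have h2 : _ ↔ _ := h2 x
    rw [key (Q := fun u w => PointedHolds K a θ (Fin.snoc x u) ∧
      PointedHolds K a η (Fin.snoc x w)), pointedHolds_inf, h1, h2]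
    · simp only [forall_and, forall_const]
    · intro z u w
      rw [pointedHolds_inf, left, right]
  | @sup n φ ψ θ η _ _ h1 h2 =>
    have h1 : _ ↔ _ := h1 x
    have h2 : _ ↔ _ := h2 x
    rw [key (Q := fun u w => PointedHolds K a θ (Fin.snoc x u) ∨
      PointedHolds K a η (Fin.snoc x w)), pointedHolds_sup, h1, h2]
    · simp only [forall_or_left, forall_or_right]
    · intro z u w
      rw [pointedHolds_sup, left, right]

end

/-! ### The merging on Gödel numbers -/

/-- Gödel number of `unpairFormula`, where `d` is the number of `D`. -/
def unpairCode (d n x : ℕ) : ℕ := exCode (exCode (infCode (substCode (([], n, constCode), d)) x))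

/-- Recursive calls in the merging of universal quantifiers. -/
def mergeCalls (b : ℕ × ℕ) : List (ℕ × ℕ) :=
  if (shape b.2).1 = 5 then [(b.1 + 1, (shape b.2).2.1)]
  else if (shape b.2).1 = 2 then [(b.1, (shape b.2).2.1), (b.1, (shape b.2).2.2)]
  else if (shape b.2).1 = 3 then [(b.1, (shape b.2).2.1), (b.1, (shape b.2).2.2)]
  else []

/-- One step of the merging of universal quantifiers, where `r` holds the results of the recursive
calls. -/
def mergeStep (d : ℕ) (b : ℕ × ℕ) (r : List ℕ) : ℕ :=
  if formValid pointedArities (1, b.1, b.2) = true then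
    substCode ((List.range b.1, 1, constCode), b.2)
  else if (shape b.2).1 = 5 then
    unpairCode d b.1 (substCode ((List.range b.1, 1, constCode), r.getD 0 0))
  else if (shape b.2).1 = 2 then
    unpairCode d b.1 (infCode
      (substCode ((List.range (b.1 + 1 + 1), 1, constCode),
        substCode ((List.range b.1, 1, constCode), r.getD 0 0)))
      (substCode ((List.range b.1, 2, constCode), r.getD 1 0)))
  else unpairCode d b.1 (supCode
      (substCode ((List.range (b.1 + 1 + 1), 1, constCode),
        substCode ((List.range b.1, 1, constCode), r.getD 0 0)))
      (substCode ((List.range b.1, 2, constCode), r.getD 1 0)))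

theorem mergeCalls_lt (b b' : ℕ × ℕ) (h : b' ∈ mergeCalls b) : b'.2 < b.2 := by
  have key := @shape_lt b.2
  unfold mergeCalls at h
  split_ifs at h with h1 h2 h3 <;>
    simp only [List.mem_cons, List.not_mem_nil, or_false] at h
  · subst h; exact (key (by omega) (by omega)).1
  · rcases h with rfl | rfl
    · exact (key (by omega) (by omega)).1
    · exact (key (by omega) (by omega)).2
  · rcases h with rfl | rfl
    · exact (key (by omega) (by omega)).1
    · exact (key (by omega) (by omega)).2

/-- Gödel number of the formula that `MergeRel` assigns to the formula in `b.1` variables with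
number `b.2`. -/
def mergeCode (d : ℕ) : ℕ × ℕ → ℕ :=
  measureRec Prod.snd mergeCalls (mergeStep d) mergeCalls_lt

theorem mergeCode_eq (d : ℕ) (b : ℕ × ℕ) :
    mergeCode d b = mergeStep d b ((mergeCalls b).map (mergeCode d)) :=
  measureRec_eq ..

theorem primrec_mergeCode (d : ℕ) : Primrec (mergeCode d) := by
  refine primrec_measureRec ?_ ?_ ?_
  · fun_prop
  · unfold mergeCalls; fun_prop
  · unfold mergeStep unpairCode; fun_prop

theorem code_unpairFormula {D : ringWithConst.BoundedFormula Empty 3} {n : ℕ}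
    (χ : ringWithConst.BoundedFormula Empty (n + 1 + 1 + 1)) :
    ringWithConstPresentation.code (unpairFormula D χ) =
      unpairCode (ringWithConstPresentation.code D) n (ringWithConstPresentation.code χ) := by
  rw [unpairFormula, code_ex, code_ex, code_inf, code_rename describes_natAdd]
  rfl

/-- `MergeRel` is a relation because a formula may be decomposed in several ways. Here the choice
made by `mergeCode` is followed: existential formulas are left whole, and only the others are split.
-/
theorem exists_mergeRel (D : ringWithConst.BoundedFormula Empty 3) {n : ℕ}
    {φ : ringWithConst.BoundedFormula Empty n} (h : Level 2 φ) : ∃ θ, MergeRel D φ θ ∧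
      ringWithConstPresentation.code θ = mergeCode (ringWithConstPresentation.code D)
        (n, ringWithConstPresentation.code φ) := by
  have base : ∀ {n : ℕ} (φ : ringWithConst.BoundedFormula Empty n),
      formValid pointedArities (1, n, ringWithConstPresentation.code φ) = true →
      ∃ θ, MergeRel D φ θ ∧ ringWithConstPresentation.code θ =
        mergeCode (ringWithConstPresentation.code D) (n, ringWithConstPresentation.code φ) := by
    intro n φ hv
    obtain ⟨φ', h1, h2⟩ := formValid_pointed_iff.1 hv
    obtain rfl := code_injective _ h2
    refine ⟨_, .ex h1, ?_⟩
    rw [code_rename (describes_shiftFrom le_rfl), mergeCode_eq, mergeStep, if_pos hv]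
  generalize hl : 2 = l at h
  induction h with
  | qf h => exact base _ (formValid_pointed_iff.2 ⟨_, .qf h, rfl⟩)
  | ex _ h => exact base _ (formValid_pointed_iff.2 ⟨_, .ex le_rfl h, rfl⟩)
  | @allMany n φ _ ih =>
    by_cases hv : formValid pointedArities (1, n, ringWithConstPresentation.code φ.all) = true
    · exact base _ hv
    obtain ⟨θ, h1, h2⟩ := ih hl
    refine ⟨_, .all h1, ?_⟩
    rw [code_unpairFormula, code_rename (describes_shiftFrom (Nat.le_add_right _ _)), h2,
      mergeCode_eq _ (n, _), mergeStep, if_neg hv, code_all]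
    simp [mergeCalls, shape_allCode]
  | allOnce => omega
  | @inf _ n φ ψ _ _ ih1 ih2 =>
    -- The conjunction may be existential as a whole, and then `mergeCode` does not split it.
    by_cases hv : formValid pointedArities (1, n, ringWithConstPresentation.code (φ ⊓ ψ)) = true
    · exact base _ hv
    obtain ⟨θ, h1, h2⟩ := ih1 hl
    obtain ⟨η, h3, h4⟩ := ih2 hl
    refine ⟨_, .inf h1 h3, ?_⟩
    rw [code_unpairFormula, code_inf, code_rename (describes_shiftFrom le_rfl),
      code_rename (describes_shiftFrom (Nat.le_add_right _ _)),
      code_rename (describes_shiftFrom (Nat.le_add_right _ _)), h2, h4,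
      mergeCode_eq _ (n, ringWithConstPresentation.code (φ ⊓ ψ)),
      mergeStep, if_neg hv, code_inf]
    simp [mergeCalls, shape_infCode]
  | @sup _ n φ ψ _ _ ih1 ih2 =>
    by_cases hv : formValid pointedArities (1, n, ringWithConstPresentation.code (φ ⊔ ψ)) = true
    · exact base _ hv
    obtain ⟨θ, h1, h2⟩ := ih1 hl
    obtain ⟨η, h3, h4⟩ := ih2 hl
    refine ⟨_, .sup h1 h3, ?_⟩
    rw [code_unpairFormula, code_sup, code_rename (describes_shiftFrom le_rfl),
      code_rename (describes_shiftFrom (Nat.le_add_right _ _)),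
      code_rename (describes_shiftFrom (Nat.le_add_right _ _)), h2, h4,
      mergeCode_eq _ (n, ringWithConstPresentation.code (φ ⊔ ψ)),
      mergeStep, if_neg hv, code_sup]
    simp [mergeCalls, shape_supCode]

/-! ### Fields of degree `p` over their subfield of `p`-th powers -/

section

variable {K : Type*} [Field K] {p : ℕ} [Fact p.Prime] [CharP K p]

/-- The minimal polynomial of `s` over `K ^ p` is `X ^ p - s ^ p`, of degree `p`. -/
theorem linearIndependent_pow_of_notMem_frobenius {s : K}
    (hs : s ∉ (frobenius K p).fieldRange) :
    LinearIndependent (frobenius K p).fieldRange fun i : Fin p => s ^ (i : ℕ) := by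
  have hp := Fact.out (p := p.Prime)
  let a : (frobenius K p).fieldRange := ⟨s ^ p, s, rfl⟩
  have hirr : Irreducible (Polynomial.X ^ p - Polynomial.C a) := by
    -- A root `b` in `K ^ p` would satisfy `b ^ p = s ^ p`, hence `b = s`.
    refine X_pow_sub_C_irreducible_of_prime hp fun b hb => hs ?_
    have : (b : K) ^ p = s ^ p := congrArg Subtype.val hb
    rw [← frobenius_inj K p this]
    exact b.2
  have hmin : minpoly (frobenius K p).fieldRange s = Polynomial.X ^ p - Polynomial.C a := by
    refine (minpoly.eq_of_irreducible_of_monic hirr ?_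
      (Polynomial.monic_X_pow_sub_C _ hp.ne_zero)).symm
    rw [map_sub, map_pow, Polynomial.aeval_X, Polynomial.aeval_C]
    exact sub_eq_zero.2 rfl
  have h := linearIndependent_pow (K := (frobenius K p).fieldRange) s
  rw [hmin, Polynomial.natDegree_X_pow_sub_C] at h
  exact h

/-- The powers of `t` show that `K` has dimension `p` over `K ^ p`, so the `p` independent powers of
`s` span as well. -/
theorem exists_eq_sum_pow_mul_pow {s t : K} (hs : s ∉ (frobenius K p).fieldRange)
    (ht : t ∉ (frobenius K p).fieldRange)
    (h : ∀ z : K, ∃ w : Fin p → K, z = ∑ i : Fin p, t ^ (i : ℕ) * w i ^ p) (z : K) :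
    ∃ w : Fin p → K, z = ∑ i : Fin p, s ^ (i : ℕ) * w i ^ p := by
  have hspan : ⊤ ≤ Submodule.span (frobenius K p).fieldRange
      (Set.range fun i : Fin p => t ^ (i : ℕ)) := by
    intro z _
    obtain ⟨w, rfl⟩ := h z
    refine Submodule.mem_span_range_iff_exists_fun _ |>.2 ⟨fun i => ⟨w i ^ p, w i, rfl⟩, ?_⟩
    exact Finset.sum_congr rfl fun i _ => mul_comm _ _
  let b := Module.Basis.mk (linearIndependent_pow_of_notMem_frobenius ht) hspan
  have hfin : Fintype.card (Fin p) = Module.finrank (frobenius K p).fieldRange K :=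
    (Module.finrank_eq_card_basis b).symm
  have : Nonempty (Fin p) := ⟨⟨0, (Fact.out (p := p.Prime)).pos⟩⟩
  have hz : z ∈ Submodule.span (frobenius K p).fieldRange
      (Set.range fun i : Fin p => s ^ (i : ℕ)) := by
    rw [(linearIndependent_pow_of_notMem_frobenius hs).span_eq_top_of_card_eq_finrank hfin]
    trivial
  obtain ⟨c, rfl⟩ := (Submodule.mem_span_range_iff_exists_fun _).1 hz
  choose w hw using fun i => (c i).2
  refine ⟨w, Finset.sum_congr rfl fun i _ => ?_⟩
  rw [show w i ^ p = c i from hw i, mul_comm]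
  rfl

/-- In characteristic `p`, differences of `p`-th powers are `p`-th powers of differences, so linear
independence over `K ^ p` applies. -/
theorem eq_of_sum_pow_mul_pow_eq {s : K} (hs : s ∉ (frobenius K p).fieldRange) {w w' : Fin p → K}
    (h : ∑ i : Fin p, s ^ (i : ℕ) * w i ^ p = ∑ i : Fin p, s ^ (i : ℕ) * w' i ^ p) : w = w' := by
  have hli := linearIndependent_pow_of_notMem_frobenius hs
  rw [Fintype.linearIndependent_iff] at hli
  let c : Fin p → (frobenius K p).fieldRange := fun i => ⟨(w i - w' i) ^ p, w i - w' i, rfl⟩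
  have hc : ∑ i : Fin p, c i • s ^ (i : ℕ) = 0 := by
    rw [← sub_eq_zero, ← Finset.sum_sub_distrib] at h
    rw [← h]
    refine Finset.sum_congr rfl fun i _ => ?_
    rw [← mul_sub, ← sub_pow_char, mul_comm]
    rfl
  funext i
  exact sub_eq_zero.1 ((pow_eq_zero_iff (Fact.out (p := p.Prime)).ne_zero).1
    (congrArg Subtype.val (hli c hc i)))

end

/-! ### Rational functions over a perfect field of characteristic `p` -/

section

variable {k : Type*} [Field k] {p : ℕ} [Fact p.Prime] [CharP k p]

/-- The degree of a `p`-th power is divisible by `p`, while `t` has degree `1`. -/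
theorem ratFunc_X_notMem_frobenius [CharP (RatFunc k) p] :
    (RatFunc.X : RatFunc k) ∉ (frobenius (RatFunc k) p).fieldRange := by
  rintro ⟨y, hy⟩
  have hy0 : y ≠ 0 := by
    rintro rfl
    rw [map_zero] at hy
    exact RatFunc.X_ne_zero hy.symm
  have key : ∀ n : ℕ, (y ^ n).intDegree = n * y.intDegree := by
    intro n
    induction n with
    | zero => simp
    | succ n ih => rw [pow_succ, RatFunc.intDegree_mul (pow_ne_zero _ hy0) hy0, ih]; push_cast; ring
  have h1 := congrArg RatFunc.intDegree hy
  rw [frobenius_def, key, RatFunc.intDegree_X] at h1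
  have h2 : (p : ℤ) ∣ 1 := ⟨_, h1.symm⟩
  exact (Fact.out (p := p.Prime)).one_lt.ne' (by exact_mod_cast Int.eq_one_of_dvd_one (by omega) h2)

/-- The span of `1, t, …, t ^ (p - 1)` over the `p`-th powers contains the constants, since `k` is
perfect, and is stable under multiplication by `t`; so it contains all polynomials. -/
theorem ratFunc_exists_eq_sum [PerfectField k] [CharP (RatFunc k) p] (z : RatFunc k) :
    ∃ w : Fin p → RatFunc k, z = ∑ i : Fin p, RatFunc.X ^ (i : ℕ) * w i ^ p := by
  have hp := Fact.out (p := p.Prime)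
  have : PerfectRing k p := PerfectField.toPerfectRing p
  set F := (frobenius (RatFunc k) p).fieldRange
  set S := Submodule.span F (Set.range fun i : Fin p => (RatFunc.X : RatFunc k) ^ (i : ℕ))
  have smul : ∀ (a : RatFunc k) {x : RatFunc k}, x ∈ S → a ^ p * x ∈ S := fun a x hx =>
    S.smul_mem (⟨a ^ p, a, rfl⟩ : F) hx
  have hX : ∀ x ∈ S, x * RatFunc.X ∈ S := by
    intro x hx
    induction hx using Submodule.span_induction with
    | mem x hx =>
      obtain ⟨i, rfl⟩ := hx
      rcases Nat.lt_or_ge (i + 1) p with hi | hi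
      · exact Submodule.subset_span ⟨⟨i + 1, hi⟩, pow_succ _ _⟩
      · have hi' : (i : ℕ) + 1 = p := le_antisymm i.2 hi
        have h1 : (1 : RatFunc k) ∈ S := Submodule.subset_span ⟨⟨0, hp.pos⟩, pow_zero _⟩
        simpa [← pow_succ, hi'] using smul RatFunc.X h1
    | zero => rw [zero_mul]; exact S.zero_mem
    | add x y _ _ hx hy => rw [add_mul]; exact S.add_mem hx hy
    | smul a x _ hx => rw [smul_mul_assoc]; exact S.smul_mem a hx
  have hpoly : ∀ f : Polynomial k, algebraMap _ (RatFunc k) f ∈ S := by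
    have hC : ∀ c : k, RatFunc.C c ∈ S := by
      intro c
      obtain ⟨b, rfl⟩ := surjective_frobenius k p c
      have h1 : (1 : RatFunc k) ∈ S := Submodule.subset_span ⟨⟨0, hp.pos⟩, pow_zero _⟩
      simpa [frobenius_def] using smul (RatFunc.C b) h1
    intro f
    induction f using Polynomial.induction_on with
    | C c => simpa using hC c
    | add f g hf hg => rw [map_add]; exact S.add_mem hf hg
    | monomial n c h =>
      rw [pow_succ, ← mul_assoc, map_mul, RatFunc.algebraMap_X]
      exact hX _ h
  have hz : z ∈ S := by
    have hg : algebraMap _ (RatFunc k) z.denom ≠ 0 := RatFunc.algebraMap_ne_zero z.denom_ne_zero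
    have h1 := smul (algebraMap _ (RatFunc k) z.denom)⁻¹ (hpoly (z.num * z.denom ^ (p - 1)))
    -- A fraction `f / g` equals `(1 / g) ^ p * (f * g ^ (p - 1))`, a scalar times a polynomial.
    have h2 : z = (algebraMap _ (RatFunc k) z.denom)⁻¹ ^ p *
        algebraMap _ (RatFunc k) (z.num * z.denom ^ (p - 1)) := by
      conv_lhs => rw [← RatFunc.num_div_denom z]
      have h3 : algebraMap _ (RatFunc k) z.denom ^ p = algebraMap _ (RatFunc k) z.denom *
          algebraMap _ (RatFunc k) z.denom ^ (p - 1) := by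
        rw [← pow_succ', Nat.sub_add_cancel hp.one_le]
      rw [map_mul, map_pow, inv_pow, h3]
      field_simp
    rwa [← h2] at h1
  obtain ⟨c, hc⟩ := (Submodule.mem_span_range_iff_exists_fun _).1 hz
  choose w hw using fun i => (c i).2
  refine ⟨w, hc.symm.trans (Finset.sum_congr rfl fun i _ => ?_)⟩
  rw [show w i ^ p = c i from hw i, mul_comm]
  rfl

end

/-! ### The pairing on rational function fields of characteristic `p = q + 2` -/

/-- `z = ∑_{i < p} s ^ i * w_i ^ p` with `w_0 = u` and `w_1 = v`, in the variables `z, u, v, s`. -/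
noncomputable def coordinatesFormula (q : ℕ) : FirstOrder.Language.ring.BoundedFormula Empty 4 :=
  exMany (q + 2)
    (polyEq (.of (Fin.castAdd _ 0)) (∑ i : Fin (q + 2), .of (Fin.castAdd _ 3) ^ (i : ℕ) *
        .of (Fin.natAdd 4 i) ^ (q + 2)) ⊓
      (polyEq (.of (Fin.castAdd _ 1)) (.of (Fin.natAdd 4 0)) ⊓
        polyEq (.of (Fin.castAdd _ 2)) (.of (Fin.natAdd 4 1))))

/-- The formula in `z, u, v` that defines the pairing, with respect to the constant `t`. -/
noncomputable def pairingFormula (q : ℕ) : ringWithConst.BoundedFormula Empty 3 :=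
  BoundedFormula.ex (.equal (.var (.inr 3)) (constTerm 4) ⊓ liftFormula (coordinatesFormula q))

theorem level_pairingFormula (q : ℕ) : Level 1 (pairingFormula q) :=
  .ex le_rfl (.inf (.qf (.of_isAtomic (.equal _ _)))
    (level_liftFormula (.exMany (.inf level_polyEq (.inf level_polyEq level_polyEq)))))

section

variable {K : Type*} [Field K] {q : ℕ}

theorem ringHolds_coordinatesFormula {v : Fin 4 → K} :
    RingHolds K (coordinatesFormula q) v ↔ ∃ w : Fin (q + 2) → K,
      v 0 = ∑ i : Fin (q + 2), v 3 ^ (i : ℕ) * w i ^ (q + 2) ∧ v 1 = w 0 ∧ v 2 = w 1 := by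
  rw [coordinatesFormula, ringHolds_exMany]
  simp only [ringHolds_inf, ringHolds_polyEq, map_sum, map_mul, map_pow, FreeCommRing.lift_of,
    Fin.append_left, Fin.append_right]

theorem pointedHolds_pairingFormula {s z u w : K} :
    PointedHolds K s (pairingFormula q) ![z, u, w] ↔ ∃ y : Fin (q + 2) → K,
      z = ∑ i : Fin (q + 2), s ^ (i : ℕ) * y i ^ (q + 2) ∧ u = y 0 ∧ w = y 1 := by
  rw [pairingFormula, pointedHolds_ex]
  simp only [pointedHolds_inf, pointedHolds_liftFormula, ringHolds_coordinatesFormula]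
  constructor
  · rintro ⟨x, h1, h2⟩
    have h1 : x = s := h1
    rwa [h1] at h2
  · exact fun h => ⟨s, rfl, h⟩

/-- Existence and uniqueness of coordinates give a map. It is onto because `w_0` and `w_1` can be
prescribed and the other coordinates set to `0`. -/
theorem isPairing_pairingFormula [Fact (q + 2).Prime] [CharP K (q + 2)] {s t : K}
    (hs : s ∉ (frobenius K (q + 2)).fieldRange) (ht : t ∉ (frobenius K (q + 2)).fieldRange)
    (h : ∀ z : K, ∃ w : Fin (q + 2) → K, z = ∑ i : Fin (q + 2), t ^ (i : ℕ) * w i ^ (q + 2)) :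
    IsPairing (pairingFormula q) K s where
  total z := by
    obtain ⟨w, hw⟩ := exists_eq_sum_pow_mul_pow hs ht h z
    exact ⟨w 0, w 1, pointedHolds_pairingFormula.2 ⟨w, hw, rfl, rfl⟩⟩
  unique h1 h2 := by
    obtain ⟨y, rfl, rfl, rfl⟩ := pointedHolds_pairingFormula.1 h1
    obtain ⟨y', hy, rfl, rfl⟩ := pointedHolds_pairingFormula.1 h2
    rw [eq_of_sum_pow_mul_pow_eq hs hy]
    exact ⟨rfl, rfl⟩
  surjective u w := ⟨_, pointedHolds_pairingFormula.2
    ⟨Fin.cons u (Fin.cons w fun _ => 0), rfl, rfl, rfl⟩⟩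

theorem isPairing_ratFunc {k : Type*} [Field k] [PerfectField k] [Fact (q + 2).Prime]
    [CharP k (q + 2)] [CharP (RatFunc k) (q + 2)] {s : RatFunc k}
    (hs : s ∉ (frobenius (RatFunc k) (q + 2)).fieldRange) :
    IsPairing (pairingFormula q) (RatFunc k) s :=
  isPairing_pairingFormula hs ratFunc_X_notMem_frobenius ratFunc_exists_eq_sum

/-- `x_0` is a `p`-th power. -/
noncomputable def powFormula (q : ℕ) : FirstOrder.Language.ring.BoundedFormula Empty 2 :=
  (polyEq (.of 0) (.of 2 ^ (q + 2))).ex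

theorem level_powFormula (q : ℕ) : Level 1 (powFormula q) := .ex le_rfl level_polyEq

theorem ringHolds_powFormula [Fact (q + 2).Prime] [CharP K (q + 2)] {v : Fin 2 → K} :
    RingHolds K (powFormula q) v ↔ v 0 ∈ (frobenius K (q + 2)).fieldRange := by
  simp only [powFormula, ringHolds_ex, ringHolds_polyEq, map_pow, FreeCommRing.lift_of]
  exact exists_congr fun x => eq_comm

/-- The sentence `∀ s z (s ∈ K ^ p ∨ θ_s(z))`. -/
noncomputable def forallBase (q : ℕ) (θ : ringWithConst.BoundedFormula Empty 1) :
    FirstOrder.Language.ring.Sentence :=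
  BoundedFormula.all (BoundedFormula.all (powFormula q ⊔ constToVar θ))

theorem forallBase_mem {θ : ringWithConst.BoundedFormula Empty 1} (h : Level 1 θ) :
    forallBase q θ ∈ allNExFragment 2 _ _ 0 :=
  all_all_mem_allNExFragment_two (.sup (level_powFormula q) (level_constToVar h))

section

variable {k : Type*} [Field k] [PerfectField k] [Fact (q + 2).Prime] [CharP k (q + 2)]

theorem pointedHolds_ratFunc_iff_forall {φ : ringWithConst.Sentence}
    {θ : ringWithConst.BoundedFormula Empty 1} (h : MergeRel (pairingFormula q) φ θ) :
    PointedHolds (RatFunc k) RatFunc.X φ Fin.elim0 ↔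
      PointedHolds (RatFunc k) RatFunc.X θ.all Fin.elim0 := by
  have : CharP (RatFunc k) (q + 2) := charP_of_injective_algebraMap
    (algebraMap k (RatFunc k)).injective _
  exact h.pointedHolds_iff (isPairing_ratFunc ratFunc_X_notMem_frobenius) _

/-- The lifted `φ` does not mention the constant, so `∀ z θ_s(z)` has the same truth value for every
`s` outside `K ^ p`. Since `t` is such an `s`, quantifying over all of them is not vacuous. -/
theorem ringHolds_ratFunc_iff_forallBase {φ : FirstOrder.Language.ring.Sentence}
    {θ : ringWithConst.BoundedFormula Empty 1}
    (h : MergeRel (pairingFormula q) (liftFormula φ) θ) :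
    RingHolds (RatFunc k) φ Fin.elim0 ↔ RingHolds (RatFunc k) (forallBase q θ) Fin.elim0 := by
  have : CharP (RatFunc k) (q + 2) := charP_of_injective_algebraMap
    (algebraMap k (RatFunc k)).injective _
  have key : ∀ s : RatFunc k, s ∉ (frobenius (RatFunc k) (q + 2)).fieldRange →
      (RingHolds (RatFunc k) φ Fin.elim0 ↔
        ∀ z, PointedHolds (RatFunc k) s θ (Fin.snoc Fin.elim0 z)) := fun s hs => by
    rw [← h.pointedHolds_iff (isPairing_ratFunc hs), pointedHolds_liftFormula]
  have htail : ∀ s z : RatFunc k, Fin.tail (Fin.snoc (Fin.snoc Fin.elim0 s : Fin 1 → RatFunc k) z :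
      Fin 2 → RatFunc k) = Fin.snoc Fin.elim0 z := by
    intro s z
    funext i
    rw [Fin.eq_zero i]
    rfl
  simp only [forallBase, ringHolds_all, ringHolds_sup, ringHolds_powFormula, ringHolds_constToVar,
    htail]
  constructor
  · intro hφ s z
    by_cases hs : s ∈ (frobenius (RatFunc k) (q + 2)).fieldRange
    · exact .inl hs
    · exact .inr ((key s hs).1 hφ z)
  · intro hφ
    exact (key _ ratFunc_X_notMem_frobenius).2 fun z =>
      (hφ RatFunc.X z).resolve_left ratFunc_X_notMem_frobenius

end

end

/-! ### Inclusions of theories of rational function fields over perfect fields -/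

/-- The sentence `p = 0`. -/
noncomputable def charSentence (p : ℕ) : FirstOrder.Language.ring.Sentence :=
  polyEq (p : FreeCommRing (Fin 0)) 0

theorem ringHolds_charSentence {K : Type*} [Field K] {p : ℕ} :
    RingHolds K (charSentence p) Fin.elim0 ↔ (p : K) = 0 := by
  rw [charSentence, ringHolds_polyEq, map_natCast, map_zero]

/-- The pairing formula depends on `p`; this carries the characteristic of `k` over to `l`, so that
the same formula serves both fields. -/
theorem charP_of_ringHolds_ratFunc {l : Type*} [Field l] {p : ℕ} [Fact p.Prime]
    (h : RingHolds (RatFunc l) (charSentence p) Fin.elim0) : CharP l p := by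
  rw [CharP.charP_iff_prime_eq_zero Fact.out]
  apply (algebraMap l (RatFunc l)).injective
  rw [map_natCast, map_zero]
  exact ringHolds_charSentence.1 h

theorem ringHolds_ratFunc_charSentence (k : Type*) [Field k] (p : ℕ) [CharP k p] :
    RingHolds (RatFunc k) (charSentence p) Fin.elim0 := by
  rw [ringHolds_charSentence, ← map_natCast (algebraMap k (RatFunc k)), CharP.cast_eq_zero,
    map_zero]

section

variable {k l : Type*} [Field k] [Field l] [PerfectField k] [PerfectField l]

theorem pointedTheory_allEx_ratFunc_subset (q : ℕ) [Fact (q + 2).Prime] [CharP k (q + 2)]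
    (h : pointedFieldTheory (allNExFragment 1 _ _) (RatFunc k) RatFunc.X ⊆
      pointedFieldTheory (allNExFragment 1 _ _) (RatFunc l) RatFunc.X) :
    pointedFieldTheory (allExFragment _ _) (RatFunc k) RatFunc.X ⊆
      pointedFieldTheory (allExFragment _ _) (RatFunc l) RatFunc.X := by
  have key : ∀ {φ : ringWithConst.Sentence}, Level 3 φ →
      PointedHolds (RatFunc k) RatFunc.X φ Fin.elim0 →
      PointedHolds (RatFunc l) RatFunc.X φ Fin.elim0 := fun h1 h2 =>
    (mem_pointedFieldTheory.1 (h (mem_pointedFieldTheory.2 ⟨mem_allNExFragment_one.2 h1, h2⟩))).2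
  have : CharP l (q + 2) := charP_of_ringHolds_ratFunc (pointedHolds_liftFormula.1
    (key (level_liftFormula level_polyEq)
      (pointedHolds_liftFormula.2 (ringHolds_ratFunc_charSentence k (q + 2)))))
  intro φ hφ
  rw [mem_pointedFieldTheory] at hφ ⊢
  refine ⟨hφ.1, ?_⟩
  obtain ⟨θ, hθ, -⟩ := exists_mergeRel (pairingFormula q) (mem_allExFragment.1 hφ.1)
  rw [pointedHolds_ratFunc_iff_forall hθ] at hφ ⊢
  exact key (.allOnce (hθ.level (level_pairingFormula q))) hφ.2

theorem fieldTheory_allEx_ratFunc_subset (q : ℕ) [Fact (q + 2).Prime] [CharP k (q + 2)]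
    (h : fieldTheory (allNExFragment 2 _ _) (RatFunc k) ⊆
      fieldTheory (allNExFragment 2 _ _) (RatFunc l)) :
    fieldTheory (allExFragment _ _) (RatFunc k) ⊆ fieldTheory (allExFragment _ _) (RatFunc l) := by
  have key : ∀ {φ : FirstOrder.Language.ring.Sentence}, φ ∈ allNExFragment 2 _ _ 0 →
      RingHolds (RatFunc k) φ Fin.elim0 → RingHolds (RatFunc l) φ Fin.elim0 := fun h1 h2 =>
    (mem_fieldTheory.1 (h (mem_fieldTheory.2 ⟨h1, h2⟩))).2
  have : CharP l (q + 2) := charP_of_ringHolds_ratFunc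
    (key (mem_allNExFragment_two_of_level_one level_polyEq)
      (ringHolds_ratFunc_charSentence k (q + 2)))
  intro φ hφ
  rw [mem_fieldTheory] at hφ ⊢
  refine ⟨hφ.1, ?_⟩
  obtain ⟨θ, hθ, -⟩ := exists_mergeRel (pairingFormula q)
    (level_liftFormula (mem_allExFragment.1 hφ.1))
  rw [ringHolds_ratFunc_iff_forallBase hθ] at hφ ⊢
  exact key (forallBase_mem (hθ.level (level_pairingFormula q))) hφ.2

end

/-! ### Decidable theories -/

theorem DecidableTheory.exists_computable {L : FirstOrder.Language.{u, v}}
    [∀ n, IsEmpty (L.Relations n)] {P : Presentation L} {T : Set L.Sentence}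
    (h : DecidableTheory P T) :
    ∃ d : ℕ → Bool, Computable d ∧ ∀ φ : L.Sentence, d (P.code φ) = true ↔ φ ∈ T := by
  obtain ⟨d, hd, hT⟩ := ComputablePred.computable_iff.1 h
  refine ⟨d, hd, fun φ => (iff_of_eq (congrFun hT (P.code φ))).symm.trans ⟨?_, fun h => ⟨φ, h, rfl⟩⟩⟩
  rintro ⟨ψ, hψ, h1⟩
  rwa [← code_injective P h1]

/-- A theory is decidable if it consists of the sentences with numbers in a primitive recursive set
that a computable function accepts. -/
theorem decidableTheory_of_computable {L : FirstOrder.Language.{u, v}}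
    [∀ n, IsEmpty (L.Relations n)] {P : Presentation L} {T : Set L.Sentence} {valid d : ℕ → Bool}
    (hvalid : Primrec valid) (hd : Computable d) {F : Set L.Sentence}
    (hF : ∀ m, valid m = true ↔ ∃ φ ∈ F, P.code φ = m)
    (hT : ∀ φ, φ ∈ T ↔ φ ∈ F ∧ d (P.code φ) = true) : DecidableTheory P T := by
  refine ComputablePred.computable_iff.2 ⟨fun m => valid m && d m,
    Primrec.and.to_comp.comp hvalid.to_comp hd, ?_⟩
  funext m
  rw [Bool.and_eq_true, hF, eq_iff_iff]
  constructor
  · rintro ⟨φ, h1, rfl⟩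
    exact ⟨⟨φ, ((hT φ).1 h1).1, rfl⟩, ((hT φ).1 h1).2⟩
  · rintro ⟨⟨φ, h1, rfl⟩, h2⟩
    exact ⟨φ, (hT φ).2 ⟨h1, h2⟩, rfl⟩

/-- Many-one reduction on Gödel numbers. The test `valid` is needed because `f` is only controlled
on numbers of sentences in `F`. -/
theorem DecidableTheory.of_reduction {L : FirstOrder.Language.{u, v}}
    [∀ n, IsEmpty (L.Relations n)] {P : Presentation L} {T F : Set L.Sentence}
    {L' : FirstOrder.Language.{u, v}} [∀ n, IsEmpty (L'.Relations n)] {P' : Presentation L'}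
    {T' : Set L'.Sentence} (h : DecidableTheory P' T') {valid : ℕ → Bool} {f : ℕ → ℕ}
    (hvalid : Primrec valid) (hf : Primrec f) (hF : ∀ m, valid m = true ↔ ∃ φ ∈ F, P.code φ = m)
    (hTF : T ⊆ F)
    (hT : ∀ φ ∈ F, ∃ ψ : L'.Sentence, P'.code ψ = f (P.code φ) ∧ (φ ∈ T ↔ ψ ∈ T')) :
    DecidableTheory P T := by
  obtain ⟨d, hd, hT'⟩ := h.exists_computable
  refine decidableTheory_of_computable hvalid (hd.comp hf.to_comp) hF fun φ => ?_
  have key : φ ∈ F → (φ ∈ T ↔ d (f (P.code φ)) = true) := fun hφ => by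
    obtain ⟨ψ, h1, h2⟩ := hT φ hφ
    rw [← h1, h2, hT']
  exact ⟨fun h => ⟨hTF h, (key (hTF h)).1 h⟩, fun h => (key h.1).2 h.2⟩

theorem primrec_formValid_sentence (ar : List ℕ) (l : ℕ) :
    Primrec fun m : ℕ => formValid ar (l, 0, m) :=
  (primrec_formValid ar).comp (by fun_prop)

theorem formValid_ring_fragment {l m : ℕ} {F : FormulaSet FirstOrder.Language.ring Empty}
    (h : ∀ φ : FirstOrder.Language.ring.Sentence, φ ∈ F 0 ↔ Level l φ) :
    formValid ringArities (l, 0, m) = true ↔ ∃ φ ∈ F 0, ringPresentation.code φ = m :=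
  formValid_ring_iff.trans (exists_congr fun φ => and_congr_left fun _ => (h φ).symm)

theorem formValid_pointed_fragment {l m : ℕ} {F : FormulaSet ringWithConst Empty}
    (h : ∀ φ : ringWithConst.Sentence, φ ∈ F 0 ↔ Level l φ) :
    formValid pointedArities (l, 0, m) = true ↔
      ∃ φ ∈ F 0, ringWithConstPresentation.code φ = m :=
  formValid_pointed_iff.trans (exists_congr fun φ => and_congr_left fun _ => (h φ).symm)

/-! ### Perfect fields -/

section

variable {k : Type*} [Field k] [PerfectField k]

theorem decidable_pointedTheory_allEx_ratFunc (q : ℕ) [Fact (q + 2).Prime] [CharP k (q + 2)]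
    (h : DecidableTheory ringWithConstPresentation
      (pointedFieldTheory (allNExFragment 1 _ _) (RatFunc k) RatFunc.X)) :
    DecidableTheory ringWithConstPresentation
      (pointedFieldTheory (allExFragment _ _) (RatFunc k) RatFunc.X) := by
  refine h.of_reduction (f := fun m => allCode
      (mergeCode (ringWithConstPresentation.code (pairingFormula q)) (0, m)))
    (primrec_formValid_sentence pointedArities 2) ?_
    (fun m => formValid_pointed_fragment fun φ => mem_allExFragment) (fun _ h => h.1) ?_
  · exact primrec_allCode ((primrec_mergeCode _).comp (by fun_prop))
  · intro φ hφ
    obtain ⟨θ, h1, h2⟩ := exists_mergeRel (pairingFormula q) (mem_allExFragment.1 hφ)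
    refine ⟨θ.all, by rw [code_all, h2], ?_⟩
    rw [mem_pointedFieldTheory, mem_pointedFieldTheory, pointedHolds_ratFunc_iff_forall h1]
    exact and_congr_left fun _ => iff_of_true hφ
      (mem_allNExFragment_one.2 (.allOnce (h1.level (level_pairingFormula q))))

theorem decidable_fieldTheory_allEx_ratFunc (q : ℕ) [Fact (q + 2).Prime] [CharP k (q + 2)]
    (h : DecidableTheory ringPresentation (fieldTheory (allNExFragment 2 _ _) (RatFunc k))) :
    DecidableTheory ringPresentation (fieldTheory (allExFragment _ _) (RatFunc k)) := by
  refine h.of_reduction (f := fun m => allCode (allCode (supCode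
      (ringPresentation.code (powFormula q)) (substCode (([], 1, 0),
        mergeCode (ringWithConstPresentation.code (pairingFormula q)) (0, m))))))
    (primrec_formValid_sentence ringArities 2) ?_
    (fun m => formValid_ring_fragment fun φ => mem_allExFragment) (fun _ h => h.1) ?_
  · have : Primrec fun m => mergeCode (ringWithConstPresentation.code (pairingFormula q)) (0, m) :=
      (primrec_mergeCode _).comp (by fun_prop)
    fun_prop
  · intro φ hφ
    obtain ⟨θ, h1, h2⟩ := exists_mergeRel (pairingFormula q)
      (level_liftFormula (mem_allExFragment.1 hφ))
    refine ⟨forallBase q θ, ?_, ?_⟩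
    · rw [forallBase, code_all, code_all, code_sup, code_constToVar, h2, code_liftFormula]
    rw [mem_fieldTheory, mem_fieldTheory, ringHolds_ratFunc_iff_forallBase h1]
    exact and_congr_left fun _ => iff_of_true hφ
      (forallBase_mem (h1.level (level_pairingFormula q)))

end

/-! ### Existentially definable constants -/

theorem Level.relabel {L : FirstOrder.Language.{u, v}} {α β : Type*} {n l m : ℕ}
    {φ : L.BoundedFormula α m} (h : Level l φ) (g : α → β ⊕ Fin n) : Level l (φ.relabel g) := by
  induction h with
  | qf h => exact .qf (h.relabel g)
  | ex h0 _ ih => rw [BoundedFormula.relabel_ex]; exact .ex h0 ih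
  | allMany _ ih => rw [BoundedFormula.relabel_all]; exact .allMany ih
  | allOnce _ ih => rw [BoundedFormula.relabel_all]; exact .allOnce ih
  | inf _ _ h1 h2 => exact .inf h1 h2
  | sup _ _ h1 h2 => exact .sup h1 h2

section

variable {k : Type*} [Field k]

/-- Moves the free variable to the indexed variables, where it can be quantified. -/
theorem exists_formula_of_existentiallyDefinable {S : Set k} (h : ExistentiallyDefinable k S) :
    ∃ γ : FirstOrder.Language.ring.BoundedFormula Empty 1, Level 1 γ ∧
      ∀ x, RingHolds k γ (fun _ => x) ↔ x ∈ S := by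
  let _ := Ring.compatibleRingOfRing k
  obtain ⟨γ, h1, rfl⟩ := h
  refine ⟨BoundedFormula.relabel (fun i => (Sum.inr i : Empty ⊕ Fin 1)) γ, (mem_exFragment.1 h1).relabel _,
    fun x => ?_⟩
  refine (BoundedFormula.realize_relabel (xs := fun _ : Fin (1 + 0) => x)).trans ?_
  rw [Set.mem_ofPred, Formula.Realize]
  exact iff_of_eq (congrArg₂ _ rfl (Subsingleton.elim _ _))

/-- If `φ` holds at `t`, it holds at every nonconstant element by the endomorphisms of `k(t)`;
conversely, `t` itself is not constant. -/
theorem pointedHolds_ratFunc_iff_all {γ : FirstOrder.Language.ring.BoundedFormula Empty 1}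
    (hγ : ∀ x, RingHolds (RatFunc k) γ (fun _ => x) ↔ x ∈ Set.range (algebraMap k (RatFunc k)))
    {φ : ringWithConst.Sentence} (h : Level 1 φ) :
    PointedHolds (RatFunc k) RatFunc.X φ Fin.elim0 ↔
      RingHolds (RatFunc k) (γ ⊔ constToVar φ).all Fin.elim0 := by
  simp only [ringHolds_all, ringHolds_sup, snoc_elim0, hγ, ringHolds_constToVar]
  have helim : ∀ (x : RatFunc k) {f : Fin 0 → RatFunc k},
      PointedHolds (RatFunc k) x φ f ↔ PointedHolds (RatFunc k) x φ Fin.elim0 := fun x f => by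
    rw [Subsingleton.elim f Fin.elim0]
  simp only [helim]
  constructor
  · intro hφ x
    refine or_iff_not_imp_left.2 fun hx => ?_
    exact (helim x).1 (pointedHolds_ratFunc_of_X h (v := Fin.elim0) ((helim _).2 hφ) hx)
  · exact fun hφ => (hφ RatFunc.X).resolve_left ratFunc_X_notMem_range

theorem decidable_pointedTheory_ex_ratFunc
    (h : DecidableTheory ringPresentation (fieldTheory (allNExFragment 1 _ _) (RatFunc k)))
    (hdef : ExistentiallyDefinable (RatFunc k) (Set.range (algebraMap k (RatFunc k)))) :
    DecidableTheory ringWithConstPresentation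
      (pointedFieldTheory (exFragment _ _) (RatFunc k) RatFunc.X) := by
  obtain ⟨γ, h1, h2⟩ := exists_formula_of_existentiallyDefinable hdef
  refine h.of_reduction (f := fun m => allCode (supCode (ringPresentation.code γ)
      (substCode (([], 1, 0), m))))
    (primrec_formValid_sentence pointedArities 1)
    (by fun_prop) (fun m => formValid_pointed_fragment fun φ => mem_exFragment) (fun _ h => h.1) ?_
  intro φ hφ
  refine ⟨(γ ⊔ constToVar φ).all, by rw [code_all, code_sup, code_constToVar], ?_⟩
  rw [mem_fieldTheory, mem_pointedFieldTheory, pointedHolds_ratFunc_iff_all h2 (mem_exFragment.1 hφ)]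
  exact and_congr_left fun _ => iff_of_true hφ
    (mem_allNExFragment_one.2 (.allOnce (.sup h1 (level_constToVar (mem_exFragment.1 hφ)))))

end

/-! ### Decidability of the theory of a rational function field -/

section

/-- Here the step may call a decision procedure that is merely computable. The table of all earlier
values is built by strong recursion, and the recursive calls are read off from it. -/
theorem computable_measureRec {l : ℕ → List ℕ} {g : ℕ → List Bool → Bool}
    {ord : ∀ b, ∀ b' ∈ l b, b' < b} (hl : Primrec l) (hg : Computable₂ g) :
    Computable (measureRec id l g ord) := by
  have h1 : Primrec fun p : Unit × List Bool => p.2.length := by fun_prop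
  have h2 : Primrec fun p : Unit × List Bool => (l p.2.length).map fun i => p.2.getD i false :=
    Primrec.list_map (hl.comp h1) (by unfold Primrec₂; fun_prop)
  have h := Computable.nat_strong_rec (α := Unit) (fun _ => measureRec id l g ord)
    (g := fun _ r => some (g r.length ((l r.length).map fun i => r.getD i false)))
    (Computable.option_some.comp (hg.comp h1.to_comp h2.to_comp))
    (fun _ n => by
      rw [measureRec_eq (m := id) n]
      simp only [List.length_map, List.length_range]
      congr 2
      refine List.map_congr_left fun i hi => ?_
      have := ord n i hi
      simp [List.getD, this])
  exact h.comp (Computable.const ()) Computable.id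

theorem computable_list_all {d : ℕ → Bool} (hd : Computable d) {f : ℕ → ℕ → ℕ} (hf : Primrec₂ f) :
    ∀ s : List ℕ, Computable fun a => s.all fun e => d (f e a)
  | [] => Computable.const _
  | e :: s => Primrec.and.to_comp.comp
      (hd.comp (hf.comp (Primrec.const e) Primrec.id).to_comp) (computable_list_all hd hf s)

/-- Recursive calls in the evaluation of sentences with one universal quantifier. -/
def evalCalls (m : ℕ) : List ℕ :=
  cond (decide ((shape m).1 = 2) || decide ((shape m).1 = 3)) [(shape m).2.1, (shape m).2.2] []

/-- One step of the evaluation of sentences with one universal quantifier, where `r` holds the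
results of the recursive calls. -/
def evalStep (d leaf : ℕ → Bool) (m : ℕ) (r : List Bool) : Bool :=
  cond (formValid ringArities (1, 0, m)) (d m)
    (cond (decide ((shape m).1 = 5)) (leaf (shape m).2.1)
      (cond (decide ((shape m).1 = 2)) (r.getD 0 false && r.getD 1 false)
        (r.getD 0 false || r.getD 1 false)))

theorem evalCalls_lt (b b' : ℕ) (h : b' ∈ evalCalls b) : b' < b := by
  have key := @shape_lt b
  by_cases hs : (shape b).1 = 2 ∨ (shape b).1 = 3
  · have : evalCalls b = [(shape b).2.1, (shape b).2.2] := by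
      rcases hs with hs | hs <;> simp [evalCalls, hs]
    rw [this] at h
    simp only [List.mem_cons, List.not_mem_nil, or_false] at h
    rcases h with rfl | rfl
    · exact (key (by omega) (by omega)).1
    · exact (key (by omega) (by omega)).2
  · rw [not_or] at hs
    simp [evalCalls, hs] at h

/-- The truth value of a sentence with one universal quantifier, where `d` decides the existential
sentences and `leaf` the universal quantifications of existential formulas. -/
def evalCode (d leaf : ℕ → Bool) : ℕ → Bool :=
  measureRec id evalCalls (evalStep d leaf) evalCalls_lt

theorem evalCode_eq (d leaf : ℕ → Bool) (m : ℕ) : evalCode d leaf m =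
    evalStep d leaf m ((evalCalls m).map (evalCode d leaf)) :=
  measureRec_eq m

theorem computable_evalCode {d leaf : ℕ → Bool} (hd : Computable d) (hleaf : Computable leaf) :
    Computable (evalCode d leaf) := by
  refine computable_measureRec (Primrec.cond (by fun_prop) (by fun_prop) (by fun_prop)) ?_
  have p1 : Primrec fun p : ℕ × List Bool => formValid ringArities (1, 0, p.1) :=
    (primrec_formValid_sentence _ 1).comp Primrec.fst
  have p2 : Primrec fun p : ℕ × List Bool => decide ((shape p.1).1 = 5) := by fun_prop
  have p3 : Primrec fun p : ℕ × List Bool => cond (decide ((shape p.1).1 = 2))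
      (p.2.getD 0 false && p.2.getD 1 false) (p.2.getD 0 false || p.2.getD 1 false) :=
    Primrec.cond (by fun_prop) (by fun_prop) (by fun_prop)
  have p4 : Primrec fun p : ℕ × List Bool => (shape p.1).2.1 := by fun_prop
  exact Computable.cond p1.to_comp (hd.comp Computable.fst)
    (Computable.cond p2.to_comp (hleaf.comp p4.to_comp) p3.to_comp)

/-- Level `3` sentences are positive Boolean combinations of existential ones and of `∀ x φ(x)` with
`φ` existential. The evaluation passes any existential combination to `d` as a whole. -/
theorem evalCode_iff {K : Type*} [Field K] {d leaf : ℕ → Bool}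
    (hd : ∀ φ : FirstOrder.Language.ring.Sentence, Level 1 φ →
      (d (ringPresentation.code φ) = true ↔ RingHolds K φ Fin.elim0))
    (hleaf : ∀ φ : FirstOrder.Language.ring.BoundedFormula Empty 1, Level 1 φ →
      (leaf (ringPresentation.code φ) = true ↔ RingHolds K φ.all Fin.elim0))
    {φ : FirstOrder.Language.ring.Sentence} (h : Level 3 φ) :
    evalCode d leaf (ringPresentation.code φ) = true ↔ RingHolds K φ Fin.elim0 := by
  have base : ∀ φ : FirstOrder.Language.ring.Sentence,
      formValid ringArities (1, 0, ringPresentation.code φ) = true →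
      (evalCode d leaf (ringPresentation.code φ) = true ↔ RingHolds K φ Fin.elim0) := by
    intro φ hv
    obtain ⟨φ', h1, h2⟩ := formValid_ring_iff.1 hv
    obtain rfl := code_injective _ h2
    rw [evalCode_eq, evalStep, hv, cond_true, hd _ h1]
  refine Level.sentence_induction (fun φ h => base φ (formValid_ring_iff.2 ⟨φ, h, rfl⟩))
    ?_ ?_ ?_ h
  · intro φ h
    by_cases hv : formValid ringArities (1, 0, ringPresentation.code φ.all) = true
    · exact base _ hv
    rw [evalCode_eq, evalStep, Bool.eq_false_iff.2 hv, cond_false, code_all, shape_allCode,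
      decide_eq_true rfl, cond_true, hleaf _ h]
  · intro φ ψ _ _ h1 h2
    by_cases hv : formValid ringArities (1, 0, ringPresentation.code (φ ⊓ ψ)) = true
    · exact base _ hv
    rw [evalCode_eq, evalStep, Bool.eq_false_iff.2 hv, cond_false, ringHolds_inf, ← h1, ← h2,
      code_inf]
    simp [evalCalls, shape_infCode]
  · intro φ ψ _ _ h1 h2
    by_cases hv : formValid ringArities (1, 0, ringPresentation.code (φ ⊔ ψ)) = true
    · exact base _ hv
    rw [evalCode_eq, evalStep, Bool.eq_false_iff.2 hv, cond_false, ringHolds_sup, ← h1, ← h2,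
      code_sup]
    simp [evalCalls, shape_supCode]

end

/-! ### Constants, and the decision procedure -/

section

variable {k : Type*} [Field k]

/-- Every homomorphism from a finite field to its rational function field is an automorphism of the
constants. -/
theorem exists_ringEquiv_of_ringHom_ratFunc [Finite k] (f : k →+* RatFunc k) :
    ∃ e : k ≃+* k, ∀ c, f c = algebraMap k (RatFunc k) (e c) := by
  have := Fintype.ofFinite k
  have hmem : ∀ c, ∃ b, algebraMap k (RatFunc k) b = f c := by
    intro c
    by_contra h
    -- A nonconstant image would be transcendental, but it is a root of `X ^ q - X`, as is every
    -- image of an element of a field with `q` elements.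
    have htr : Transcendental k (f c) := (f c).transcendental_of_ne_C fun ⟨b, hb⟩ => h ⟨b, hb.symm⟩
    refine htr ⟨Polynomial.X ^ Fintype.card k - Polynomial.X,
      FiniteField.X_pow_card_sub_X_ne_zero k Fintype.one_lt_card, ?_⟩
    rw [map_sub, map_pow, Polynomial.aeval_X, ← map_pow, FiniteField.pow_card, sub_self]
  choose σ hσ using hmem
  have hinj := (algebraMap k (RatFunc k)).injective
  let e : k →+* k :=
    { toFun := σ
      map_one' := hinj (by rw [hσ, map_one, map_one])
      map_zero' := hinj (by rw [hσ, map_zero, map_zero])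
      map_add' := fun a b => hinj (by rw [hσ, map_add, map_add, hσ, hσ])
      map_mul' := fun a b => hinj (by rw [hσ, map_mul, map_mul, hσ, hσ]) }
  exact ⟨RingEquiv.ofBijective e (Finite.injective_iff_bijective.1 e.injective),
    fun c => (hσ c).symm⟩

/-- A witness for the full diagram is the image of `c` under an automorphism of `k`. The inverse
automorphism extends to `k(t)` and carries `φ` back to `c`. So truth at `c` is expressed by an
existential sentence without parameters. -/
theorem ringHolds_const_iff_diagram [Fintype k] {φ : FirstOrder.Language.ring.BoundedFormula Empty 1}
    (h : Level 1 φ) (c : k) :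
    RingHolds (RatFunc k) (diagramFormula Finset.univ c ⊓ φ).ex Fin.elim0 ↔
      RingHolds (RatFunc k) φ (fun _ => algebraMap k _ c) := by
  simp only [ringHolds_ex, ringHolds_inf, ringHolds_diagramFormula, snoc_elim0]
  constructor
  · rintro ⟨y, ⟨f, rfl, h1, h2⟩, hφ⟩
    obtain ⟨e, he⟩ := exists_ringEquiv_of_ringHom_ratFunc
      (ringHomOfMap f h1 fun a b => h2 (a, b) (Finset.mem_univ _))
    obtain ⟨g, -, hg⟩ := exists_ratFunc_map (e.symm : k →+* k)
    have h3 : g (f c) = algebraMap k _ c := by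
      rw [show f c = _ from he c, hg]
      simp
    have := ringHolds_map g h hφ
    convert this using 1
    funext i
    exact h3.symm
  · intro hφ
    exact ⟨_, ⟨algebraMap k _, rfl, map_one _, fun _ _ => ⟨map_add _ _ _, map_mul _ _ _⟩⟩, hφ⟩

/-- The algorithm is chosen according to `k`: for finite `k` a fixed list of existential sentences
is tested, for infinite `k` the question is passed to the theory of `k`. -/
theorem exists_computable_forall_const {d d' : ℕ → Bool} (hd : Computable d) (hd' : Computable d')
    (h : ∀ φ : FirstOrder.Language.ring.Sentence, Level 1 φ →
      (d (ringPresentation.code φ) = true ↔ RingHolds (RatFunc k) φ Fin.elim0))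
    (h' : ∀ φ : FirstOrder.Language.ring.Sentence, Level 3 φ →
      (d' (ringPresentation.code φ) = true ↔ RingHolds k φ Fin.elim0)) :
    ∃ leaf : ℕ → Bool, Computable leaf ∧
      ∀ φ : FirstOrder.Language.ring.BoundedFormula Empty 1, Level 1 φ →
        (leaf (ringPresentation.code φ) = true ↔
          ∀ c, RingHolds (RatFunc k) φ (fun _ => algebraMap k _ c)) := by
  rcases finite_or_infinite k with hfin | hinf
  · have := Fintype.ofFinite k
    refine ⟨_, computable_list_all hd (f := fun e a => exCode (infCode e a))
      (by unfold Primrec₂; fun_prop)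
      (Finset.univ.toList.map fun c : k => ringPresentation.code (diagramFormula Finset.univ c)),
      fun φ hφ => ?_⟩
    simp only [List.all_eq_true, List.forall_mem_map, Finset.mem_toList, Finset.mem_univ,
      forall_const]
    refine forall_congr' fun c => ?_
    rw [← ringHolds_const_iff_diagram hφ, ← h _ (.ex le_rfl (.inf (level_diagramFormula _ _) hφ)),
      code_ex, code_inf]
  · refine ⟨fun a => d' (allCode a), hd'.comp (Primrec.to_comp (by fun_prop)), fun φ hφ => ?_⟩
    beta_reduce
    rw [← code_all, h' _ (.allOnce hφ), ringHolds_all]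
    simp only [snoc_elim0]
    exact forall_congr' fun c => ⟨ringHolds_ratFunc hφ, ringHolds_of_ratFunc hφ⟩

theorem decidable_fieldTheory_allNEx_ratFunc
    (h : DecidableTheory ringWithConstPresentation
      (pointedFieldTheory (exFragment _ _) (RatFunc k) RatFunc.X))
    (h' : DecidableTheory ringPresentation (fieldTheory (allNExFragment 1 _ _) k)) :
    DecidableTheory ringPresentation (fieldTheory (allNExFragment 1 _ _) (RatFunc k)) := by
  obtain ⟨d, hd, hT⟩ := h.exists_computable
  obtain ⟨d', hd', hT'⟩ := h'.exists_computable
  replace hT : ∀ φ : ringWithConst.Sentence, Level 1 φ →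
      (d (ringWithConstPresentation.code φ) = true ↔
        PointedHolds (RatFunc k) RatFunc.X φ Fin.elim0) := fun φ hφ => by
    rw [hT, mem_pointedFieldTheory]
    exact and_iff_right (mem_exFragment.2 hφ)
  have h1 : ∀ φ : FirstOrder.Language.ring.Sentence, Level 1 φ →
      (d (ringPresentation.code φ) = true ↔ RingHolds (RatFunc k) φ Fin.elim0) := fun φ hφ => by
    rw [← code_liftFormula, hT _ (level_liftFormula hφ), pointedHolds_liftFormula]
  obtain ⟨leaf, hleaf, hl⟩ := exists_computable_forall_const hd hd' h1 fun φ hφ => by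
    rw [hT', mem_fieldTheory]
    exact and_iff_right (mem_allNExFragment_one.2 hφ)
  let e := ringWithConstPresentation.code
    (.equal (.var (.inr 0)) (constTerm 1) : ringWithConst.BoundedFormula Empty 1)
  -- Decides `φ(t)`, in the form `∃ x (x = t ∧ φ(x))`, together with `φ` at all constants. Lifting
  -- does not change numbers, so `a` may be used directly.
  let leaf' : ℕ → Bool := fun a => d (exCode (infCode e a)) && leaf a
  have hleaf' : Computable leaf' :=
    Primrec.and.to_comp.comp (hd.comp (Primrec.to_comp (by fun_prop))) hleaf
  refine decidableTheory_of_computable (primrec_formValid_sentence ringArities 3)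
    (computable_evalCode hd hleaf')
    (fun m => formValid_ring_fragment fun φ => mem_allNExFragment_one) fun φ => ?_
  rw [mem_fieldTheory]
  refine and_congr_right fun hφ => (evalCode_iff h1 (fun φ hφ => ?_)
    (mem_allNExFragment_one.1 hφ)).symm
  rw [Bool.and_eq_true, hl _ hφ, ringHolds_all_ratFunc hφ, ← code_liftFormula, ← code_inf, ← code_ex]
  refine and_congr_left fun _ => ?_
  rw [← pointedHolds_liftFormula (a := RatFunc.X), ← pointedHolds_atConst]
  exact hT _ (level_atConst (level_liftFormula hφ))

end

end FieldFragments

/-! ### The theorem -/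

open FieldFragments in
theorem theorem1p3 (k : Type*) (l : Type*) [Field k] [Field l] :
    -- existential theory of `k` controls that of `(k(t), t)`
    (fieldTheory (exFragment _ _) k ⊆ fieldTheory (exFragment _ _) l →
      pointedFieldTheory (exFragment _ _) (RatFunc k) RatFunc.X ⊆
        pointedFieldTheory (exFragment _ _) (RatFunc l) RatFunc.X) ∧
    -- `∀₁∃`-theories of `k` and `k(t)`
    (fieldTheory (allNExFragment 1 _ _) k ⊆ fieldTheory (allNExFragment 1 _ _) l →
      fieldTheory (allNExFragment 1 _ _) (RatFunc k) ⊆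
        fieldTheory (allNExFragment 1 _ _) (RatFunc l)) ∧
    -- decidability of the `∀₁∃`-theory of `k(t)`
    (DecidableTheory ringWithConstPresentation
        (pointedFieldTheory (exFragment _ _) (RatFunc k) RatFunc.X) →
      DecidableTheory ringPresentation (fieldTheory (allNExFragment 1 _ _) k) →
      DecidableTheory ringPresentation (fieldTheory (allNExFragment 1 _ _) (RatFunc k))) ∧
    -- decidability of the existential theory of `(k(t), t)`
    (DecidableTheory ringPresentation (fieldTheory (allNExFragment 1 _ _) (RatFunc k)) →
      ExistentiallyDefinable (RatFunc k) (Set.range (algebraMap k (RatFunc k))) →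
      DecidableTheory ringWithConstPresentation
        (pointedFieldTheory (exFragment _ _) (RatFunc k) RatFunc.X)) ∧
    -- perfect fields of positive characteristic
    (PerfectField k → PerfectField l → 0 < ringChar k → 0 < ringChar l →
      (pointedFieldTheory (allNExFragment 1 _ _) (RatFunc k) RatFunc.X ⊆
          pointedFieldTheory (allNExFragment 1 _ _) (RatFunc l) RatFunc.X →
        pointedFieldTheory (allExFragment _ _) (RatFunc k) RatFunc.X ⊆
          pointedFieldTheory (allExFragment _ _) (RatFunc l) RatFunc.X) ∧
      (DecidableTheory ringWithConstPresentation
          (pointedFieldTheory (allNExFragment 1 _ _) (RatFunc k) RatFunc.X) →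
        DecidableTheory ringWithConstPresentation
          (pointedFieldTheory (allExFragment _ _) (RatFunc k) RatFunc.X)) ∧
      (fieldTheory (allNExFragment 2 _ _) (RatFunc k) ⊆
          fieldTheory (allNExFragment 2 _ _) (RatFunc l) →
        fieldTheory (allExFragment _ _) (RatFunc k) ⊆
          fieldTheory (allExFragment _ _) (RatFunc l)) ∧
      (DecidableTheory ringPresentation (fieldTheory (allNExFragment 2 _ _) (RatFunc k)) →
        DecidableTheory ringPresentation (fieldTheory (allExFragment _ _) (RatFunc k)))) := by
  refine ⟨exTheory_ratFunc_subset, allNExTheory_ratFunc_subset,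
    decidable_fieldTheory_allNEx_ratFunc, decidable_pointedTheory_ex_ratFunc, ?_⟩
  intro _ _ hk _
  have hp : (ringChar k).Prime := (CharP.char_is_prime_or_zero k _).resolve_right hk.ne'
  -- Writing `p = q + 2` makes the two coordinates `0` and `1` of the pairing available in `Fin p`.
  obtain ⟨q, hq⟩ := Nat.exists_eq_add_of_le' hp.two_le
  have : Fact (q + 2).Prime := ⟨hq ▸ hp⟩
  have : CharP k (q + 2) := hq ▸ ringChar.charP k
  exact ⟨pointedTheory_allEx_ratFunc_subset q, decidable_pointedTheory_allEx_ratFunc q,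
    fieldTheory_allEx_ratFunc_subset q, decidable_fieldTheory_allEx_ratFunc q⟩
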